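/- **Corollary 1 (Stability under general passive dynamics).** Consider a combined heat and power network with the following data. *Electric part.* A finite set $N_e$ of buses, lines $E_e\subseteq N_e\times N_e$ with susceptances $B_{ij}>0$, generator buses $N_e^G\subseteq N_e$ with inertia $M_j>0$ (all other buses are load buses: $M_j=0$, $p^G_j=0$), damping $D_j>0$, constant loads $p^L_j$, and buses $H_e\subseteq N_e$ with heat pumps ($p^P_j=0$ for $j\notin H_e$): $$M_j\dot\omega_j=-p^L_j-p^P_j+p^G_j-D_j\omega_j+\sum_{i:\,i\to j}p_{ij}-\sum_{k:\,j\to k}p_{jk},\qquad \dot\eta_{ij}=\omega_i-\omega_j,\qquad p_{ij}=B_{ij}\sin\eta_{ij}.$$ *Heating part.* A finite connected directed graph with nodes $N_h$ and edges $E_h$ (edge $j$ leads from node $s(j)$ to node $t(j)$), mass flows $q_j>0$ that are conserved at every node, and volumes $V^E_j,V^N_k>0$: $$V^E_j\dot T^E_j=q_j\,(T^N_{s(j)}-T^E_j)+h^G_j+h^P_j-h^L_j,\qquad V^N_k\dot T^N_k=\sum_{j:\,t(j)=k}q_jT^E_j-\Big(\sum_{j:\,t(j)=k}q_j\Big)T^N_k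 .$$ Here $h^G_j=0$ outside a nonempty set $E_h^G\subseteq E_h$ of edges with conventional heat sources. The heat pump at bus $j\in H_e$ has its own edge $k_j\notin E_h^G$ with $h^P_{k_j}=C_{o,j}p^P_j$, $C_{o,j}>0$, and $h^P=0$ on all other edges. The constants $h^L_j$ vanish on the edges of heat pumps and conventional sources. Let $\bar T=\big(\sum_jV^E_jT^E_j+\sum_kV^N_kT^N_k\big)/\big(\sum_jV^E_j+\sum_kV^N_k\big)$ be the average temperature. *Generation.* For $j\in N_e^G$ and $j\in E_h^G$ respectively, $$\dot x^s_{e,j}=-f_{e,j}(x^s_{e,j},\omega_j),\quad p^G_j=-g_{e,j}(x^s_{e,j},\omega_j);\qquad \dot x^s_{h,j}=-f_{h,j}(x^s_{h,j},\bar T),\quad h^G_j=-g_{h,j}(x^s_{h,j},\bar T),$$ with finite-dimensional states and locally Lipschitz $f_{e,j},g_{e,j},f_{h,j},g_{h,j}$. *Heat pumps.* Either **Mode 1**: $p^P_j=a_{1,j}\omega_j$ with $a_{1,j}>0$ for $j\in H_e$; or **Mode 2**: the buses in $H_e$ are not generator buses, and for them the swing equation is replaced by $$0=-p^P_j+\sum_{i:\,i\to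 j}p_{ij}-\sum_{k:\,j\to k}p_{jk},\qquad \omega_j=m_j\bar T,$$ with $m_j>0$, where the ratio $\alpha=m_j/C_{o,j}$ is the same for all $j\in H_e$ (which is automatic if there is only one heat pump bus). Let $x^*=(\eta^*,\omega^*,x_e^{s*},T^*,x_h^{s*})$ be an equilibrium point of the resulting system with $|\eta^*_{ij}|<\pi/2$ for all $(i,j)\in E_e$. Suppose that every generation subsystem $\dot x=-f(x,u)$, $y=-g(x,u)$, with equilibrium input $u^*$ ($u^*=\omega_j^*$ or $u^*=\bar T^*$), equilibrium state $x^{s*}$ and output $y^*=-g(x^{s*},u^*)$, satisfies: 1. it is locally input strictly passive about $(u^*,x^{s*})$: there are open neighbourhoods $\Omega$ of $u^*$ and $X$ of $x^{s*}$, a continuously differentiable function $W\ge 0$ on $X$, and a function $\phi$ with $\phi(0)=0$ and $\phi(v)>0$ for $v\ne0$, such that $\nabla W(x)\cdot(-f(x,u))\le(-u+u^*)(y-y^*)-\phi(-u+u^*)$ for all $u\in\Omega$, $x\in X$, $y=-g(x,u)$; moreover $W$ has a strict local minimum at $x^{s*}$; 2. $x^{s*}$ is asymptotically stable for the constant input $u^*$.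 Then there is an open neighbourhood of $x^*$ such that from every point of it that satisfies the algebraic equations of the system there is a solution on $[0,\infty)$, and every solution of the system starting in this neighbourhood converges, as $t\to\infty$, to an equilibrium point of the system. -/

import Mathlib

open Set Filter Topology

noncomputable section

/-- A nonlinear input/output system with scalar input `u` and scalar output `y`,
`ẋ = -f(x, u)`, `y = -g(x, u)`, with `f`, `g` locally Lipschitz. -/
structure IOSystem where
  dim : ℕ
  f : EuclideanSpace ℝ (Fin dim) → ℝ → EuclideanSpace ℝ (Fin dim)
  g : EuclideanSpace ℝ (Fin dim) → ℝ → ℝ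
  f_lip : LocallyLipschitz (fun z : EuclideanSpace ℝ (Fin dim) × ℝ => f z.1 z.2)
  g_lip : LocallyLipschitz (fun z : EuclideanSpace ℝ (Fin dim) × ℝ => g z.1 z.2)

namespace IOSystem

/-- The state space of the system. -/
abbrev X (S : IOSystem) : Type := EuclideanSpace ℝ (Fin S.dim)

/-- The output `y = -g(x, u)`. -/
def output (S : IOSystem) (x : S.X) (u : ℝ) : ℝ := -S.g x u

/-- `x` is a solution on `[0, ∞)` of the system with constant input `u`. -/
def IsSolution (S : IOSystem) (u : ℝ) (x : ℝ → S.X) : Prop :=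
  ∀ t : ℝ, 0 ≤ t → HasDerivWithinAt x (-S.f (x t) u) (Ici 0) t

/-- `xs` is an asymptotically stable equilibrium for the constant input `us`: it is an
equilibrium, Lyapunov stable, and locally attractive. -/
def IsAsymptoticallyStable (S : IOSystem) (us : ℝ) (xs : S.X) : Prop :=
  S.f xs us = 0 ∧
  (∀ ε > 0, ∃ δ > 0, ∀ x : ℝ → S.X, S.IsSolution us x → dist (x 0) xs < δ →
    ∀ t : ℝ, 0 ≤ t → dist (x t) xs < ε) ∧
  (∃ δ > 0, ∀ x : ℝ → S.X, S.IsSolution us x → dist (x 0) xs < δ → Tendsto x atTop (𝓝 xs))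

/-- `W` is a storage function showing that the system is locally input strictly passive, from
`-u` to the output, about the input `us` and the state `xs`. Here `fderiv ℝ W x (-S.f x u)` is the
derivative of `W` along the system. -/
def IsPassivityStorage (S : IOSystem) (us : ℝ) (xs : S.X) (W : S.X → ℝ) : Prop :=
  ∃ (Ω : Set ℝ) (D : Set S.X) (φ : ℝ → ℝ),
    IsOpen Ω ∧ us ∈ Ω ∧ IsOpen D ∧ xs ∈ D ∧
    ContDiffOn ℝ 1 W D ∧ (∀ x ∈ D, 0 ≤ W x) ∧
    φ 0 = 0 ∧ (∀ v : ℝ, v ≠ 0 → 0 < φ v) ∧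
    ∀ u ∈ Ω, ∀ x ∈ D, fderiv ℝ W x (-S.f x u) ≤
      (-u + us) * (S.output x u - S.output xs us) - φ (-u + us)

/-- The system is locally input strictly passive about `(us, xs)` with a storage function that has
a strict local minimum at `xs`. -/
def IsLocallyInputStrictlyPassive (S : IOSystem) (us : ℝ) (xs : S.X) : Prop :=
  ∃ W : S.X → ℝ, S.IsPassivityStorage us xs W ∧ ∀ᶠ x in 𝓝[≠] xs, W xs < W x

end IOSystem

/-- Data of a combined heat and power network: buses `N`, heat edges `E`, heat nodes `K`. -/
structure CHPNetwork (N E K : Type*) [Fintype N] [DecidableEq N] [Fintype E] [DecidableEq E]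
    [Fintype K] [DecidableEq K] where
  /-- Transmission lines, as ordered pairs of buses. -/
  lines : Finset (N × N)
  /-- Generator buses; the other buses are load buses, with zero inertia and no generation. -/
  gen : Finset N
  /-- Buses to which heat pumps are connected. -/
  pump : Finset N
  /-- Line susceptances. -/
  B : N × N → ℝ
  B_pos : ∀ l ∈ lines, 0 < B l
  /-- Inertia. -/
  M : N → ℝ
  M_gen : ∀ j ∈ gen, 0 < M j
  M_load : ∀ j, j ∉ gen → M j = 0
  /-- Damping coefficients. -/
  D : N → ℝ
  D_pos : ∀ j, 0 < D j
  /-- Electric load deviations. -/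
  pL : N → ℝ
  /-- Generation dynamics, from the bus frequency to the generated power. -/
  genSys : gen → IOSystem
  /-- Node from which the flow through a heat edge originates. -/
  src : E → K
  /-- Node into which the flow through a heat edge injects. -/
  tgt : E → K
  /-- Mass flows. -/
  q : E → ℝ
  q_pos : ∀ e, 0 < q e
  /-- Conservation of mass at every heat node. -/
  q_balance : ∀ k, ∑ e, (if tgt e = k then q e else 0) = ∑ e, (if src e = k then q e else 0)
  /-- The heating network is connected. -/
  heat_connected : ∀ k l : K, Relation.EqvGen (fun a b => ∃ e, src e = a ∧ tgt e = b) k l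
  /-- Volumes of heat edges and heat nodes. -/
  VE : E → ℝ
  VN : K → ℝ
  VE_pos : ∀ e, 0 < VE e
  VN_pos : ∀ k, 0 < VN k
  /-- Edges with conventional heat sources. -/
  heatSrc : Finset E
  heatSrc_nonempty : heatSrc.Nonempty
  /-- The heat edge associated with the heat pump at a bus of `pump`. -/
  pumpEdge : N → E
  pumpEdge_inj : Set.InjOn pumpEdge pump
  pumpEdge_not_heatSrc : ∀ j ∈ pump, pumpEdge j ∉ heatSrc
  /-- Coefficients of performance. -/
  Co : N → ℝ
  Co_pos : ∀ j ∈ pump, 0 < Co j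
  /-- Heat load deviations; they vanish on the edges of pumps and of conventional sources. -/
  hL : E → ℝ
  hL_heatSrc : ∀ e ∈ heatSrc, hL e = 0
  hL_pump : ∀ j ∈ pump, hL (pumpEdge j) = 0
  /-- Heat source dynamics, from the average temperature to the generated heat power. -/
  heatSys : heatSrc → IOSystem

/-- The two ways in which heat pumps take part in frequency regulation. -/
inductive HeatPumpMode (N : Type*) where
  /-- Mode 1: `p^P_j = a_j ω_j`. -/
  | freqDependent (a : N → ℝ) : HeatPumpMode N
  /-- Mode 2: `ω_j = m_j T̄` at the pump bus, the pump taking all the power that flows in. -/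
  | converterLinked (m : N → ℝ) : HeatPumpMode N

namespace CHPNetwork

variable {N E K : Type*} [Fintype N] [DecidableEq N] [Fintype E] [DecidableEq E]
  [Fintype K] [DecidableEq K]

/-- Conditions on the coefficients of a mode. In mode 2 a pump bus is a separate bus without
inertia or generation, and the coefficient `α = m_j / C_{o,j}` of the heating network does not
depend on the pump. -/
def ModeAdmissible (P : CHPNetwork N E K) : HeatPumpMode N → Prop
  | .freqDependent a => ∀ j ∈ P.pump, 0 < a j
  | .converterLinked m => Disjoint P.gen P.pump ∧ (∀ j ∈ P.pump, 0 < m j) ∧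
      ∀ i ∈ P.pump, ∀ j ∈ P.pump, m i / P.Co i = m j / P.Co j

/-- States `(η, ω, x_e, T^E, T^N, x_h)`, with the product topology. -/
abbrev State (P : CHPNetwork N E K) : Type _ :=
  (P.lines → ℝ) × (N → ℝ) × (∀ j : P.gen, (P.genSys j).X) × (E → ℝ) × (K → ℝ) ×
    (∀ e : P.heatSrc, (P.heatSys e).X)

section

variable {P : CHPNetwork N E K}

/-- Angle differences. -/
def State.η (x : P.State) : P.lines → ℝ := x.1
/-- Frequency deviations. -/
def State.ω (x : P.State) : N → ℝ := x.2.1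
/-- States of the generation dynamics. -/
def State.xe (x : P.State) : ∀ j : P.gen, (P.genSys j).X := x.2.2.1
/-- Edge temperatures. -/
def State.TE (x : P.State) : E → ℝ := x.2.2.2.1
/-- Node temperatures. -/
def State.TN (x : P.State) : K → ℝ := x.2.2.2.2.1
/-- States of the heat source dynamics. -/
def State.xh (x : P.State) : ∀ e : P.heatSrc, (P.heatSys e).X := x.2.2.2.2.2

end

/-- Power transfer `p_ij = B_ij sin η_ij`. -/
def lineFlow (P : CHPNetwork N E K) (x : P.State) (l : P.lines) : ℝ :=
  P.B l.1 * Real.sin (x.η l)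

/-- `∑_{i → j} p_ij - ∑_{j → k} p_jk`. -/
def netInflow (P : CHPNetwork N E K) (x : P.State) (j : N) : ℝ :=
  ∑ l : P.lines, (if l.1.2 = j then P.lineFlow x l else 0) -
    ∑ l : P.lines, (if l.1.1 = j then P.lineFlow x l else 0)

/-- Average temperature, weighted by volumes. -/
def Tbar (P : CHPNetwork N E K) (x : P.State) : ℝ :=
  (∑ e, P.VE e * x.TE e + ∑ k, P.VN k * x.TN k) / (∑ e, P.VE e + ∑ k, P.VN k)

/-- Generated electric power; zero at load buses. -/
def pG (P : CHPNetwork N E K) (x : P.State) (j : N) : ℝ :=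
  if h : j ∈ P.gen then (P.genSys ⟨j, h⟩).output (x.xe ⟨j, h⟩) (x.ω j) else 0

/-- Electric power consumed by the heat pump; zero at buses without a heat pump. -/
def pP (P : CHPNetwork N E K) (mode : HeatPumpMode N) (x : P.State) (j : N) : ℝ :=
  if j ∈ P.pump then
    match mode with
    | .freqDependent a => a j * x.ω j
    | .converterLinked _ => P.netInflow x j
  else 0

/-- Right-hand side of the swing equation, with `p^U_j = D_j ω_j`. -/
def swingRHS (P : CHPNetwork N E K) (mode : HeatPumpMode N) (x : P.State) (j : N) : ℝ :=
  -P.pL j - P.pP mode x j + P.pG x j - P.D j * x.ω j + P.netInflow x j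

/-- Heat power of conventional sources; zero on the other edges. -/
def hG (P : CHPNetwork N E K) (x : P.State) (e : E) : ℝ :=
  if h : e ∈ P.heatSrc then (P.heatSys ⟨e, h⟩).output (x.xh ⟨e, h⟩) (P.Tbar x) else 0

/-- Heat power of the heat pumps: `C_{o,j} p^P_j` on the edge of pump `j`, zero elsewhere. -/
def hP (P : CHPNetwork N E K) (mode : HeatPumpMode N) (x : P.State) (e : E) : ℝ :=
  ∑ j ∈ P.pump, if P.pumpEdge j = e then P.Co j * P.pP mode x j else 0

/-- Right-hand side of the edge temperature dynamics (normalized so that `ρ C_p = 1`). -/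
def edgeRHS (P : CHPNetwork N E K) (mode : HeatPumpMode N) (x : P.State) (e : E) : ℝ :=
  P.q e * (x.TN (P.src e) - x.TE e) + P.hG x e + P.hP mode x e - P.hL e

/-- Right-hand side of the node temperature dynamics. -/
def nodeRHS (P : CHPNetwork N E K) (x : P.State) (k : K) : ℝ :=
  ∑ e, (if P.tgt e = k then P.q e * x.TE e else 0) -
    (∑ e, (if P.tgt e = k then P.q e else 0)) * x.TN k

/-- The algebraic equations of the model: power balance at the buses without inertia, and in mode 2,
for the pump buses, `ω_j = m_j T̄` (there the power balance is built into `pP`). -/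
def IsConsistent (P : CHPNetwork N E K) (mode : HeatPumpMode N) (x : P.State) : Prop :=
  match mode with
  | .freqDependent _ => ∀ j, j ∉ P.gen → P.swingRHS mode x j = 0
  | .converterLinked m => (∀ j, j ∉ P.gen → j ∉ P.pump → P.swingRHS mode x j = 0) ∧
      ∀ j ∈ P.pump, x.ω j = m j * P.Tbar x

/-- `x` solves the network model on `[0, ∞)`. -/
structure IsSolution (P : CHPNetwork N E K) (mode : HeatPumpMode N) (x : ℝ → P.State) : Prop where
  consistent : ∀ t : ℝ, 0 ≤ t → P.IsConsistent mode (x t)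
  angle : ∀ t : ℝ, 0 ≤ t → ∀ l : P.lines,
    HasDerivWithinAt (fun s => (x s).η l) ((x t).ω l.1.1 - (x t).ω l.1.2) (Ici 0) t
  swing : ∀ t : ℝ, 0 ≤ t → ∀ j ∈ P.gen,
    HasDerivWithinAt (fun s => P.M j * (x s).ω j) (P.swingRHS mode (x t) j) (Ici 0) t
  generator : ∀ t : ℝ, 0 ≤ t → ∀ j : P.gen,
    HasDerivWithinAt (fun s => (x s).xe j) (-(P.genSys j).f ((x t).xe j) ((x t).ω j)) (Ici 0) t
  edge : ∀ t : ℝ, 0 ≤ t → ∀ e,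
    HasDerivWithinAt (fun s => P.VE e * (x s).TE e) (P.edgeRHS mode (x t) e) (Ici 0) t
  node : ∀ t : ℝ, 0 ≤ t → ∀ k,
    HasDerivWithinAt (fun s => P.VN k * (x s).TN k) (P.nodeRHS (x t) k) (Ici 0) t
  heatSource : ∀ t : ℝ, 0 ≤ t → ∀ e : P.heatSrc,
    HasDerivWithinAt (fun s => (x s).xh e) (-(P.heatSys e).f ((x t).xh e) (P.Tbar (x t))) (Ici 0) t

/-- `x` is an equilibrium point of the network model. -/
structure IsEquilibrium (P : CHPNetwork N E K) (mode : HeatPumpMode N) (x : P.State) : Prop where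
  consistent : P.IsConsistent mode x
  angle : ∀ l : P.lines, x.ω l.1.1 - x.ω l.1.2 = 0
  swing : ∀ j ∈ P.gen, P.swingRHS mode x j = 0
  generator : ∀ j : P.gen, (P.genSys j).f (x.xe j) (x.ω j) = 0
  edge : ∀ e, P.edgeRHS mode x e = 0
  node : ∀ k, P.nodeRHS x k = 0
  heatSource : ∀ e : P.heatSrc, (P.heatSys e).f (x.xh e) (P.Tbar x) = 0

end CHPNetwork

end

/-! The individual temperatures act on the rest of the system only through their average: sources
read T̄, pumps read frequencies or line flows. Mass balance removes transport from the equation for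
T̄, so (η, ω, x_e, T̄, x_h) obey a closed system. Frequencies at buses without inertia are
eliminated algebraically, by D_j > 0 or by ω_j = m_j T̄, which leaves an ODE with locally Lipschitz
field. When its solution converges, so do the heat inputs and the stored heat. The temperatures then
converge too, because the transport form is negative definite up to constants and the stored heat
controls the constants (`IsThermalSolution.exists_tendsto`, `stable_of_reduction`).

The ODE is assembled from instances of `PassiveNet`. Its energy adds a convex line potential, the
kinetic terms and the storage functions; |η*| < π/2 makes the equilibrium a strict minimum. The
interconnection terms cancel (`power_balance`), so the energy falls at least at the rate given by
damping and by the strict passivity terms φ. If the energy is constant along a solution, the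
velocities sit at their equilibrium values, hence the angles are frozen and every attached system
runs with constant input. Asymptotic stability drives it to its equilibrium, and its storage, being
constant, shows that it was there already (`IsPassiveAt.mem_equilibria`).

Equilibria need not be isolated: the line angles are independent coordinates, so circulating flows
give continua. Convergence to a single point comes from linear first integrals of the angles:
equilibria near p that agree on all of them coincide, since sin is strictly increasing on (-π/2,
π/2) (`eq_of_mem_equilibria`, `IsLyapunov.exists_tendsto`).

In mode 2, multiplying the equation for T̄ by the common ratio α = m_j / C_{o,j} makes T̄ one more
mass of the network, with lossless coupling through the pumps. In mode 1 pump consumption is extra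
damping, and the electric network is autonomous. It drives the thermal one by a term that tends to
zero; total stability of the thermal part handles this cascade (`IsLyapunov.perturbed`,
`IsLyapunov.cascade`). -/

open scoped NNReal

/-! ### Global existence for Lipschitz vector fields -/

/-- One step of the Picard-Lindelöf theorem, with a step length that depends only on the
Lipschitz constant. -/
theorem exists_solution_step {E : Type*} [NormedAddCommGroup E] [NormedSpace ℝ E]
    [CompleteSpace E] {f : ℝ → E → E} {K : ℝ≥0} (hL : ∀ t, 0 ≤ t → LipschitzWith K (f t))
    (hc : ∀ x, ContinuousOn (fun t => f t x) (Ici 0)) (t₀ : ℝ) (ht₀ : 0 ≤ t₀) (x₀ : E) :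
    ∃ α : ℝ → E, α t₀ = x₀ ∧ ∀ t ∈ Icc t₀ (t₀ + 1 / (2 * (K + 1))),
      HasDerivWithinAt α (f t (α t)) (Icc t₀ (t₀ + 1 / (2 * (K + 1)))) t := by
  have hK : (0 : ℝ) < 2 * ((K : ℝ) + 1) := by positivity
  have hτ : (0 : ℝ) < 1 / (2 * (K + 1)) := by positivity
  set τ : ℝ := 1 / (2 * (K + 1)) with hτdef
  have hsub : Icc t₀ (t₀ + τ) ⊆ Ici 0 := fun t ht => ht₀.trans ht.1
  obtain ⟨C, hC⟩ := isCompact_Icc.exists_bound_of_continuousOn ((hc x₀).mono hsub)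
  have hC0 : 0 ≤ C := (norm_nonneg _).trans (hC t₀ ⟨le_rfl, by linarith⟩)
  -- The radius of the ball is C, the bound of the field at x₀, so the step does not depend on x₀:
  -- on the ball the field is at most C + K C, and (C + K C) / (2 (K + 1)) = C / 2.
  have key : IsPicardLindelof f (tmin := t₀) (tmax := t₀ + τ) ⟨t₀, le_rfl, by linarith⟩ x₀
      ⟨C, hC0⟩ 0 (⟨C, hC0⟩ + K * ⟨C, hC0⟩) K := by
    refine ⟨fun t ht => (hL t (hsub ht)).lipschitzOnWith, fun x _ => (hc x).mono hsub, ?_, ?_⟩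
    · intro t ht x hx
      have h1 := (hL t (hsub ht)).dist_le_mul x x₀
      have h2 : dist x x₀ ≤ C := hx
      have h3 : ‖f t x‖ ≤ ‖f t x₀‖ + dist (f t x) (f t x₀) := by
        rw [dist_eq_norm]
        calc ‖f t x‖ = ‖f t x₀ + (f t x - f t x₀)‖ := by congr 1; abel
          _ ≤ _ := norm_add_le _ _
      have h4 : (K : ℝ) * dist x x₀ ≤ K * C := by gcongr
      have h5 := hC t ht
      show ‖f t x‖ ≤ C + K * C
      linarith
    · show (C + K * C) * max (t₀ + τ - t₀) (t₀ - t₀) ≤ C - 0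
      rw [add_sub_cancel_left, sub_self, max_eq_left hτ.le, hτdef]
      have : (C + K * C) * (1 / (2 * ((K : ℝ) + 1))) = C / 2 := by field_simp; ring
      rw [this]; linarith
  obtain ⟨α, h1, h2⟩ := key.exists_eq_forall_mem_Icc_hasDerivWithinAt₀
  exact ⟨α, h1, h2⟩

/-- Global existence on `[0, ∞)` for a globally Lipschitz time-dependent vector field. -/
theorem exists_global_solution {E : Type*} [NormedAddCommGroup E] [NormedSpace ℝ E]
    [CompleteSpace E] {f : ℝ → E → E} {K : ℝ≥0} (hL : ∀ t, 0 ≤ t → LipschitzWith K (f t))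
    (hc : ∀ x, ContinuousOn (fun t => f t x) (Ici 0)) (x₀ : E) :
    ∃ x : ℝ → E, x 0 = x₀ ∧ ∀ t, 0 ≤ t → HasDerivWithinAt x (f t (x t)) (Ici 0) t := by
  have hτ : (0 : ℝ) < 1 / (2 * ((K : ℝ) + 1)) := by positivity
  choose! sol hsol0 hsol using fun t₀ ht₀ => exists_solution_step hL hc t₀ ht₀
  set τ : ℝ := 1 / (2 * ((K : ℝ) + 1)) with hτdef
  let p : ℕ → E := fun n => Nat.rec x₀ (fun n y => sol (n * τ) y ((n + 1 : ℕ) * τ)) n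
  have hpos : ∀ n : ℕ, 0 ≤ (n : ℝ) * τ := fun n => by positivity
  have hps : ∀ n : ℕ, p (n + 1) = sol (n * τ) (p n) ((n + 1 : ℕ) * τ) := fun n => rfl
  -- The local solutions on the cells [nτ, (n+1)τ] are glued. `hx` shows that the formula of a cell
  -- also holds at its right endpoint, where the floor already selects the next cell.
  let x : ℝ → E := fun t => sol (⌊t / τ⌋₊ * τ) (p ⌊t / τ⌋₊) t
  have hstep : ∀ n : ℕ, ((n + 1 : ℕ) : ℝ) * τ = n * τ + τ := fun n => by push_cast; ring
  have hx : ∀ n : ℕ, ∀ t ∈ Icc (n * τ) (n * τ + τ), x t = sol (n * τ) (p n) t := by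
    intro n t ht
    rcases ht.2.lt_or_eq with h | h
    · have : ⌊t / τ⌋₊ = n := by
        rw [Nat.floor_eq_iff (div_nonneg ((hpos n).trans ht.1) hτ.le)]
        constructor
        · rw [le_div_iff₀ hτ]; exact ht.1
        · rw [div_lt_iff₀ hτ]; linarith
      simp only [x, this]
    · have h' : t = ((n + 1 : ℕ) : ℝ) * τ := by rw [h, hstep]
      have : ⌊t / τ⌋₊ = n + 1 := by
        rw [h', mul_div_cancel_right₀ _ hτ.ne', Nat.floor_natCast]
      simp only [x, this]
      rw [h', hsol0 _ (hpos (n + 1)), hps]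
  have hd : ∀ n : ℕ, ∀ t ∈ Icc (n * τ) (n * τ + τ),
      HasDerivWithinAt x (f t (x t)) (Icc (n * τ) (n * τ + τ)) t := by
    intro n t ht
    rw [hx n t ht]
    exact (hsol (n * τ) (hpos n) (p n) t ht).congr (fun s hs => hx n s hs) (hx n t ht)
  refine ⟨x, ?_, ?_⟩
  · have := hx 0 0 ⟨by simp, by simp [hτ.le]⟩
    rw [this]
    simpa [show p 0 = x₀ from rfl] using hsol0 0 le_rfl x₀
  · intro t ht
    obtain ⟨n, hn1, hn2⟩ : ∃ n : ℕ, n * τ ≤ t ∧ t < n * τ + τ := by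
      refine ⟨⌊t / τ⌋₊, ?_, ?_⟩
      · have := Nat.floor_le (div_nonneg ht hτ.le)
        rwa [le_div_iff₀ hτ] at this
      · have := Nat.lt_floor_add_one (t / τ)
        rw [div_lt_iff₀ hτ] at this
        linarith
    have h1 := hd n t ⟨hn1, hn2.le⟩
    rcases hn1.lt_or_eq with h | h
    · exact (h1.hasDerivAt (Icc_mem_nhds h hn2)).hasDerivWithinAt
    -- At a grid point the derivatives from the two adjacent cells combine; at t = 0 only the
    -- right-hand one is required.
    · rcases n with _ | m
      · refine h1.mono_of_mem_nhdsWithin ?_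
        have ht0 : t = 0 := by simpa using h.symm
        subst ht0
        simpa using Icc_mem_nhdsGE hτ
      · have h2 := hd m t ⟨by rw [← h, hstep]; linarith, by rw [← h, hstep]⟩
        refine ((h1.union h2).hasDerivAt ?_).hasDerivWithinAt
        have hm : m * τ < t := by rw [← h, hstep]; linarith
        refine mem_of_superset (Icc_mem_nhds hm hn2) fun s hs => ?_
        rcases le_total (((m + 1 : ℕ) : ℝ) * τ) s with h3 | h3
        · exact Or.inl ⟨h3, hs.2⟩
        · exact Or.inr ⟨hs.1, by rw [← hstep]; exact h3⟩

/-! ### Lyapunov functions and stability -/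

/-- `x` solves `ẋ = F x` on `[0, ∞)`. -/
def IsODESolution {E : Type*} [NormedAddCommGroup E] [NormedSpace ℝ E] (F : E → E)
    (x : ℝ → E) : Prop :=
  ∀ t, 0 ≤ t → HasDerivWithinAt x (F (x t)) (Ici 0) t

/-- `x` is continuous on `[0, ∞)` and solves `ẋ = F x + d t` as long as it has not left `A`. -/
structure SolvesWhileIn {E : Type*} [NormedAddCommGroup E] [NormedSpace ℝ E] (F : E → E)
    (d : ℝ → E) (A : Set E) (x : ℝ → E) : Prop where
  cont : ContinuousOn x (Ici 0)
  deriv : ∀ t, 0 ≤ t → (∀ s ∈ Icc 0 t, x s ∈ A) →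
    HasDerivWithinAt x (F (x t) + d t) (Ici 0) t

/-- `V` is a Lyapunov function of `F` on the closed ball, with a strict minimum at the centre. -/
structure IsLyapunov {E : Type*} [NormedAddCommGroup E] [NormedSpace ℝ E] (F : E → E)
    (V : E → ℝ) (p : E) (r : ℝ) : Prop where
  pos : 0 < r
  lip : ∃ K, LipschitzOnWith K F (Metric.closedBall p r)
  cont : ContinuousOn V (Metric.closedBall p r)
  decr : ∀ (x : ℝ → E) (t : ℝ), 0 ≤ t → x t ∈ Metric.closedBall p r →
    HasDerivWithinAt x (F (x t)) (Ici 0) t →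
      ∃ v ≤ 0, HasDerivWithinAt (fun s => V (x s)) v (Ici 0) t
  lt_of_ne : ∀ y ∈ Metric.closedBall p r, y ≠ p → V p < V y

/-- A curve that starts inside a ball and leaves it hits the sphere a first time. -/
theorem exists_first_exit {E : Type*} [PseudoMetricSpace E] {x : ℝ → E} {p : E} {ε : ℝ}
    (hx : ContinuousOn x (Ici 0)) (h0 : dist (x 0) p < ε)
    {T : ℝ} (hT : 0 ≤ T) (hexit : ε ≤ dist (x T) p) :
    ∃ t, 0 ≤ t ∧ t ≤ T ∧ dist (x t) p = ε ∧ ∀ s ∈ Icc 0 t, x s ∈ Metric.closedBall p ε := by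
  have hd : ContinuousOn (fun s => dist (x s) p) (Icc 0 T) :=
    (continuous_id.dist continuous_const).comp_continuousOn (hx.mono Icc_subset_Ici_self)
  set S : Set ℝ := Icc 0 T ∩ (fun s => dist (x s) p) ⁻¹' (Ici ε) with hS
  have hclosed : IsCompact S :=
    isCompact_Icc.of_isClosed_subset (hd.preimage_isClosed_of_isClosed isClosed_Icc isClosed_Ici)
      inter_subset_left
  obtain ⟨t, ⟨ht, hte⟩, hmin⟩ := hclosed.exists_isLeast ⟨T, ⟨hT, le_rfl⟩, hexit⟩
  have hlt : ∀ s ∈ Icc 0 T, s < t → dist (x s) p < ε := fun s hs hst => by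
    by_contra! hc
    exact absurd (hmin ⟨hs, hc⟩) (by linarith)
  -- A distance above ε at the first exit time would, by the intermediate value theorem, have
  -- exceeded ε earlier.
  have hte' : dist (x t) p = ε := by
    refine le_antisymm ?_ hte
    by_contra! hc
    obtain ⟨s, hs, hse⟩ := intermediate_value_Ioo ht.1
      (hd.mono (Icc_subset_Icc le_rfl ht.2)) ⟨h0, hc⟩
    exact absurd hse (hlt s ⟨hs.1.le, hs.2.le.trans ht.2⟩ hs.2).ne
  refine ⟨t, ht.1, ht.2, hte', fun s hs => ?_⟩
  rcases hs.2.lt_or_eq with h | h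
  · exact (hlt s ⟨hs.1, hs.2.trans ht.2⟩ h).le
  · rw [h]; exact hte'.le

section

variable {E : Type*} [NormedAddCommGroup E] [NormedSpace ℝ E]
  {F : E → E} {V : E → ℝ} {p : E} {r : ℝ} {x : ℝ → E} {d : ℝ → E}

theorem IsODESolution.continuousOn (h : IsODESolution F x) : ContinuousOn x (Ici 0) :=
  fun t ht => (h t ht).continuousWithinAt

theorem HasDerivWithinAt.comp_shift {x : ℝ → E} {v : E} {a t : ℝ} (ha : 0 ≤ a)
    (h : HasDerivWithinAt x v (Ici 0) (a + t)) :
    HasDerivWithinAt (fun s => x (a + s)) v (Ici 0) t := by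
  have h2 : HasDerivWithinAt (fun s : ℝ => a + s) 1 (Ici 0) t :=
    ((hasDerivAt_id t).const_add a).hasDerivWithinAt
  have := HasDerivWithinAt.scomp t h h2 (fun s hs => by
    simp only [mem_Ici] at hs ⊢; linarith)
  simpa [Function.comp_def] using this

theorem IsODESolution.shift (h : IsODESolution F x) {a : ℝ} (ha : 0 ≤ a) :
    IsODESolution F (fun s => x (a + s)) :=
  fun t ht => (h (a + t) (by linarith)).comp_shift ha

theorem SolvesWhileIn.shift {A : Set E} (h : SolvesWhileIn F d A x) {a : ℝ} (ha : 0 ≤ a)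
    (hin : ∀ s ∈ Icc 0 a, x s ∈ A) :
    SolvesWhileIn F (fun s => d (a + s)) A (fun s => x (a + s)) := by
  refine ⟨h.cont.comp (by fun_prop) (fun s hs => ?_), fun t ht hs => ?_⟩
  · simp only [mem_Ici] at hs ⊢; linarith
  · refine (h.deriv (a + t) (by linarith) fun s hs' => ?_).comp_shift ha
    rcases le_total s a with h1 | h1
    · exact hin s ⟨hs'.1, h1⟩
    · have := hs (s - a) ⟨by linarith, by linarith [hs'.2]⟩
      simpa using this

theorem IsODESolution.solvesWhileIn (h : IsODESolution F x) (A : Set E) :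
    SolvesWhileIn F (fun _ => 0) A x :=
  ⟨h.continuousOn, fun t ht _ => by simpa using h t ht⟩

theorem SolvesWhileIn.mono {A A' : Set E} (h : SolvesWhileIn F d A x) (hA : A' ⊆ A) :
    SolvesWhileIn F d A' x :=
  ⟨h.cont, fun t ht hs => h.deriv t ht fun s hs' => hA (hs s hs')⟩

theorem SolvesWhileIn.isODESolution {A : Set E} (h : SolvesWhileIn F (fun _ => 0) A x)
    (hA : ∀ t, 0 ≤ t → x t ∈ A) : IsODESolution F x :=
  fun t ht => by simpa using h.deriv t ht fun s hs => hA s hs.1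

theorem IsLyapunov.mono (h : IsLyapunov F V p r) {r' : ℝ} (hr' : 0 < r') (hle : r' ≤ r) :
    IsLyapunov F V p r' :=
  have hsub := Metric.closedBall_subset_closedBall (x := p) hle
  ⟨hr', h.lip.imp fun _ hK => hK.mono hsub, h.cont.mono hsub,
    fun x t ht hx => h.decr x t ht (hsub hx), fun y hy => h.lt_of_ne y (hsub hy)⟩

/-- The derivative of V is nonpositive wherever the curve is in the ball. Only a finite interval is
assumed, so that the bound can be used up to a first exit time. -/
theorem IsLyapunov.le_start (h : IsLyapunov F V p r) {T : ℝ} (hT : 0 ≤ T)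
    (hin : ∀ t ∈ Icc 0 T, x t ∈ Metric.closedBall p r)
    (hd : ∀ t ∈ Icc 0 T, HasDerivWithinAt x (F (x t)) (Ici 0) t) : V (x T) ≤ V (x 0) := by
  choose! v hv hder using fun t (ht : t ∈ Icc 0 T) => h.decr x t ht.1 (hin t ht) (hd t ht)
  have : AntitoneOn (fun s => V (x s)) (Icc 0 T) := by
    refine antitoneOn_of_hasDerivWithinAt_nonpos (f' := v) (convex_Icc 0 T)
      (fun t ht => ((hder t ht).mono Icc_subset_Ici_self).continuousWithinAt) ?_ ?_
    · intro t ht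
      rw [interior_Icc] at ht ⊢
      exact (hder t (Ioo_subset_Icc_self ht)).mono (fun s hs => hs.1.le)
    · intro t ht
      rw [interior_Icc] at ht
      exact hv t (Ioo_subset_Icc_self ht)
  exact this ⟨le_rfl, hT⟩ ⟨hT, le_rfl⟩ hT

variable [FiniteDimensional ℝ E]

/-- Lyapunov stability. -/
theorem IsLyapunov.stable (h : IsLyapunov F V p r) :
    ∃ δ > 0, ∀ x : ℝ → E, SolvesWhileIn F (fun _ => 0) (Metric.closedBall p r) x →
      dist (x 0) p < δ → ∀ t, 0 ≤ t → dist (x t) p < r := by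
  have : ProperSpace E := FiniteDimensional.proper_real E
  -- m is the minimum of V on the sphere, which is positive distance away from p and hence above V
  -- p. The sphere is empty in the trivial space, and there any m > V p serves.
  obtain ⟨m, hpm, hm⟩ : ∃ m, V p < m ∧ ∀ y, dist y p = r → m ≤ V y := by
    rcases (Metric.sphere p r).eq_empty_or_nonempty with h0 | h0
    · refine ⟨V p + 1, by linarith, fun y hy => ?_⟩
      have : y ∈ Metric.sphere p r := hy
      simp [h0] at this
    · obtain ⟨y, hy, hmin⟩ := (isCompact_sphere p r).exists_isMinOn h0
        (h.cont.mono Metric.sphere_subset_closedBall)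
      refine ⟨V y, h.lt_of_ne y (Metric.sphere_subset_closedBall hy) ?_, fun z hz => hmin hz⟩
      rintro rfl
      simp only [Metric.mem_sphere, dist_self] at hy
      exact h.pos.ne hy
  have hcp : ContinuousAt V p :=
    h.cont.continuousAt (Metric.closedBall_mem_nhds p h.pos)
  obtain ⟨δ, hδ, hball⟩ := Metric.eventually_nhds_iff.1 (hcp.eventually_lt continuousAt_const hpm)
  refine ⟨min δ r, lt_min hδ h.pos, fun x hx h0 t ht => ?_⟩
  by_contra! hc
  -- At a first exit V would be at least m, although it started below m and could not increase.
  obtain ⟨T, hT0, -, hTe, hTin⟩ := exists_first_exit hx.cont (h0.trans_le (min_le_right _ _)) ht hc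
  have h1 := h.le_start hT0 hTin fun s hs => by
    simpa using hx.deriv s hs.1 fun u hu => hTin u ⟨hu.1, hu.2.trans hs.2⟩
  have h2 := hm _ hTe
  have h3 := hball (h0.trans_le (min_le_left _ _))
  linarith

/-- Existence of a curve, with prescribed initial value, that solves a continuously perturbed
equation while it stays in a ball. -/
theorem exists_solvesWhileIn (hlip : ∃ K, LipschitzOnWith K F (Metric.closedBall p r))
    (hd : ContinuousOn d (Ici 0)) (x₀ : E) :
    ∃ x : ℝ → E, x 0 = x₀ ∧ SolvesWhileIn F d (Metric.closedBall p r) x := by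
  obtain ⟨K, hK⟩ := hlip
  -- F is only Lipschitz on the ball. A globally Lipschitz extension has global solutions, and these
  -- solve the original equation until they leave the ball.
  obtain ⟨G, hG, hFG⟩ := hK.extend_finite_dimension
  have : CompleteSpace E := FiniteDimensional.complete ℝ E
  obtain ⟨x, hx0, hx⟩ := exists_global_solution (f := fun t y => G y + d t)
    (K := lipschitzExtensionConstant E * K)
    (fun t _ => LipschitzWith.of_dist_le_mul fun y z => by
      simpa using hG.dist_le_mul y z) (fun y => continuousOn_const.add hd) x₀
  refine ⟨x, hx0, fun t ht => (hx t ht).continuousWithinAt, fun t ht hin => ?_⟩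
  rw [hFG (hin t ⟨ht, le_rfl⟩)]
  exact hx t ht

/-- Existence of solutions near a stable equilibrium. -/
theorem IsLyapunov.exists_solution (h : IsLyapunov F V p r) :
    ∃ δ > 0, ∀ x₀, dist x₀ p < δ → ∃ x, x 0 = x₀ ∧ IsODESolution F x ∧
      ∀ t, 0 ≤ t → dist (x t) p < r := by
  obtain ⟨δ, hδ, hs⟩ := h.stable
  refine ⟨δ, hδ, fun x₀ hx₀ => ?_⟩
  obtain ⟨x, hx0, hx⟩ := exists_solvesWhileIn (d := fun _ => (0 : E)) h.lip continuousOn_const x₀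
  have hin := hs x hx (by rwa [hx0])
  exact ⟨x, hx0, hx.isODESolution fun t ht => (hin t ht).le, hin⟩

end

/-! ### LaSalle convergence with linear first integrals -/

section

variable {E : Type*} [NormedAddCommGroup E] [NormedSpace ℝ E]
  {F : E → E} {V : E → ℝ} {p : E} {r : ℝ} {x : ℝ → E} {d : ℝ → E}

/-- Grönwall's inequality on a set where F is Lipschitz. With d = 0 it gives continuous dependence
on the initial point; with equal initial points it measures the effect of d. -/
theorem dist_le_gronwallBound_of_perturbed {z : ℝ → E} {A : Set E} {K : ℝ≥0} {T η : ℝ}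
    (hK : LipschitzOnWith K F A)
    (hx : ∀ t ∈ Icc 0 T, HasDerivWithinAt x (F (x t) + d t) (Ici 0) t)
    (hxA : ∀ t ∈ Icc 0 T, x t ∈ A) (hd : ∀ t ∈ Icc 0 T, ‖d t‖ ≤ η)
    (hz : IsODESolution F z) (hzA : ∀ t, 0 ≤ t → z t ∈ A) :
    ∀ t ∈ Icc 0 T, dist (x t) (z t) ≤ gronwallBound (dist (x 0) (z 0)) K η t := by
  have := dist_le_of_approx_trajectories_ODE_of_mem (v := fun _ => F) (s := fun _ => A)
    (f := x) (g := z) (f' := fun t => F (x t) + d t) (g' := fun t => F (z t)) (a := 0) (b := T)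
    (K := K) (εf := η) (εg := 0) (δ := dist (x 0) (z 0)) (fun _ _ => hK)
    (fun t ht => ((hx t ht).mono Icc_subset_Ici_self).continuousWithinAt)
    (fun t ht => (hx t (Ico_subset_Icc_self ht)).mono (Ici_subset_Ici.2 ht.1))
    (fun t ht => by simpa using hd t (Ico_subset_Icc_self ht))
    (fun t ht => hxA t (Ico_subset_Icc_self ht))
    (hz.continuousOn.mono Icc_subset_Ici_self)
    (fun t ht => (hz t ht.1).mono (Ici_subset_Ici.2 ht.1))
    (fun t ht => by simp) (fun t ht => hzA t ht.1) le_rfl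
  simpa using this

variable [FiniteDimensional ℝ E]

/-- A LaSalle principle for a Lyapunov function with a strict minimum: if the solutions along
which `V` is constant start in `Q`, and points of `Q` are separated by the linear first integrals
of the system, then every solution that starts near `p` converges to a point of `Q`. -/
theorem IsLyapunov.exists_tendsto (h : IsLyapunov F V p r) {Q : Set E}
    (hconst : ∀ z, IsODESolution F z → (∀ t, 0 ≤ t → z t ∈ Metric.closedBall p r) →
      (∀ t, 0 ≤ t → V (z t) = V (z 0)) → z 0 ∈ Q)
    (huniq : ∀ q ∈ Q, ∀ q' ∈ Q, q ∈ Metric.closedBall p r → q' ∈ Metric.closedBall p r →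
      (∀ ℓ : E →L[ℝ] ℝ, (∀ y, ℓ (F y) = 0) → ℓ q = ℓ q') → q = q') :
    ∃ δ > 0, ∀ x, IsODESolution F x → dist (x 0) p < δ →
      ∃ q ∈ Q, Tendsto x atTop (𝓝 q) := by
  have : ProperSpace E := FiniteDimensional.proper_real E
  obtain ⟨δ₁, hδ₁, hex⟩ := h.exists_solution
  have hm : 0 < min δ₁ r := lt_min hδ₁ h.pos
  set ε : ℝ := min δ₁ r / 2 with hε
  have hε0 : 0 < ε := by positivity
  have hεδ : ε < δ₁ := by have := min_le_left δ₁ r; linarith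
  have hεr : ε < r := by have := min_le_right δ₁ r; linarith
  obtain ⟨δ, hδ, hst⟩ := (h.mono hε0 hεr.le).stable
  refine ⟨δ, hδ, fun x hx hx0 => ?_⟩
  have hin := hst x (hx.solvesWhileIn _) hx0
  have hball : ∀ y, dist y p < r → ContinuousAt V y := fun y hy =>
    h.cont.continuousAt (mem_of_superset (Metric.isOpen_ball.mem_nhds hy)
      Metric.ball_subset_closedBall)
  have hanti : ∀ s t, 0 ≤ s → s ≤ t → V (x t) ≤ V (x s) := fun s t hs hst' => by
    have := h.le_start (x := fun u => x (s + u)) (T := t - s) (by linarith)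
      (fun u hu => ((hin (s + u) (by linarith [hu.1])).trans hεr).le)
      (fun u hu => hx.shift hs u hu.1)
    simpa using this
  obtain ⟨K, hK⟩ := h.lip
  have hev : ∀ᶠ t in atTop, x t ∈ Metric.closedBall p ε :=
    (eventually_ge_atTop 0).mono fun t ht => (hin t ht).le
  -- V is constant along the solution z from a cluster point: V(z 0) is a lower bound of V along x,
  -- and x follows z for a fixed time whenever it returns close enough to z 0.
  have hcl : ∀ q, MapClusterPt q atTop x → dist q p ≤ ε ∧ q ∈ Q := by
    intro q hq
    have hqε : dist q p ≤ ε := Metric.isClosed_closedBall.mem_of_mapClusterPt hq hev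
    refine ⟨hqε, ?_⟩
    obtain ⟨z, rfl, hz, hzin⟩ := hex q (hqε.trans_lt hεδ)
    have hle : ∀ t, 0 ≤ t → V (z 0) ≤ V (x t) := by
      intro t ht
      by_contra! hc
      have h1 := hq.frequently ((hball (z 0) (hzin 0 le_rfl)).eventually_const_lt hc)
      obtain ⟨s, hs, hts⟩ := (h1.and_eventually (eventually_ge_atTop t)).exists
      exact absurd (hanti t s ht hts) (not_le.2 hs)
    refine hconst z hz (fun t ht => (hzin t ht).le) fun s hs => le_antisymm ?_ ?_
    · exact h.le_start hs (fun t ht => (hzin t ht.1).le) fun t ht => hz t ht.1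
    -- If V(z s) < V(z 0), take t with x t so near z 0 that the growth factor exp(K s) leaves x (t +
    -- s) within η of z s. Then V(x (t + s)) < V(z 0), against `hle`.
    · by_contra! hc
      obtain ⟨η, hη, hηV⟩ := Metric.eventually_nhds_iff.1
        ((hball (z s) (hzin s hs)).eventually_lt_const hc)
      have hη' : 0 < η * Real.exp (-(K * s)) := by positivity
      obtain ⟨t, ht, ht0⟩ := ((hq.frequently (Metric.ball_mem_nhds _ hη')).and_eventually
        (eventually_ge_atTop 0)).exists
      have h2 := dist_le_gronwallBound_of_perturbed (d := fun _ => 0) (η := 0) (T := s)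
        (x := fun u => x (t + u)) (z := z) hK
        (fun u hu => by simpa using hx.shift ht0 u hu.1)
        (fun u hu => ((hin (t + u) (by linarith [hu.1])).trans hεr).le) (by simp) hz
        (fun u hu => (hzin u hu).le) s ⟨hs, le_rfl⟩
      rw [gronwallBound_ε0, add_zero] at h2
      have h3 : dist (x t) (z 0) * Real.exp (K * s) < η := by
        calc _ < η * Real.exp (-(K * s)) * Real.exp (K * s) := by
              have : dist (x t) (z 0) < η * Real.exp (-(K * s)) := ht
              gcongr
          _ = η := by rw [mul_assoc, ← Real.exp_add]; simp
      exact absurd (hle (t + s) (by linarith)) (not_le.2 (hηV (h2.trans_lt h3)))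
  obtain ⟨q, hqb, hq⟩ := (isCompact_closedBall p ε).exists_mapClusterPt (f := atTop) (u := x)
    (by simpa using hev)
  refine ⟨q, (hcl q hq).2, ?_⟩
  have hint : ∀ ℓ : E →L[ℝ] ℝ, (∀ y, ℓ (F y) = 0) → ∀ t, 0 ≤ t → ℓ (x t) = ℓ (x 0) := by
    intro ℓ hℓ t ht
    have hder : ∀ s, 0 ≤ s → HasDerivWithinAt (fun s => ℓ (x s)) 0 (Ici 0) s := fun s hs => by
      have := ℓ.hasFDerivAt.comp_hasDerivWithinAt s (hx s hs)
      rwa [hℓ] at this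
    exact constant_of_has_deriv_right_zero (a := 0) (b := t)
      (fun s hs => ((hder s hs.1).mono Icc_subset_Ici_self).continuousWithinAt)
      (fun s hs => (hder s hs.1).mono (Ici_subset_Ici.2 hs.1)) t ⟨ht, le_rfl⟩
  have hlim : ∀ ℓ : E →L[ℝ] ℝ, (∀ y, ℓ (F y) = 0) → ∀ q, MapClusterPt q atTop x →
      ℓ q = ℓ (x 0) := by
    intro ℓ hℓ q hq
    by_contra hne
    have : ∀ᶠ y in 𝓝 q, ℓ y ≠ ℓ (x 0) := ℓ.continuous.continuousAt.eventually_ne hne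
    obtain ⟨t, ht, ht0⟩ := ((hq.frequently this).and_eventually (eventually_ge_atTop 0)).exists
    exact ht (hint ℓ hℓ t ht0)
  -- First integrals keep their initial value along x, hence agree at all cluster points. By `huniq`
  -- there is only one, and a curve in a compact set with one cluster point converges.
  refine (isCompact_closedBall p ε).tendsto_nhds_of_unique_mapClusterPt hev fun q' _ hq' => ?_
  exact huniq q' (hcl q' hq').2 q (hcl q hq).2 ((hcl q' hq').1.trans hεr.le)
    ((hcl q hq).1.trans hεr.le) fun ℓ hℓ => (hlim ℓ hℓ q' hq').trans (hlim ℓ hℓ q hq).symm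

end

/-! ### Uniform attraction and total stability -/

section

variable {E : Type*} [NormedAddCommGroup E] [NormedSpace ℝ E]
  {F : E → E} {V : E → ℝ} {p : E} {r : ℝ} {x : ℝ → E} {d : ℝ → E}

variable [FiniteDimensional ℝ E]

/-- Attraction to a stable attractive equilibrium is uniform over the starting points in a
small ball. -/
theorem IsLyapunov.uniformly_attractive (h : IsLyapunov F V p r)
    (hattr : ∃ δ > 0, ∀ x, IsODESolution F x → dist (x 0) p < δ → Tendsto x atTop (𝓝 p)) :
    ∃ ρ > 0, ∀ ε > 0, ∃ τ, 0 < τ ∧ ∀ z, IsODESolution F z →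
      (∀ t, 0 ≤ t → z t ∈ Metric.closedBall p r) → dist (z 0) p ≤ ρ → dist (z τ) p < ε := by
  have : ProperSpace E := FiniteDimensional.proper_real E
  obtain ⟨δ₀, hδ₀, hattr⟩ := hattr
  obtain ⟨δ₁, hδ₁, hex⟩ := h.exists_solution
  obtain ⟨K, hK⟩ := h.lip
  refine ⟨min δ₀ δ₁ / 2, by positivity, fun ε hε => ?_⟩
  have hε' : 0 < min ε r := lt_min hε h.pos
  obtain ⟨δ₂, hδ₂, hst⟩ := (h.mono hε' (min_le_right _ _)).stable
  -- Asking for the bound at all times after τ makes the property pass to finite unions, with the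
  -- larger of the two times, so that compactness of the ball applies.
  let P : Set E → Prop := fun s => ∃ τ, 0 ≤ τ ∧ ∀ z, IsODESolution F z →
    (∀ t, 0 ≤ t → z t ∈ Metric.closedBall p r) → z 0 ∈ s → ∀ t, τ ≤ t → dist (z t) p < ε
  have hP : P (Metric.closedBall p (min δ₀ δ₁ / 2)) := by
    refine (isCompact_closedBall p _).induction_on (p := P) ⟨0, le_rfl, by simp⟩ ?_ ?_ ?_
    · rintro s t hst ⟨τ, hτ, h1⟩
      exact ⟨τ, hτ, fun z hz hzr hz0 => h1 z hz hzr (hst hz0)⟩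
    · rintro s t ⟨τ, hτ, h1⟩ ⟨τ', hτ', h2⟩
      refine ⟨max τ τ', le_max_of_le_left hτ, fun z hz hzr hz0 u hu => ?_⟩
      rcases hz0 with h0 | h0
      · exact h1 z hz hzr h0 u ((le_max_left _ _).trans hu)
      · exact h2 z hz hzr h0 u ((le_max_right _ _).trans hu)
    · intro y hy
      have hy' : dist y p ≤ min δ₀ δ₁ / 2 := hy
      have hm : 0 < min δ₀ δ₁ := lt_min hδ₀ hδ₁
      have hyδ : dist y p < min δ₀ δ₁ := by linarith
      obtain ⟨z, hz0, hz, hzin⟩ := hex y (hyδ.trans_le (min_le_right _ _))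
      have ht := hattr z hz (by rw [hz0]; exact hyδ.trans_le (min_le_left _ _))
      obtain ⟨τ, hτ, hτ0⟩ := ((ht.eventually (Metric.ball_mem_nhds p hδ₂)).and
        (eventually_ge_atTop 0)).exists
      have hgap : 0 < (δ₂ - dist (z τ) p) * Real.exp (-(K * τ)) := by
        have : dist (z τ) p < δ₂ := hτ
        have : 0 < δ₂ - dist (z τ) p := by linarith
        positivity
      -- Solutions starting this near y are at time τ still so close to z that they lie in the
      -- δ₂-ball, from which stability keeps them within ε of p for good.
      refine ⟨Metric.ball y ((δ₂ - dist (z τ) p) * Real.exp (-(K * τ))),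
        mem_nhdsWithin_of_mem_nhds (Metric.ball_mem_nhds _ hgap), τ, hτ0, ?_⟩
      intro w hw hwr hw0 t htτ
      have h2 := dist_le_gronwallBound_of_perturbed (d := fun _ => 0) (η := 0) (T := τ) hK
        (fun u hu => by simpa using hw u hu.1) (fun u hu => hwr u hu.1) (by simp) hz
        (fun u hu => (hzin u hu).le) τ ⟨hτ0, le_rfl⟩
      rw [gronwallBound_ε0, hz0] at h2
      have h3 : dist (w 0) y * Real.exp (K * τ) < δ₂ - dist (z τ) p := by
        calc _ < (δ₂ - dist (z τ) p) * Real.exp (-(K * τ)) * Real.exp (K * τ) := by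
              have : dist (w 0) y < (δ₂ - dist (z τ) p) * Real.exp (-(K * τ)) := hw0
              gcongr
          _ = _ := by rw [mul_assoc, ← Real.exp_add]; simp
      have h4 : dist (w τ) p < δ₂ := by linarith [dist_triangle (w τ) (z τ) p]
      have h5 := hst _ ((hw.shift hτ0).solvesWhileIn _) (by simpa using h4) (t - τ) (by linarith)
      simp only [add_sub_cancel] at h5
      exact h5.trans_le (min_le_left _ _)
  obtain ⟨τ, hτ, h1⟩ := hP
  -- Adding 1 makes the time strictly positive, so that [0, ∞) can later be divided into windows of
  -- this length.
  exact ⟨τ + 1, by linarith, fun z hz hzr hz0 => h1 z hz hzr hz0 _ (by linarith)⟩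

/-- For equal initial points the bound is continuous in the size η of the perturbation and vanishes
at η = 0. -/
theorem exists_gronwallBound_lt (K τ : ℝ) {c : ℝ} (hc : 0 < c) :
    ∃ η > 0, gronwallBound 0 K η τ < c := by
  have h1 : Tendsto (fun η => gronwallBound 0 K η τ) (𝓝 0) (𝓝 0) := by
    have := (gronwallBound_continuous_ε 0 K τ).tendsto 0
    rwa [gronwallBound_ε0_δ0] at this
  have h2 := (h1.eventually_lt_const hc).filter_mono (nhdsWithin_le_nhds (s := Ioi 0))
  obtain ⟨η, h3, h4⟩ := (h2.and self_mem_nhdsWithin).exists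
  exact ⟨η, h4, h3⟩

/-- Total stability: solutions of a slightly perturbed equation stay near an asymptotically
stable equilibrium. -/
theorem IsLyapunov.totally_stable (h : IsLyapunov F V p r)
    (hattr : ∃ δ > 0, ∀ x, IsODESolution F x → dist (x 0) p < δ → Tendsto x atTop (𝓝 p)) :
    ∃ δ > 0, ∀ x d, SolvesWhileIn F d (Metric.closedBall p r) x → (∀ t, 0 ≤ t → ‖d t‖ ≤ δ) →
      dist (x 0) p < δ → ∀ t, 0 ≤ t → dist (x t) p < r := by
  obtain ⟨ρ, hρ, hunif⟩ := h.uniformly_attractive hattr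
  obtain ⟨K, hK⟩ := h.lip
  have hr2 : 0 < r / 2 := half_pos h.pos
  obtain ⟨δ₁, hδ₁, hex⟩ := (h.mono hr2 (half_le_self h.pos.le)).exists_solution
  have hδ : 0 < min (min δ₁ ρ) (r / 2) := by simp [hδ₁, hρ, h.pos]
  set δ : ℝ := min (min δ₁ ρ) (r / 2) with hδdef
  have hle1 : δ ≤ δ₁ := (min_le_left _ _).trans (min_le_left _ _)
  have hle2 : δ ≤ ρ := (min_le_left _ _).trans (min_le_right _ _)
  have hle3 : δ ≤ r / 2 := min_le_right _ _
  -- In time τ the unperturbed flow contracts the δ-ball into the δ/2-ball, and η is so small that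
  -- the perturbation costs less than δ/2 over that time. Each window of length τ therefore ends
  -- where it may start again.
  obtain ⟨τ, hτ, hτz⟩ := hunif (δ / 2) (half_pos hδ)
  obtain ⟨η, hη, hg⟩ := exists_gronwallBound_lt K τ (half_pos hδ)
  have hstep : ∀ x d, SolvesWhileIn F d (Metric.closedBall p r) x → (∀ t, 0 ≤ t → ‖d t‖ ≤ η) →
      dist (x 0) p < δ → (∀ t ∈ Icc 0 τ, dist (x t) p < r) ∧ dist (x τ) p < δ := by
    intro x d hx hd hx0
    obtain ⟨z, hz0, hz, hzin⟩ := hex (x 0) (hx0.trans_le hle1)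
    have hzr : ∀ t, 0 ≤ t → z t ∈ Metric.closedBall p r := fun t ht =>
      ((hzin t ht).trans_le (half_le_self h.pos.le)).le
    have hclose : ∀ T ∈ Icc 0 τ, (∀ s ∈ Icc 0 T, x s ∈ Metric.closedBall p r) →
        dist (x T) (z T) < δ / 2 := by
      intro T hT hxT
      have h2 := dist_le_gronwallBound_of_perturbed (η := η) (T := T) hK
        (fun u hu => hx.deriv u hu.1 fun s hs => hxT s ⟨hs.1, hs.2.trans hu.2⟩) hxT
        (fun u hu => hd u hu.1) hz hzr T ⟨hT.1, le_rfl⟩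
      rw [hz0, dist_self] at h2
      exact (h2.trans (gronwallBound_mono le_rfl hη.le K.2 hT.2)).trans_lt hg
    -- No exit within the window: z stays within r/2 of p, and x within δ/2 ≤ r/4 of z up to a first
    -- exit.
    have hin : ∀ t ∈ Icc 0 τ, dist (x t) p < r := by
      intro t ht
      by_contra! hc
      obtain ⟨T, hT0, hTt, hTe, hTin⟩ := exists_first_exit hx.cont
        (hx0.trans (by linarith)) ht.1 hc
      have h1 := hclose T ⟨hT0, hTt.trans ht.2⟩ hTin
      have h2 := hzin T hT0
      linarith [dist_triangle (x T) (z T) p]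
    refine ⟨hin, ?_⟩
    have h1 := hclose τ ⟨hτ.le, le_rfl⟩ fun s hs => (hin s hs).le
    have h2 := hτz z hz hzr (by rw [hz0]; exact hx0.le.trans hle2)
    linarith [dist_triangle (x τ) (z τ) p]
  have hn : ∀ n : ℕ, ∀ x d, SolvesWhileIn F d (Metric.closedBall p r) x →
      (∀ t, 0 ≤ t → ‖d t‖ ≤ η) → dist (x 0) p < δ →
      ∀ t ∈ Icc 0 (n * τ), dist (x t) p < r := by
    intro n
    induction n with
    | zero =>
      intro x d hx hd hx0 t ht
      simp only [Nat.cast_zero, zero_mul, Icc_self, mem_singleton_iff] at ht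
      rw [ht]; linarith
    | succ n ih =>
      intro x d hx hd hx0 t ht
      obtain ⟨h1, h2⟩ := hstep x d hx hd hx0
      rcases le_total t τ with h3 | h3
      · exact h1 t ⟨ht.1, h3⟩
      · have := ih _ _ (hx.shift hτ.le fun s hs => (h1 s hs).le)
          (fun s hs => hd (τ + s) (by linarith)) (by simpa using h2) (t - τ)
          ⟨by linarith, by have := ht.2; push_cast at this; linarith⟩
        simpa using this
  refine ⟨min δ η, lt_min hδ hη, fun x d hx hd hx0 t ht => ?_⟩
  obtain ⟨n, hnt⟩ := exists_nat_ge (t / τ)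
  rw [div_le_iff₀ hτ] at hnt
  exact hn n x d hx (fun s hs => (hd s hs).trans (min_le_right _ _))
    (hx0.trans_le (min_le_left _ _)) t ⟨ht, hnt⟩

/-- Under a small perturbation, solutions stay near an asymptotically stable equilibrium, and they
converge to it if the perturbation vanishes at infinity. -/
theorem IsLyapunov.perturbed (h : IsLyapunov F V p r)
    (hattr : ∃ δ > 0, ∀ x, IsODESolution F x → dist (x 0) p < δ → Tendsto x atTop (𝓝 p)) :
    ∃ δ > 0, ∀ x d, SolvesWhileIn F d (Metric.closedBall p r) x → (∀ t, 0 ≤ t → ‖d t‖ ≤ δ) →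
      dist (x 0) p < δ → (∀ t, 0 ≤ t → dist (x t) p < r) ∧
        (Tendsto d atTop (𝓝 0) → Tendsto x atTop (𝓝 p)) := by
  obtain ⟨ρ, hρ, hunif⟩ := h.uniformly_attractive hattr
  obtain ⟨K, hK⟩ := h.lip
  obtain ⟨δ₀, hδ₀, hex⟩ := h.exists_solution
  have hr1 : 0 < min (min ρ (δ₀ / 2)) r := by simp [hδ₀, hρ, h.pos]
  -- Staying within r₁ ensures that at any time an unperturbed solution can be started at the
  -- current point and is attracted uniformly.
  set r₁ : ℝ := min (min ρ (δ₀ / 2)) r with hr1def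
  have hle1 : r₁ ≤ ρ := (min_le_left _ _).trans (min_le_left _ _)
  have hle2 : r₁ ≤ δ₀ / 2 := (min_le_left _ _).trans (min_le_right _ _)
  have hle3 : r₁ ≤ r := min_le_right _ _
  obtain ⟨δ, hδ, hst⟩ := (h.mono hr1 hle3).totally_stable hattr
  refine ⟨δ, hδ, fun x d hx hd hx0 => ?_⟩
  have hin := hst x d (hx.mono (Metric.closedBall_subset_closedBall hle3)) hd hx0
  refine ⟨fun t ht => (hin t ht).trans_le hle3, fun hd0 => ?_⟩
  rw [Metric.tendsto_nhds]
  intro ε hε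
  have hε' : 0 < min ε r := lt_min hε h.pos
  have hεr : min ε r ≤ r := min_le_right _ _
  -- By total stability for the target ε, it is enough to enter the δ'-ball once after d has become
  -- small. Following the unperturbed solution from x T for a time τ does this: δ'/2 for the
  -- attraction, δ'/2 for the perturbation.
  obtain ⟨δ', hδ', hst'⟩ := (h.mono hε' hεr).totally_stable hattr
  obtain ⟨τ, hτ, hτz⟩ := hunif (δ' / 2) (half_pos hδ')
  obtain ⟨η, hη, hg⟩ := exists_gronwallBound_lt K τ (half_pos hδ')
  have hev : ∀ᶠ t in atTop, ‖d t‖ < min δ' η := by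
    have := hd0.norm
    rw [norm_zero] at this
    exact this.eventually_lt_const (lt_min hδ' hη)
  obtain ⟨T, hT⟩ := (hev.and (eventually_ge_atTop 0)).exists_forall_of_atTop
  have hT0 : 0 ≤ T := (hT T le_rfl).2
  have hxr : ∀ t, 0 ≤ t → x t ∈ Metric.closedBall p r := fun t ht =>
    ((hin t ht).trans_le hle3).le
  obtain ⟨z, hz0, hz, hzin⟩ := hex (x T) (by linarith [hin T hT0])
  have h1 := dist_le_gronwallBound_of_perturbed (η := η) (T := τ) (x := fun s => x (T + s))
    (d := fun s => d (T + s)) hK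
    (fun u hu => (hx.shift hT0 fun s hs => hxr s hs.1).deriv u hu.1 fun s hs =>
      hxr _ (by linarith [hs.1]))
    (fun u hu => hxr _ (by linarith [hu.1]))
    (fun u hu => (hT (T + u) (by linarith [hu.1])).1.le.trans (min_le_right _ _)) hz
    (fun t ht => (hzin t ht).le) τ ⟨hτ.le, le_rfl⟩
  simp only [add_zero, hz0, dist_self] at h1
  have h2 := hτz z hz (fun t ht => (hzin t ht).le) (by rw [hz0]; linarith [hin T hT0])
  have h3 : dist (x (T + τ)) p < δ' := by linarith [dist_triangle (x (T + τ)) (z τ) p]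
  have hTτ : 0 ≤ T + τ := by linarith
  have h4 := hst' _ _ ((hx.shift hTτ fun s hs => hxr s hs.1).mono
      (Metric.closedBall_subset_closedBall hεr))
    (fun t ht => (hT (T + τ + t) (by linarith)).1.le.trans (min_le_left _ _)) (by simpa using h3)
  filter_upwards [eventually_ge_atTop (T + τ)] with t ht
  have := h4 (t - (T + τ)) (by linarith)
  rw [add_sub_cancel] at this
  exact this.trans_le (min_le_left _ _)

end

/-! ### Local Lipschitz continuity of sums, products and scalings -/

theorem locallyLipschitz_sum {α ι : Type*} [PseudoEMetricSpace α] (s : Finset ι)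
    {f : ι → α → ℝ} (hf : ∀ i, LocallyLipschitz (f i)) :
    LocallyLipschitz (fun x => ∑ i ∈ s, f i x) := by
  classical
  induction s using Finset.induction_on with
  | empty => simpa using LocallyLipschitz.const (0 : ℝ)
  | insert i s hi ih =>
    simp only [Finset.sum_insert hi]
    exact (hf i).add ih

theorem locallyLipschitz_neg {α E : Type*} [PseudoEMetricSpace α] [NormedAddCommGroup E]
    {f : α → E} (hf : LocallyLipschitz f) : LocallyLipschitz (fun x => -f x) := by
  simpa using (LocallyLipschitz.const (0 : E)).sub hf

theorem locallyLipschitz_pi {α ι : Type*} [PseudoEMetricSpace α] [Fintype ι] {β : ι → Type*}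
    [∀ i, PseudoEMetricSpace (β i)] {f : ∀ i, α → β i} (hf : ∀ i, LocallyLipschitz (f i)) :
    LocallyLipschitz (fun x i => f i x) := by
  intro x
  choose K t ht hK using fun i => hf i x
  refine ⟨∑ i, K i, ⋂ i, t i, Filter.iInter_mem.2 ht, fun y hy z hz => ?_⟩
  refine edist_pi_le_iff.2 fun i => (hK i (mem_iInter.1 hy i) (mem_iInter.1 hz i)).trans ?_
  gcongr
  exact Finset.single_le_sum (f := K) (fun _ _ => zero_le) (Finset.mem_univ i)

theorem locallyLipschitz_const_mul {α : Type*} [PseudoEMetricSpace α] {f : α → ℝ} (a : ℝ)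
    (hf : LocallyLipschitz f) : LocallyLipschitz (fun x => a * f x) :=
  (ContDiff.locallyLipschitz (𝕂 := ℝ) (f := fun t : ℝ => a * t) (by fun_prop)).comp hf

theorem locallyLipschitz_div_const {α : Type*} [PseudoEMetricSpace α] {f : α → ℝ} (a : ℝ)
    (hf : LocallyLipschitz f) : LocallyLipschitz (fun x => f x / a) :=
  (ContDiff.locallyLipschitz (𝕂 := ℝ) (f := fun t : ℝ => t / a) (by fun_prop)).comp hf

theorem IOSystem.locallyLipschitz_neg_f (S : IOSystem) :
    LocallyLipschitz (fun z : S.X × ℝ => -S.f z.1 z.2) :=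
  locallyLipschitz_neg S.f_lip

/-! ### Passive networks: vector field, energy and power balance -/

/-- A network of masses `J` and massless nodes `Q`, coupled by lines `L` with sinusoidal flows, with
input/output systems `I` attached to the masses. -/
structure PassiveNet (L J Q I : Type*) where
  S : I → IOSystem
  att : I → J
  κ : I → ℝ
  κ_pos : ∀ i, 0 < κ i
  R : L → J → ℝ
  R' : L → Q → ℝ
  b : L → ℝ
  b_pos : ∀ l, 0 < b l
  M : J → ℝ
  M_pos : ∀ j, 0 < M j
  D : J → ℝ
  D_nonneg : ∀ j, 0 ≤ D j
  active : ∀ j, 0 < D j ∨ ∃ i, att i = j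
  c : J → ℝ
  D' : Q → ℝ
  D'_pos : ∀ q, 0 < D' q
  c' : Q → ℝ

namespace PassiveNet

variable {L J Q I : Type*}

/-- States: line angles, velocities of the masses, states of the attached systems. -/
abbrev State (A : PassiveNet L J Q I) : Type _ :=
  (L → ℝ) × (J → ℝ) × (∀ i, (A.S i).X)

variable [Fintype L]

/-- Velocities of the massless nodes. -/
noncomputable def w (A : PassiveNet L J Q I) (η : L → ℝ) (q : Q) : ℝ :=
  (A.c' q - ∑ l, A.R' l q * (A.b l * Real.sin (η l))) / A.D' q

theorem D'_mul_w_sub (A : PassiveNet L J Q I) (η η' : L → ℝ) (q : Q) :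
    A.D' q * (A.w η q - A.w η' q) =
      -∑ l, A.R' l q * (A.b l * (Real.sin (η l) - Real.sin (η' l))) := by
  have h := (A.D'_pos q).ne'
  have : A.w η q - A.w η' q =
      (-∑ l, A.R' l q * (A.b l * (Real.sin (η l) - Real.sin (η' l)))) / A.D' q := by
    unfold w
    rw [← sub_div]
    congr 1
    simp only [mul_sub, Finset.sum_sub_distrib]
    ring
  rw [this, mul_div_cancel₀ _ h]

theorem w_eq_of_sum_eq_zero (A : PassiveNet L J Q I) {η η' : L → ℝ} {q : Q}
    (h : ∑ l, A.R' l q * (A.b l * (Real.sin (η l) - Real.sin (η' l))) = 0) :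
    A.w η q = A.w η' q := by
  have h1 := A.D'_mul_w_sub η η' q
  rw [h, neg_zero] at h1
  exact sub_eq_zero.1 ((mul_eq_zero.1 h1).resolve_left (A.D'_pos q).ne')

variable [Fintype J] [Fintype I]

theorem locallyLipschitz_velocity (A : PassiveNet L J Q I) (j : J) :
    LocallyLipschitz (fun y : A.State => y.2.1 j) :=
  ContDiff.locallyLipschitz (𝕂 := ℝ) (by fun_prop)

theorem locallyLipschitz_state_velocity (A : PassiveNet L J Q I) (i : I) :
    LocallyLipschitz (fun y : A.State => (y.2.2 i, y.2.1 (A.att i))) := by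
  have h1 : LocallyLipschitz (fun y : A.State => y.2.2) :=
    LocallyLipschitz.comp LipschitzWith.prod_snd.locallyLipschitz
      LipschitzWith.prod_snd.locallyLipschitz
  have h2 : LocallyLipschitz (fun y : A.State => y.2.2 i) :=
    LocallyLipschitz.comp (LipschitzWith.eval (α := fun i => (A.S i).X) i).locallyLipschitz h1
  exact h2.prodMk (ContDiff.locallyLipschitz (𝕂 := ℝ) (by fun_prop))

theorem locallyLipschitz_output (A : PassiveNet L J Q I) (i : I) :
    LocallyLipschitz (fun y : A.State => (A.S i).output (y.2.2 i) (y.2.1 (A.att i))) := by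
  have h2 : LocallyLipschitz (fun y : A.State => (A.S i).g (y.2.2 i) (y.2.1 (A.att i))) :=
    (A.S i).g_lip.comp (A.locallyLipschitz_state_velocity i)
  simpa [IOSystem.output] using (LocallyLipschitz.const (0 : ℝ)).sub h2

theorem hasDerivWithinAt_state {A : PassiveNet L J Q I} {y : ℝ → A.State} {v : A.State}
    {s : Set ℝ} {t : ℝ} (h1 : ∀ l, HasDerivWithinAt (fun u => (y u).1 l) (v.1 l) s t)
    (h2 : ∀ j, HasDerivWithinAt (fun u => (y u).2.1 j) (v.2.1 j) s t)
    (h3 : ∀ i, HasDerivWithinAt (fun u => (y u).2.2 i) (v.2.2 i) s t) :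
    HasDerivWithinAt y v s t :=
  (hasDerivWithinAt_pi.2 h1).prodMk ((hasDerivWithinAt_pi.2 h2).prodMk (hasDerivWithinAt_pi.2 h3))

variable [DecidableEq J] [Fintype Q]

/-- The vector field of the network. -/
noncomputable def field (A : PassiveNet L J Q I) (y : A.State) : A.State :=
  (fun l => ∑ j, A.R l j * y.2.1 j + ∑ q, A.R' l q * A.w y.1 q,
   fun j => (A.c j - A.D j * y.2.1 j +
      ∑ i, (if A.att i = j then A.κ i * (A.S i).output (y.2.2 i) (y.2.1 (A.att i)) else 0) -
      ∑ l, A.R l j * (A.b l * Real.sin (y.1 l))) / A.M j,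
   fun i => -(A.S i).f (y.2.2 i) (y.2.1 (A.att i)))

/-- Potential energy of the lines, kinetic energy, and storage functions. -/
noncomputable def energy (A : PassiveNet L J Q I) (p : A.State) (W : ∀ i, (A.S i).X → ℝ) (y : A.State) : ℝ :=
  ∑ l, A.b l * (-Real.cos (y.1 l) - Real.sin (p.1 l) * y.1 l) +
    ∑ j, A.M j * ((y.2.1 j - p.2.1 j) ^ 2 / 2) + ∑ i, A.κ i * W i (y.2.2 i)

/-- A lower bound for the rate at which the energy decreases. -/
noncomputable def dissipation (A : PassiveNet L J Q I) (p : A.State) (φ : I → ℝ → ℝ) (y : A.State) : ℝ :=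
  ∑ j, A.D j * (y.2.1 j - p.2.1 j) ^ 2 + ∑ q, A.D' q * (A.w y.1 q - A.w p.1 q) ^ 2 +
    ∑ i, A.κ i * φ i (-y.2.1 (A.att i) + p.2.1 (A.att i))

theorem field_angle_sub (A : PassiveNet L J Q I) (y p : A.State) (l : L) :
    (A.field y).1 l - (A.field p).1 l = ∑ j, A.R l j * (y.2.1 j - p.2.1 j) +
      ∑ q, A.R' l q * (A.w y.1 q - A.w p.1 q) := by
  simp only [field, mul_sub, Finset.sum_sub_distrib]
  ring

theorem M_mul_field_sub (A : PassiveNet L J Q I) (y p : A.State) (j : J) :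
    A.M j * ((A.field y).2.1 j - (A.field p).2.1 j) = -(A.D j * (y.2.1 j - p.2.1 j)) +
      ∑ i, (if A.att i = j then A.κ i * ((A.S i).output (y.2.2 i) (y.2.1 (A.att i)) -
        (A.S i).output (p.2.2 i) (p.2.1 (A.att i))) else 0) -
      ∑ l, A.R l j * (A.b l * (Real.sin (y.1 l) - Real.sin (p.1 l))) := by
  have h := (A.M_pos j).ne'
  simp only [field]
  rw [← sub_div, mul_div_cancel₀ _ h]
  have : ∀ i, (if A.att i = j then A.κ i * ((A.S i).output (y.2.2 i) (y.2.1 (A.att i)) -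
        (A.S i).output (p.2.2 i) (p.2.1 (A.att i))) else 0) =
      (if A.att i = j then A.κ i * (A.S i).output (y.2.2 i) (y.2.1 (A.att i)) else 0) -
      (if A.att i = j then A.κ i * (A.S i).output (p.2.2 i) (p.2.1 (A.att i)) else 0) := by
    intro i; split_ifs <;> ring
  simp only [this]
  simp only [mul_sub, Finset.sum_sub_distrib]
  ring

/-- The power balance of the network, relative to an equilibrium. -/
theorem power_balance (A : PassiveNet L J Q I) {p : A.State} (hp : A.field p = 0) (y : A.State) :
    ∑ l, A.b l * ((Real.sin (y.1 l) - Real.sin (p.1 l)) * (A.field y).1 l) +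
      ∑ j, A.M j * ((y.2.1 j - p.2.1 j) * (A.field y).2.1 j) =
    -∑ j, A.D j * (y.2.1 j - p.2.1 j) ^ 2 - ∑ q, A.D' q * (A.w y.1 q - A.w p.1 q) ^ 2 +
      ∑ i, A.κ i * ((y.2.1 (A.att i) - p.2.1 (A.att i)) *
        ((A.S i).output (y.2.2 i) (y.2.1 (A.att i)) -
          (A.S i).output (p.2.2 i) (p.2.1 (A.att i)))) := by
  have h1 : ∀ l, (A.field y).1 l = ∑ j, A.R l j * (y.2.1 j - p.2.1 j) +
      ∑ q, A.R' l q * (A.w y.1 q - A.w p.1 q) := fun l => by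
    rw [← field_angle_sub, hp]; simp
  have h2 := fun j => A.M_mul_field_sub y p j
  simp only [hp, Prod.snd_zero, Prod.fst_zero, Pi.zero_apply, sub_zero] at h2
  -- The same coefficients R, R' turn velocities into angle rates and line flows into nodal powers.
  -- Exchanging the sums in e1 therefore yields terms that cancel the flow terms of the masses in e2
  -- and become damping at the massless nodes in e4.
  have e1 : ∑ l, A.b l * ((Real.sin (y.1 l) - Real.sin (p.1 l)) * (A.field y).1 l) =
      ∑ j, (y.2.1 j - p.2.1 j) *
        ∑ l, A.R l j * (A.b l * (Real.sin (y.1 l) - Real.sin (p.1 l))) +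
      ∑ q, (A.w y.1 q - A.w p.1 q) *
        ∑ l, A.R' l q * (A.b l * (Real.sin (y.1 l) - Real.sin (p.1 l))) := by
    simp only [h1, Finset.mul_sum, mul_add, Finset.sum_add_distrib]
    congr 1
    · rw [Finset.sum_comm]
      exact Finset.sum_congr rfl fun _ _ => Finset.sum_congr rfl fun _ _ => by ring
    · rw [Finset.sum_comm]
      exact Finset.sum_congr rfl fun _ _ => Finset.sum_congr rfl fun _ _ => by ring
  have e2 : ∑ j, A.M j * ((y.2.1 j - p.2.1 j) * (A.field y).2.1 j) =
      -∑ j, A.D j * (y.2.1 j - p.2.1 j) ^ 2 +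
      ∑ j, (y.2.1 j - p.2.1 j) * ∑ i, (if A.att i = j then A.κ i *
        ((A.S i).output (y.2.2 i) (y.2.1 (A.att i)) -
        (A.S i).output (p.2.2 i) (p.2.1 (A.att i))) else 0) -
      ∑ j, (y.2.1 j - p.2.1 j) *
        ∑ l, A.R l j * (A.b l * (Real.sin (y.1 l) - Real.sin (p.1 l))) := by
    rw [← Finset.sum_neg_distrib, ← Finset.sum_add_distrib, ← Finset.sum_sub_distrib]
    refine Finset.sum_congr rfl fun j _ => ?_
    rw [mul_left_comm, h2]
    ring
  have e3 : ∑ j, (y.2.1 j - p.2.1 j) * ∑ i, (if A.att i = j then A.κ i *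
        ((A.S i).output (y.2.2 i) (y.2.1 (A.att i)) -
        (A.S i).output (p.2.2 i) (p.2.1 (A.att i))) else 0) =
      ∑ i, A.κ i * ((y.2.1 (A.att i) - p.2.1 (A.att i)) *
        ((A.S i).output (y.2.2 i) (y.2.1 (A.att i)) -
          (A.S i).output (p.2.2 i) (p.2.1 (A.att i)))) := by
    simp only [Finset.mul_sum]
    rw [Finset.sum_comm]
    refine Finset.sum_congr rfl fun i _ => ?_
    simp only [mul_ite, mul_zero, Finset.sum_ite_eq, Finset.mem_univ, if_true]
    ring
  have e4 : ∑ q, (A.w y.1 q - A.w p.1 q) *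
        ∑ l, A.R' l q * (A.b l * (Real.sin (y.1 l) - Real.sin (p.1 l))) =
      -∑ q, A.D' q * (A.w y.1 q - A.w p.1 q) ^ 2 := by
    rw [← Finset.sum_neg_distrib]
    refine Finset.sum_congr rfl fun q _ => ?_
    have := A.D'_mul_w_sub y.1 p.1 q
    linear_combination (A.w y.1 q - A.w p.1 q) * this
  rw [e1, e2, e3, e4]
  ring

theorem locallyLipschitz_field_angle (A : PassiveNet L J Q I) :
    LocallyLipschitz (fun y : A.State => (A.field y).1) := by
  have hw : ∀ q, LocallyLipschitz (fun y : A.State => A.w y.1 q) := fun q =>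
    ContDiff.locallyLipschitz (𝕂 := ℝ) (by unfold w; fun_prop)
  exact locallyLipschitz_pi fun l =>
    (locallyLipschitz_sum _ fun j => locallyLipschitz_const_mul _
      (A.locallyLipschitz_velocity j)).add
    (locallyLipschitz_sum _ fun q => locallyLipschitz_const_mul _ (hw q))

theorem locallyLipschitz_field_velocity (A : PassiveNet L J Q I) :
    LocallyLipschitz (fun y : A.State => (A.field y).2.1) := by
  refine locallyLipschitz_pi fun j => locallyLipschitz_div_const _ ?_
  have e1 := (LocallyLipschitz.const (α := A.State) (A.c j)).sub
    (locallyLipschitz_const_mul (A.D j) (A.locallyLipschitz_velocity j))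
  have e2 : LocallyLipschitz (fun y : A.State =>
      ∑ l, A.R l j * (A.b l * Real.sin (y.1 l))) :=
    ContDiff.locallyLipschitz (𝕂 := ℝ) (by fun_prop)
  have e3 : LocallyLipschitz (fun y : A.State => ∑ i, (if A.att i = j then
      A.κ i * (A.S i).output (y.2.2 i) (y.2.1 (A.att i)) else 0)) := by
    refine locallyLipschitz_sum _ fun i => ?_
    split_ifs
    · exact locallyLipschitz_const_mul _ (A.locallyLipschitz_output i)
    · exact LocallyLipschitz.const _
  exact (e1.add e3).sub e2

theorem locallyLipschitz_field_state (A : PassiveNet L J Q I) :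
    LocallyLipschitz (fun y : A.State => (A.field y).2.2) := by
  have h : ∀ i, LocallyLipschitz (fun y : A.State =>
      -(A.S i).f (y.2.2 i) (y.2.1 (A.att i))) := by
    intro i
    have h1 := LocallyLipschitz.comp (A.S i).locallyLipschitz_neg_f
      (A.locallyLipschitz_state_velocity i)
    simp only [Function.comp_def] at h1
    exact h1
  exact locallyLipschitz_pi h

theorem locallyLipschitz_field (A : PassiveNet L J Q I) : LocallyLipschitz A.field :=
  A.locallyLipschitz_field_angle.prodMk
    (A.locallyLipschitz_field_velocity.prodMk A.locallyLipschitz_field_state)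

end PassiveNet

/-! ### The energy as a Lyapunov function -/

/-- The tangent line inequality for `-cos`, strictly convex on `(-π/2, π/2)`. -/
theorem neg_cos_sub_sin_mul_lt {a x : ℝ} (ha : |a| < Real.pi / 2) (hx : |x| < Real.pi / 2)
    (hne : x ≠ a) :
    -Real.cos a - Real.sin a * a < -Real.cos x - Real.sin a * x := by
  rw [abs_lt] at ha hx
  have hd : ∀ s : Set ℝ, ∀ t : ℝ, HasDerivWithinAt (fun y => -Real.cos y - Real.sin a * y)
      (Real.sin t - Real.sin a) s t := fun s t => by
    have := ((Real.hasDerivAt_cos t).neg.sub ((hasDerivAt_id t).const_mul (Real.sin a)))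
    convert! this.hasDerivWithinAt using 1
    simp
  have hc : Continuous (fun y => -Real.cos y - Real.sin a * y) := by fun_prop
  have hmono := Real.strictMonoOn_sin
  rcases lt_or_gt_of_ne hne with h | h
  · refine strictAntiOn_of_hasDerivWithinAt_neg (convex_Icc x a) hc.continuousOn
      (fun t _ => hd _ t) (fun t ht => ?_) ⟨le_rfl, h.le⟩ ⟨h.le, le_rfl⟩ h
    rw [interior_Icc] at ht
    exact sub_neg.2 (hmono ⟨by linarith [ht.1], by linarith [ht.2]⟩ ⟨by linarith, by linarith⟩ ht.2)
  · refine strictMonoOn_of_hasDerivWithinAt_pos (convex_Icc a x) hc.continuousOn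
      (fun t _ => hd _ t) (fun t ht => ?_) ⟨le_rfl, h.le⟩ ⟨h.le, le_rfl⟩ h
    rw [interior_Icc] at ht
    exact sub_pos.2 (hmono ⟨by linarith, by linarith⟩ ⟨by linarith [ht.1], by linarith [ht.2]⟩ ht.1)

namespace PassiveNet

variable {L J Q I : Type*} [Fintype L] [Fintype J] [Fintype I] [DecidableEq J] [Fintype Q]

/-- The hypotheses on an equilibrium `p` and a radius under which the energy is a Lyapunov
function. -/
structure IsPassiveAt (A : PassiveNet L J Q I) (p : A.State) (W : ∀ i, (A.S i).X → ℝ)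
    (φ : I → ℝ → ℝ) (r : ℝ) : Prop where
  pos : 0 < r
  eq : A.field p = 0
  angle : ∀ y ∈ Metric.closedBall p r, ∀ l, |y.1 l| < Real.pi / 2
  φ_zero : ∀ i, φ i 0 = 0
  φ_pos : ∀ i v, v ≠ 0 → 0 < φ i v
  diff : ∀ y ∈ Metric.closedBall p r, ∀ i, DifferentiableAt ℝ (W i) (y.2.2 i)
  passive : ∀ y ∈ Metric.closedBall p r, ∀ i,
    fderiv ℝ (W i) (y.2.2 i) (-(A.S i).f (y.2.2 i) (y.2.1 (A.att i))) ≤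
      (-y.2.1 (A.att i) + p.2.1 (A.att i)) * ((A.S i).output (y.2.2 i) (y.2.1 (A.att i)) -
        (A.S i).output (p.2.2 i) (p.2.1 (A.att i))) -
      φ i (-y.2.1 (A.att i) + p.2.1 (A.att i))
  lt_of_ne : ∀ y ∈ Metric.closedBall p r, ∀ i, y.2.2 i ≠ p.2.2 i →
    W i (p.2.2 i) < W i (y.2.2 i)
  attractive : ∀ y ∈ Metric.closedBall p r, ∀ i x, (A.S i).IsSolution (p.2.1 (A.att i)) x →
    x 0 = y.2.2 i → Tendsto x atTop (𝓝 (p.2.2 i))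

/-- Apart from the equation at p and the properties of φ, every condition holds on a neighbourhood
of p, and there are finitely many, so one ball serves for all. -/
theorem exists_isPassiveAt (A : PassiveNet L J Q I) {p : A.State} (hp : A.field p = 0)
    (hη : ∀ l, |p.1 l| < Real.pi / 2)
    (hS : ∀ i, (A.S i).IsLocallyInputStrictlyPassive (p.2.1 (A.att i)) (p.2.2 i) ∧
      (A.S i).IsAsymptoticallyStable (p.2.1 (A.att i)) (p.2.2 i)) :
    ∃ W φ r, 0 < r ∧ ∀ r', 0 < r' → r' ≤ r → A.IsPassiveAt p W φ r' := by
  choose W hW hmin using fun i => (hS i).1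
  choose Ω Dm φ hΩ hΩp hD hDp hWD hW0 hφ0 hφ hpass using hW
  choose δ hδ hattr using fun i => (hS i).2.2.2
  have c1 : ∀ l, Continuous (fun y : A.State => y.1 l) := fun l => by fun_prop
  have c2 : ∀ j, Continuous (fun y : A.State => y.2.1 j) := fun j => by fun_prop
  have c3 : ∀ i, Continuous (fun y : A.State => y.2.2 i) := fun i =>
    (continuous_apply i).comp (continuous_snd.comp continuous_snd)
  have hev : ∀ᶠ y in 𝓝 p, (∀ l, |y.1 l| < Real.pi / 2) ∧ (∀ i, y.2.1 (A.att i) ∈ Ω i) ∧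
      (∀ i, y.2.2 i ∈ Dm i) ∧ (∀ i, y.2.2 i ≠ p.2.2 i → W i (p.2.2 i) < W i (y.2.2 i)) ∧
      (∀ i, dist (y.2.2 i) (p.2.2 i) < δ i) := by
    refine (eventually_all.2 fun l => ?_).and ((eventually_all.2 fun i => ?_).and
      ((eventually_all.2 fun i => ?_).and ((eventually_all.2 fun i => ?_).and
        (eventually_all.2 fun i => ?_))))
    · exact ((c1 l).abs.tendsto p).eventually_lt_const (hη l)
    · exact (c2 (A.att i)).continuousAt.eventually ((hΩ i).mem_nhds (hΩp i))
    · exact (c3 i).continuousAt.eventually ((hD i).mem_nhds (hDp i))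
    · exact (c3 i).continuousAt.eventually (eventually_nhdsWithin_iff.1 (hmin i))
    · exact (c3 i).continuousAt.eventually (Metric.ball_mem_nhds _ (hδ i))
  obtain ⟨r, hr, hball⟩ := Metric.nhds_basis_closedBall.eventually_iff.1 hev
  refine ⟨W, φ, r, hr, fun r' hr' hle => ?_⟩
  have hb := fun y (hy : y ∈ Metric.closedBall p r') =>
    hball (Metric.closedBall_subset_closedBall hle hy)
  refine ⟨hr', hp, fun y hy => (hb y hy).1, hφ0, hφ, fun y hy i => ?_, fun y hy i => ?_,
    fun y hy => (hb y hy).2.2.2.1, fun y hy i x hx hx0 => ?_⟩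
  · exact ((hWD i).differentiableOn one_ne_zero).differentiableAt
      ((hD i).mem_nhds ((hb y hy).2.2.1 i))
  · exact hpass i _ ((hb y hy).2.1 i) _ ((hb y hy).2.2.1 i)
  · exact hattr i x hx (hx0 ▸ (hb y hy).2.2.2.2 i)

theorem hasDerivWithinAt_energy (A : PassiveNet L J Q I) {p : A.State}
    {W : ∀ i, (A.S i).X → ℝ} {y : ℝ → A.State} {t : ℝ} {s : Set ℝ}
    (hW : ∀ i, DifferentiableAt ℝ (W i) ((y t).2.2 i))
    (hy : HasDerivWithinAt y (A.field (y t)) s t) :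
    HasDerivWithinAt (fun u => A.energy p W (y u))
      (∑ l, A.b l * ((Real.sin ((y t).1 l) - Real.sin (p.1 l)) * (A.field (y t)).1 l) +
        ∑ j, A.M j * (((y t).2.1 j - p.2.1 j) * (A.field (y t)).2.1 j) +
        ∑ i, A.κ i * fderiv ℝ (W i) ((y t).2.2 i) ((A.field (y t)).2.2 i)) s t := by
  have h1 := hasDerivWithinAt_pi.1 hy.fst
  have h2 := hasDerivWithinAt_pi.1 hy.snd.fst
  have h3 := hasDerivWithinAt_pi.1 hy.snd.snd
  unfold energy
  refine HasDerivWithinAt.add (HasDerivWithinAt.add ?_ ?_) ?_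
  · refine HasDerivWithinAt.fun_sum fun l _ => HasDerivWithinAt.const_mul _ ?_
    have := (h1 l).cos.neg.sub ((h1 l).const_mul (Real.sin (p.1 l)))
    convert! this using 1
    ring
  · refine HasDerivWithinAt.fun_sum fun j _ => HasDerivWithinAt.const_mul _ ?_
    have := (((h2 j).sub_const (p.2.1 j)).pow 2).div_const 2
    convert! this using 1
    simp; ring
  · refine HasDerivWithinAt.fun_sum fun i _ => HasDerivWithinAt.const_mul _ ?_
    exact (hW i).hasFDerivAt.comp_hasDerivWithinAt t (h3 i)

namespace IsPassiveAt

variable {A : PassiveNet L J Q I} {p : A.State} {W : ∀ i, (A.S i).X → ℝ} {φ : I → ℝ → ℝ}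
  {r : ℝ}

theorem mem_self (h : A.IsPassiveAt p W φ r) : p ∈ Metric.closedBall p r :=
  Metric.mem_closedBall_self h.pos.le

theorem φ_nonneg (h : A.IsPassiveAt p W φ r) (i : I) (v : ℝ) : 0 ≤ φ i v := by
  by_cases hv : v = 0
  · rw [hv, h.φ_zero]
  · exact (h.φ_pos i v hv).le

/-- The power supplied to the attached systems enters their storage inequalities with the sign
opposite to the one in `power_balance`. The supply terms cancel and only damping and φ remain. -/
theorem exists_deriv_le (h : A.IsPassiveAt p W φ r) {y : ℝ → A.State} {t : ℝ}
    (hyt : y t ∈ Metric.closedBall p r) {s : Set ℝ}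
    (hy : HasDerivWithinAt y (A.field (y t)) s t) :
    ∃ v ≤ -A.dissipation p φ (y t),
      HasDerivWithinAt (fun u => A.energy p W (y u)) v s t := by
  refine ⟨_, ?_, A.hasDerivWithinAt_energy (h.diff _ hyt) hy⟩
  rw [A.power_balance h.eq]
  have h1 : ∑ i, A.κ i * fderiv ℝ (W i) ((y t).2.2 i) ((A.field (y t)).2.2 i) ≤
      ∑ i, A.κ i * ((-(y t).2.1 (A.att i) + p.2.1 (A.att i)) *
        ((A.S i).output ((y t).2.2 i) ((y t).2.1 (A.att i)) -
        (A.S i).output (p.2.2 i) (p.2.1 (A.att i))) -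
      φ i (-(y t).2.1 (A.att i) + p.2.1 (A.att i))) :=
    Finset.sum_le_sum fun i _ => mul_le_mul_of_nonneg_left (h.passive _ hyt i) (A.κ_pos i).le
  have h2 : ∑ i, A.κ i * ((-(y t).2.1 (A.att i) + p.2.1 (A.att i)) *
        ((A.S i).output ((y t).2.2 i) ((y t).2.1 (A.att i)) -
        (A.S i).output (p.2.2 i) (p.2.1 (A.att i))) -
      φ i (-(y t).2.1 (A.att i) + p.2.1 (A.att i))) =
      -∑ i, A.κ i * (((y t).2.1 (A.att i) - p.2.1 (A.att i)) *
        ((A.S i).output ((y t).2.2 i) ((y t).2.1 (A.att i)) -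
          (A.S i).output (p.2.2 i) (p.2.1 (A.att i)))) -
      ∑ i, A.κ i * φ i (-(y t).2.1 (A.att i) + p.2.1 (A.att i)) := by
    rw [← Finset.sum_neg_distrib, ← Finset.sum_sub_distrib]
    exact Finset.sum_congr rfl fun i _ => by ring
  unfold dissipation
  linarith

theorem dissipation_terms_nonneg (h : A.IsPassiveAt p W φ r) (y : A.State) :
    0 ≤ ∑ j, A.D j * (y.2.1 j - p.2.1 j) ^ 2 ∧
    0 ≤ ∑ q, A.D' q * (A.w y.1 q - A.w p.1 q) ^ 2 ∧
    0 ≤ ∑ i, A.κ i * φ i (-y.2.1 (A.att i) + p.2.1 (A.att i)) :=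
  ⟨Finset.sum_nonneg fun j _ => mul_nonneg (A.D_nonneg j) (sq_nonneg _),
    Finset.sum_nonneg fun q _ => mul_nonneg (A.D'_pos q).le (sq_nonneg _),
    Finset.sum_nonneg fun i _ => mul_nonneg (A.κ_pos i).le (h.φ_nonneg i _)⟩

/-- All summands are nonnegative, so each vanishes. A damped mass is pinned by its own term, an
undamped one by φ of an attached system, which `active` provides. -/
theorem eq_of_dissipation_nonpos (h : A.IsPassiveAt p W φ r) {y : A.State}
    (hy : A.dissipation p φ y ≤ 0) : y.2.1 = p.2.1 ∧ ∀ q, A.w y.1 q = A.w p.1 q := by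
  obtain ⟨h1, h2, h3⟩ := h.dissipation_terms_nonneg y
  unfold dissipation at hy
  have e1 := (Finset.sum_eq_zero_iff_of_nonneg fun j _ =>
    mul_nonneg (A.D_nonneg j) (sq_nonneg (y.2.1 j - p.2.1 j))).1
    (le_antisymm (by linarith) h1)
  have e2 := (Finset.sum_eq_zero_iff_of_nonneg fun q _ =>
    mul_nonneg (A.D'_pos q).le (sq_nonneg (A.w y.1 q - A.w p.1 q))).1
    (le_antisymm (by linarith) h2)
  have e3 := (Finset.sum_eq_zero_iff_of_nonneg fun i _ =>
    mul_nonneg (A.κ_pos i).le (h.φ_nonneg i (-y.2.1 (A.att i) + p.2.1 (A.att i)))).1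
    (le_antisymm (by linarith) h3)
  refine ⟨funext fun j => ?_, fun q => ?_⟩
  · rcases A.active j with hj | ⟨i, rfl⟩
    · have := (mul_eq_zero.1 (e1 j (Finset.mem_univ j))).resolve_left hj.ne'
      exact sub_eq_zero.1 (pow_eq_zero_iff two_ne_zero |>.1 this)
    · have := (mul_eq_zero.1 (e3 i (Finset.mem_univ i))).resolve_left (A.κ_pos i).ne'
      by_contra hne
      exact (h.φ_pos i _ (fun h0 => hne (by linarith))).ne' this
  · have := (mul_eq_zero.1 (e2 q (Finset.mem_univ q))).resolve_left (A.D'_pos q).ne'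
    exact sub_eq_zero.1 (pow_eq_zero_iff two_ne_zero |>.1 this)

theorem potential_le (h : A.IsPassiveAt p W φ r) {y : A.State}
    (hy : y ∈ Metric.closedBall p r) (l : L) :
    A.b l * (-Real.cos (p.1 l) - Real.sin (p.1 l) * p.1 l) ≤
      A.b l * (-Real.cos (y.1 l) - Real.sin (p.1 l) * y.1 l) := by
  refine mul_le_mul_of_nonneg_left ?_ (A.b_pos l).le
  by_cases hne : y.1 l = p.1 l
  · rw [hne]
  · exact (neg_cos_sub_sin_mul_lt (h.angle p h.mem_self l) (h.angle y hy l) hne).le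

theorem storage_le (h : A.IsPassiveAt p W φ r) {y : A.State}
    (hy : y ∈ Metric.closedBall p r) (i : I) :
    A.κ i * W i (p.2.2 i) ≤ A.κ i * W i (y.2.2 i) := by
  refine mul_le_mul_of_nonneg_left ?_ (A.κ_pos i).le
  by_cases hne : y.2.2 i = p.2.2 i
  · rw [hne]
  · exact (h.lt_of_ne y hy i hne).le

/-- Each summand separately is minimal at p: the line term is -cos minus its slope at the
equilibrium angle, strictly convex in the range allowed, the kinetic term is a square, and the
storage function has a strict minimum. A change in any one coordinate raises the sum. -/
theorem energy_lt (h : A.IsPassiveAt p W φ r) {y : A.State}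
    (hy : y ∈ Metric.closedBall p r) (hne : y ≠ p) : A.energy p W p < A.energy p W y := by
  by_contra! hc
  have h1 := Finset.sum_le_sum fun l (_ : l ∈ Finset.univ) => h.potential_le hy l
  have h3 := Finset.sum_le_sum fun i (_ : i ∈ Finset.univ) => h.storage_le hy i
  have h2 : ∀ j ∈ Finset.univ, A.M j * ((p.2.1 j - p.2.1 j) ^ 2 / 2) ≤
      A.M j * ((y.2.1 j - p.2.1 j) ^ 2 / 2) := fun j _ => by
    have := A.M_pos j
    simp only [sub_self]
    have h0 : 0 ≤ A.M j * ((y.2.1 j - p.2.1 j) ^ 2 / 2) := by positivity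
    simpa using h0
  have h2' := Finset.sum_le_sum h2
  unfold energy at hc
  refine hne (Prod.ext (funext fun l => ?_) (Prod.ext (funext fun j => ?_) (funext fun i => ?_)))
  · by_contra hl
    have := Finset.sum_lt_sum (fun l (_ : l ∈ Finset.univ) => h.potential_le hy l)
      ⟨l, Finset.mem_univ l, mul_lt_mul_of_pos_left
        (neg_cos_sub_sin_mul_lt (h.angle p h.mem_self l) (h.angle y hy l) hl) (A.b_pos l)⟩
    linarith
  · by_contra hj
    have hpos : 0 < A.M j * ((y.2.1 j - p.2.1 j) ^ 2 / 2) := by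
      have h1 := A.M_pos j
      have h2 := pow_pos (abs_pos.2 (sub_ne_zero.2 hj)) 2
      rw [sq_abs] at h2
      positivity
    have := Finset.sum_lt_sum h2 ⟨j, Finset.mem_univ j, by simpa using hpos⟩
    linarith
  · by_contra hi
    have := Finset.sum_lt_sum (fun i (_ : i ∈ Finset.univ) => h.storage_le hy i)
      ⟨i, Finset.mem_univ i, mul_lt_mul_of_pos_left (h.lt_of_ne y hy i hi) (A.κ_pos i)⟩
    linarith

theorem continuousOn_energy (h : A.IsPassiveAt p W φ r) :
    ContinuousOn (A.energy p W) (Metric.closedBall p r) := by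
  unfold energy
  refine ContinuousOn.add (Continuous.continuousOn (by fun_prop))
    (continuousOn_finsetSum _ fun i _ => continuousOn_const.mul fun y hy => ?_)
  have c3 : Continuous (fun y : A.State => y.2.2 i) :=
    (continuous_apply i).comp (continuous_snd.comp continuous_snd)
  exact ((h.diff y hy i).continuousAt.comp (f := fun y : A.State => y.2.2 i)
    c3.continuousAt).continuousWithinAt

theorem isLyapunov (h : A.IsPassiveAt p W φ r) :
    IsLyapunov A.field (A.energy p W) p r := by
  have : ProperSpace A.State := FiniteDimensional.proper_real _
  refine ⟨h.pos, (A.locallyLipschitz_field.locallyLipschitzOn).exists_lipschitzOnWith_of_compact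
    (isCompact_closedBall p r), h.continuousOn_energy, fun x t _ hxt hx => ?_,
    fun y hy hne => h.energy_lt hy hne⟩
  obtain ⟨v, hv, hd⟩ := h.exists_deriv_le hxt hx
  obtain ⟨h1, h2, h3⟩ := h.dissipation_terms_nonneg (x t)
  exact ⟨v, by unfold dissipation at hv; linarith, hd⟩

end IsPassiveAt

/-! ### Motions of constant energy and convergence of the network -/

/-- The equilibria that share velocities, attached states and nodal flows with `p`. -/
def equilibria (A : PassiveNet L J Q I) (p : A.State) : Set A.State :=
  {y | y.2 = p.2 ∧ (∀ q, ∑ l, A.R' l q * (A.b l * (Real.sin (y.1 l) - Real.sin (p.1 l))) = 0) ∧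
    ∀ j, ∑ l, A.R l j * (A.b l * (Real.sin (y.1 l) - Real.sin (p.1 l))) = 0}

/-- Constant energy leaves no dissipation, so velocities are those of p and angle rates vanish as
they do at p. It remains to pin the attached states; the velocity equation then gives the condition
on the flows. -/
theorem IsPassiveAt.mem_equilibria {A : PassiveNet L J Q I} {p : A.State}
    {W : ∀ i, (A.S i).X → ℝ} {φ : I → ℝ → ℝ} {r : ℝ} (h : A.IsPassiveAt p W φ r)
    {z : ℝ → A.State} (hz : IsODESolution A.field z)
    (hin : ∀ t, 0 ≤ t → z t ∈ Metric.closedBall p r)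
    (hconst : ∀ t, 0 ≤ t → A.energy p W (z t) = A.energy p W (z 0)) :
    z 0 ∈ A.equilibria p := by
  have hstat : ∀ t, 0 ≤ t → (z t).2.1 = p.2.1 ∧ ∀ q, A.w (z t).1 q = A.w p.1 q := by
    intro t ht
    refine h.eq_of_dissipation_nonpos ?_
    obtain ⟨v, hv, hd⟩ := h.exists_deriv_le (hin t ht) (hz t ht)
    have h0 : HasDerivWithinAt (fun u => A.energy p W (z u)) 0 (Ici 0) t :=
      (hasDerivWithinAt_const t (Ici 0) (A.energy p W (z 0))).congr (fun s hs => hconst s hs)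
        (hconst t ht)
    have := (uniqueDiffOn_Ici (0 : ℝ) t ht).eq_deriv _ hd h0
    linarith
  have hang : ∀ t, 0 ≤ t → (z t).1 = (z 0).1 := by
    intro t ht
    funext l
    have hder : ∀ s, 0 ≤ s → HasDerivWithinAt (fun u => (z u).1 l) 0 (Ici 0) s := by
      intro s hs
      have h1 := hasDerivWithinAt_pi.1 (hz s hs).fst l
      have h2 := A.field_angle_sub (z s) p l
      rw [h.eq, (hstat s hs).1] at h2
      simp only [(hstat s hs).2, sub_self, mul_zero, Finset.sum_const_zero, add_zero,
        Prod.fst_zero, Pi.zero_apply, sub_zero] at h2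
      rwa [h2] at h1
    exact constant_of_has_deriv_right_zero (a := 0) (b := t)
      (fun s hs => ((hder s hs.1).mono Icc_subset_Ici_self).continuousWithinAt)
      (fun s hs => (hder s hs.1).mono (Ici_subset_Ici.2 hs.1)) t ⟨ht, le_rfl⟩
  -- The attached systems now have constant input, so their asymptotic stability applies. The sum of
  -- the storages is constant in time and tends to its minimum; by strictness each state equals its
  -- equilibrium value from the start.
  have hlim : ∀ i, Tendsto (fun t => (z t).2.2 i) atTop (𝓝 (p.2.2 i)) := by
    intro i
    refine h.attractive (z 0) (hin 0 le_rfl) i _ (fun t ht => ?_) rfl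
    have h1 := hasDerivWithinAt_pi.1 (hz t ht).snd.snd i
    have h2 : (A.field (z t)).2.2 i = -(A.S i).f ((z t).2.2 i) (p.2.1 (A.att i)) := by
      rw [← (hstat t ht).1]; rfl
    rwa [h2] at h1
  have hW : ∑ i, A.κ i * W i ((z 0).2.2 i) = ∑ i, A.κ i * W i (p.2.2 i) := by
    have h1 : Tendsto (fun t => ∑ i, A.κ i * W i ((z t).2.2 i)) atTop
        (𝓝 (∑ i, A.κ i * W i (p.2.2 i))) :=
      tendsto_finsetSum _ fun i _ => Tendsto.const_mul _
        ((h.diff p h.mem_self i).continuousAt.tendsto.comp (hlim i))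
    have h2 : ∀ t, 0 ≤ t →
        ∑ i, A.κ i * W i ((z t).2.2 i) = ∑ i, A.κ i * W i ((z 0).2.2 i) := by
      intro t ht
      have := hconst t ht
      unfold energy at this
      rw [hang t ht, (hstat t ht).1, (hstat 0 le_rfl).1] at this
      linarith
    exact tendsto_nhds_unique (tendsto_const_nhds.congr'
      ((eventually_ge_atTop 0).mono fun t ht => (h2 t ht).symm)) h1
  have hx : ∀ i, (z 0).2.2 i = p.2.2 i := by
    intro i
    by_contra hi
    have := Finset.sum_lt_sum (fun i (_ : i ∈ Finset.univ) => h.storage_le (hin 0 le_rfl) i)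
      ⟨i, Finset.mem_univ i,
        mul_lt_mul_of_pos_left (h.lt_of_ne _ (hin 0 le_rfl) i hi) (A.κ_pos i)⟩
    linarith
  refine ⟨Prod.ext (hstat 0 le_rfl).1 (funext hx), fun q => ?_, fun j => ?_⟩
  · have := A.D'_mul_w_sub (z 0).1 p.1 q
    rw [(hstat 0 le_rfl).2 q, sub_self, mul_zero] at this
    linarith
  · have h1 := hasDerivWithinAt_pi.1 (hz 0 le_rfl).snd.fst j
    have h0 : HasDerivWithinAt (fun u => (z u).2.1 j) 0 (Ici 0) 0 :=
      (hasDerivWithinAt_const 0 (Ici 0) (p.2.1 j)).congr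
        (fun s hs => by rw [(hstat s hs).1]) (by rw [(hstat 0 le_rfl).1])
    have h2 := (uniqueDiffOn_Ici (0 : ℝ) 0 self_mem_Ici).eq_deriv _ h1 h0
    have h3 := A.M_mul_field_sub (z 0) p j
    rw [h.eq, (hstat 0 le_rfl).1, h2] at h3
    simp only [hx, sub_self, mul_zero, ite_self, Finset.sum_const_zero, neg_zero, zero_add,
      Prod.snd_zero, Prod.fst_zero, Pi.zero_apply] at h3
    linarith

/-- The difference s of the line flows at q and q' has zero net flow at every node, hence ⟨s, η⟩ is
a first integral. Equality of its values reads ∑ b (sin q - sin q')(q - q') = 0, where each term is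
positive unless the two angles agree. -/
theorem eq_of_mem_equilibria (A : PassiveNet L J Q I) {p q q' : A.State}
    (hq : q ∈ A.equilibria p) (hq' : q' ∈ A.equilibria p) (hqa : ∀ l, |q.1 l| < Real.pi / 2)
    (hqa' : ∀ l, |q'.1 l| < Real.pi / 2)
    (hℓ : ∀ ℓ : A.State →L[ℝ] ℝ, (∀ y, ℓ (A.field y) = 0) → ℓ q = ℓ q') : q = q' := by
  let s : L → ℝ := fun l => A.b l * (Real.sin (q.1 l) - Real.sin (q'.1 l))
  have hs : ∀ c : L → ℝ, ∑ l, c l * (A.b l * (Real.sin (q.1 l) - Real.sin (p.1 l))) = 0 →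
      ∑ l, c l * (A.b l * (Real.sin (q'.1 l) - Real.sin (p.1 l))) = 0 → ∑ l, c l * s l = 0 := by
    intro c h1 h2
    rw [← sub_zero (0 : ℝ)]
    nth_rw 1 [← h1]
    rw [← h2, ← Finset.sum_sub_distrib]
    exact Finset.sum_congr rfl fun l _ => by simp only [s]; ring
  let ℓ : A.State →L[ℝ] ℝ := ∑ l, s l • (ContinuousLinearMap.proj (R := ℝ) l).comp
    (ContinuousLinearMap.fst ℝ (L → ℝ) ((J → ℝ) × (∀ i, (A.S i).X)))
  have hℓa : ∀ y, ℓ y = ∑ l, s l * y.1 l := fun y => by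
    simp [ℓ]
  have h0 : ∀ y, ℓ (A.field y) = 0 := by
    intro y
    rw [hℓa]
    have e : ∑ l, s l * (A.field y).1 l = ∑ j, y.2.1 j * ∑ l, A.R l j * s l +
        ∑ k, A.w y.1 k * ∑ l, A.R' l k * s l := by
      simp only [field, Finset.mul_sum, mul_add, Finset.sum_add_distrib]
      congr 1
      · rw [Finset.sum_comm]
        exact Finset.sum_congr rfl fun _ _ => Finset.sum_congr rfl fun _ _ => by ring
      · rw [Finset.sum_comm]
        exact Finset.sum_congr rfl fun _ _ => Finset.sum_congr rfl fun _ _ => by ring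
    rw [e]
    have e1 : ∀ j, ∑ l, A.R l j * s l = 0 := fun j => hs _ (hq.2.2 j) (hq'.2.2 j)
    have e2 : ∀ k, ∑ l, A.R' l k * s l = 0 := fun k => hs _ (hq.2.1 k) (hq'.2.1 k)
    simp [e1, e2]
  have h1 := hℓ ℓ h0
  rw [hℓa, hℓa] at h1
  have h2 : ∑ l, s l * (q.1 l - q'.1 l) = 0 := by
    simp only [mul_sub, Finset.sum_sub_distrib]; linarith
  have hpos : ∀ l, q.1 l ≠ q'.1 l → 0 < s l * (q.1 l - q'.1 l) := by
    intro l hl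
    have a1 := abs_lt.1 (hqa l)
    have a2 := abs_lt.1 (hqa' l)
    have m1 : q.1 l ∈ Icc (-(Real.pi / 2)) (Real.pi / 2) := ⟨a1.1.le, a1.2.le⟩
    have m2 : q'.1 l ∈ Icc (-(Real.pi / 2)) (Real.pi / 2) := ⟨a2.1.le, a2.2.le⟩
    rcases lt_or_gt_of_ne hl with h | h
    · have := Real.strictMonoOn_sin m1 m2 h
      exact mul_pos_of_neg_of_neg (mul_neg_of_pos_of_neg (A.b_pos l) (by linarith)) (by linarith)
    · have := Real.strictMonoOn_sin m2 m1 h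
      exact mul_pos (mul_pos (A.b_pos l) (by linarith)) (by linarith)
  refine Prod.ext (funext fun l => ?_) (hq.1.trans hq'.1.symm)
  by_contra hl
  have := Finset.sum_pos' (s := Finset.univ) (f := fun l => s l * (q.1 l - q'.1 l))
    (fun l _ => by
      by_cases h : q.1 l = q'.1 l
      · simp [h]
      · exact (hpos l h).le) ⟨l, Finset.mem_univ l, hpos l hl⟩
  linarith

/-- Every solution that starts near `p` converges to an equilibrium. -/
theorem IsPassiveAt.exists_tendsto {A : PassiveNet L J Q I} {p : A.State}
    {W : ∀ i, (A.S i).X → ℝ} {φ : I → ℝ → ℝ} {r : ℝ} (h : A.IsPassiveAt p W φ r) :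
    ∃ δ > 0, ∀ x, IsODESolution A.field x → dist (x 0) p < δ →
      ∃ q ∈ A.equilibria p, Tendsto x atTop (𝓝 q) :=
  h.isLyapunov.exists_tendsto (fun _ hz hin hc => h.mem_equilibria hz hin hc)
    fun q hq q' hq' hqr hqr' hℓ =>
      A.eq_of_mem_equilibria hq hq' (h.angle q hqr) (h.angle q' hqr') hℓ

end PassiveNet

/-! ### Long-time limits of curves and dissipative linear systems -/

/-- If a curve and its derivative converge, then the derivative converges to zero. -/
theorem eq_zero_of_tendsto_of_hasDerivWithinAt {E : Type*} [NormedAddCommGroup E]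
    [NormedSpace ℝ E] {f f' : ℝ → E} {a b : E}
    (hd : ∀ t, 0 ≤ t → HasDerivWithinAt f (f' t) (Ici 0) t) (hf : Tendsto f atTop (𝓝 a))
    (hf' : Tendsto f' atTop (𝓝 b)) : b = 0 := by
  have key : ∀ ε > 0, ‖b‖ ≤ ε := by
    intro ε hε
    obtain ⟨T, hT⟩ := ((Metric.tendsto_nhds.1 hf' ε hε).and
      (eventually_ge_atTop 0)).exists_forall_of_atTop
    have h1 : ∀ t, T ≤ t → ‖f (t + 1) - f t - b‖ ≤ ε := by
      intro t ht
      have h0 : 0 ≤ t := (hT t ht).2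
      -- The mean value inequality for f s - s • b puts the increment of f over a unit interval
      -- within ε of b, whereas this increment tends to zero.
      have := (convex_Icc t (t + 1)).norm_image_sub_le_of_norm_hasDerivWithin_le
        (f := fun s => f s - s • b) (f' := fun s => f' s - b) (C := ε)
        (fun s hs => (((hd s (h0.trans hs.1)).mono fun u hu => h0.trans hu.1).sub
          (by simpa using ((hasDerivAt_id s).smul_const b).hasDerivWithinAt)))
        (fun s hs => by
          have := (hT s (ht.trans hs.1)).1
          rw [dist_eq_norm] at this
          exact this.le)
        (x := t) (y := t + 1) ⟨le_rfl, by linarith⟩ ⟨by linarith, le_rfl⟩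
      simp only [add_sub_cancel_left, norm_one, mul_one] at this
      convert this using 2
      module
    have h2 : Tendsto (fun t => ‖f (t + 1) - f t - b‖) atTop (𝓝 ‖a - a - b‖) :=
      (((hf.comp (tendsto_atTop_add_const_right _ 1 tendsto_id)).sub hf).sub_const b).norm
    have h3 := le_of_tendsto h2 ((eventually_ge_atTop T).mono h1)
    simpa using h3
  have : ‖b‖ ≤ 0 := le_of_forall_pos_le_add fun ε hε => by simpa using key ε hε
  simpa using this

/-- A nonnegative function that satisfies `Ṡ ≤ -c S + β` with `β → 0` converges to zero. -/
theorem tendsto_zero_of_deriv_le {S S' β : ℝ → ℝ} {c : ℝ} (hc : 0 < c) (hS : ∀ t, 0 ≤ S t)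
    (hd : ∀ t, 0 ≤ t → HasDerivWithinAt S (S' t) (Ici 0) t)
    (hle : ∀ t, 0 ≤ t → S' t ≤ -c * S t + β t) (hβ : Tendsto β atTop (𝓝 0)) :
    Tendsto S atTop (𝓝 0) := by
  rw [Metric.tendsto_nhds]
  intro ε hε
  obtain ⟨T, hT⟩ := ((hβ.eventually_lt_const (show (0 : ℝ) < c * (ε / 2) by positivity)).and
    (eventually_ge_atTop 0)).exists_forall_of_atTop
  have hT0 : 0 ≤ T := (hT T le_rfl).2
  -- After T, β < c ε / 2, so the integrating factor makes (S - ε/2) exp(c t) nonincreasing.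
  have hder : ∀ t, T ≤ t → HasDerivWithinAt (fun s => (S s - ε / 2) * Real.exp (c * s))
      ((S' t + c * (S t - ε / 2)) * Real.exp (c * t)) (Ici T) t := by
    intro t ht
    have h1 := ((hd t (hT0.trans ht)).mono (Ici_subset_Ici.2 hT0)).sub_const (ε / 2)
    have h2 : HasDerivWithinAt (fun s => Real.exp (c * s)) (Real.exp (c * t) * (c * 1))
        (Ici T) t := (((hasDerivAt_id t).const_mul c).exp).hasDerivWithinAt
    convert! h1.mul h2 using 1
    ring
  have hanti : AntitoneOn (fun s => (S s - ε / 2) * Real.exp (c * s)) (Ici T) := by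
    refine antitoneOn_of_hasDerivWithinAt_nonpos (convex_Ici T)
      (f' := fun t => (S' t + c * (S t - ε / 2)) * Real.exp (c * t))
      (fun t ht => (hder t ht).continuousWithinAt)
      (fun t ht => (hder t (interior_subset ht)).mono interior_subset) (fun t ht => ?_)
    have ht' : T ≤ t := interior_subset ht
    refine mul_nonpos_of_nonpos_of_nonneg ?_ (Real.exp_pos _).le
    have h1 := hle t (hT0.trans ht')
    have h2 := (hT t ht').1
    nlinarith
  have hexp : Tendsto (fun t => |(S T - ε / 2) * Real.exp (c * T)| * Real.exp (-(c * t)))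
      atTop (𝓝 0) := by
    have := (Real.tendsto_exp_neg_atTop_nhds_zero.comp
      (tendsto_id.const_mul_atTop hc)).const_mul |(S T - ε / 2) * Real.exp (c * T)|
    simpa using this
  filter_upwards [hexp.eventually_lt_const (half_pos hε), eventually_ge_atTop T] with t h1 h2
  have h3 := hanti self_mem_Ici (mem_Ici.2 h2) h2
  simp only at h3
  have h4 : S t - ε / 2 ≤ (S T - ε / 2) * Real.exp (c * T) * Real.exp (-(c * t)) := by
    have := mul_le_mul_of_nonneg_right h3 (Real.exp_pos (-(c * t))).le
    rwa [mul_assoc (S t - ε / 2), ← Real.exp_add, add_neg_cancel, Real.exp_zero, mul_one] at this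
  have h5 : (S T - ε / 2) * Real.exp (c * T) * Real.exp (-(c * t)) ≤
      |(S T - ε / 2) * Real.exp (c * T)| * Real.exp (-(c * t)) :=
    mul_le_mul_of_nonneg_right (le_abs_self _) (Real.exp_pos _).le
  rw [Real.dist_eq, sub_zero, abs_of_nonneg (hS t)]
  linarith

/-- A negative definite form is bounded away from zero on the unit sphere. -/
theorem exists_sum_mul_le_neg {ι : Type*} [Fintype ι] (G : (ι → ℝ) →ₗ[ℝ] (ι → ℝ))
    (hG : ∀ y, y ≠ 0 → ∑ i, y i * G y i < 0) :
    ∃ m > 0, ∀ y, ∑ i, y i * G y i ≤ -m * ‖y‖ ^ 2 := by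
  rcases (Metric.sphere (0 : ι → ℝ) 1).eq_empty_or_nonempty with h0 | h0
  · refine ⟨1, one_pos, fun y => ?_⟩
    by_cases hy : y = 0
    · simp [hy]
    · have : ‖y‖⁻¹ • y ∈ Metric.sphere (0 : ι → ℝ) 1 := by
        simp [norm_smul, inv_mul_cancel₀ (norm_ne_zero_iff.2 hy)]
      simp [h0] at this
  · have hGc : Continuous G := G.continuous_of_finiteDimensional
    have hcont : Continuous (fun y : ι → ℝ => ∑ i, y i * G y i) :=
      continuous_finsetSum _ fun i _ => (continuous_apply i).mul
        ((continuous_apply i).comp hGc)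
    obtain ⟨u, hu, hmax⟩ := (isCompact_sphere (0 : ι → ℝ) 1).exists_isMaxOn h0 hcont.continuousOn
    have hu0 : u ≠ 0 := by rintro rfl; simp at hu
    refine ⟨-∑ i, u i * G u i, neg_pos.2 (hG u hu0), fun y => ?_⟩
    by_cases hy : y = 0
    · simp [hy]
    · have hn : ‖y‖ ≠ 0 := norm_ne_zero_iff.2 hy
      have hs : ‖y‖⁻¹ • y ∈ Metric.sphere (0 : ι → ℝ) 1 := by
        simp [norm_smul, inv_mul_cancel₀ hn]
      have h1 := hmax hs
      simp only [mem_ofPred_eq, map_smul, Pi.smul_apply, smul_eq_mul] at h1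
      have h2 : ∑ i, ‖y‖⁻¹ * y i * (‖y‖⁻¹ * G y i) = (‖y‖ ^ 2)⁻¹ * ∑ i, y i * G y i := by
        rw [Finset.mul_sum]
        exact Finset.sum_congr rfl fun i _ => by field_simp
      rw [h2, inv_mul_le_iff₀ (by positivity)] at h1
      linarith

/-- A strictly dissipative linear system with a convergent input converges. -/
theorem exists_tendsto_of_dissipative {ι : Type*} [Fintype ι] {V : ι → ℝ} (hV : ∀ i, 0 < V i)
    (G : (ι → ℝ) →ₗ[ℝ] (ι → ℝ)) (hG : ∀ y, y ≠ 0 → ∑ i, y i * G y i < 0)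
    {y b : ℝ → ι → ℝ} {b' : ι → ℝ}
    (hy : ∀ t, 0 ≤ t → ∀ i, HasDerivWithinAt (fun s => V i * y s i) (G (y t) i + b t i) (Ici 0) t)
    (hb : Tendsto b atTop (𝓝 b')) : ∃ y', Tendsto y atTop (𝓝 y') := by
  have hinj : Function.Injective G := by
    refine (injective_iff_map_eq_zero G).2 fun u hu => ?_
    by_contra hne
    have := hG u hne
    simp [hu] at this
  -- The limit is the equilibrium for the limiting input, G y' = -b'; a negative definite map is
  -- injective and hence surjective.
  obtain ⟨y', hy'⟩ := LinearMap.injective_iff_surjective.1 hinj (-b')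
  refine ⟨y', ?_⟩
  obtain ⟨m, hm, hGm⟩ := exists_sum_mul_le_neg G hG
  set n : ℝ := (Fintype.card ι : ℝ) with hn
  -- The summand 1 keeps C positive when ι is empty.
  set C : ℝ := ∑ i, V i / 2 + 1 with hC
  have hC0 : 0 < C := by
    have := Finset.sum_nonneg fun i (_ : i ∈ Finset.univ) => (half_pos (hV i)).le
    linarith
  let S : ℝ → ℝ := fun t => ∑ i, V i * ((y t i - y' i) ^ 2 / 2)
  have hS0 : ∀ t, 0 ≤ S t := fun t => Finset.sum_nonneg fun i _ => by
    have := (hV i).le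
    positivity
  have hSle : ∀ t, S t ≤ C * ‖y t - y'‖ ^ 2 := by
    intro t
    have h1 : ∀ i, (y t i - y' i) ^ 2 ≤ ‖y t - y'‖ ^ 2 := fun i => by
      rw [← sq_abs]
      exact pow_le_pow_left₀ (abs_nonneg _) (norm_le_pi_norm (y t - y') i) 2
    calc S t ≤ ∑ i, V i / 2 * ‖y t - y'‖ ^ 2 := Finset.sum_le_sum fun i _ => by
          have := mul_le_mul_of_nonneg_left (h1 i) (half_pos (hV i)).le
          linarith
      _ = (∑ i, V i / 2) * ‖y t - y'‖ ^ 2 := by rw [Finset.sum_mul]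
      _ ≤ _ := by rw [hC]; nlinarith [sq_nonneg ‖y t - y'‖]
  have hd : ∀ t, 0 ≤ t → HasDerivWithinAt S
      (∑ i, (y t - y') i * (G (y t - y') i + (b t - b') i)) (Ici 0) t := by
    intro t ht
    refine HasDerivWithinAt.fun_sum fun i _ => ?_
    have h1 : HasDerivWithinAt (fun s => y s i) ((G (y t) i + b t i) / V i) (Ici 0) t := by
      have := (hy t ht i).div_const (V i)
      simpa [mul_div_cancel_left₀ _ (hV i).ne'] using this
    have h2 := (((h1.sub_const (y' i)).pow 2).div_const 2).const_mul (V i)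
    convert! h2 using 1
    rw [map_sub, hy']
    have := (hV i).ne'
    simp only [Pi.sub_apply, Pi.neg_apply]
    field_simp
    ring
  -- Half of the decay m ‖y - y'‖² absorbs the input by Young's inequality; the other half dominates
  -- S at rate m / (2 C). The factor n, the number of coordinates, comes from estimating a sum in
  -- the sup norm.
  have hle : ∀ t, 0 ≤ t → ∑ i, (y t - y') i * (G (y t - y') i + (b t - b') i) ≤
      -(m / (2 * C)) * S t + n ^ 2 * ‖b t - b'‖ ^ 2 / (2 * m) := by
    intro t _
    have h1 := hGm (y t - y')
    have h2 : ∑ i, (y t - y') i * (b t - b') i ≤ n * (‖y t - y'‖ * ‖b t - b'‖) := by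
      calc _ ≤ ∑ _i : ι, ‖y t - y'‖ * ‖b t - b'‖ := Finset.sum_le_sum fun i _ => by
            calc _ ≤ |(y t - y') i * (b t - b') i| := le_abs_self _
              _ = |(y t - y') i| * |(b t - b') i| := abs_mul _ _
              _ ≤ _ := mul_le_mul (norm_le_pi_norm (y t - y') i) (norm_le_pi_norm (b t - b') i)
                  (abs_nonneg _) (norm_nonneg _)
        _ = _ := by simp [hn]
    have h3 : n * (‖y t - y'‖ * ‖b t - b'‖) ≤
        m / 2 * ‖y t - y'‖ ^ 2 + n ^ 2 * ‖b t - b'‖ ^ 2 / (2 * m) := by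
      have h4 : m / 2 * ‖y t - y'‖ ^ 2 + n ^ 2 * ‖b t - b'‖ ^ 2 / (2 * m) -
          n * (‖y t - y'‖ * ‖b t - b'‖) =
          (m * ‖y t - y'‖ - n * ‖b t - b'‖) ^ 2 / (2 * m) := by field_simp; ring
      have h5 : 0 ≤ (m * ‖y t - y'‖ - n * ‖b t - b'‖) ^ 2 / (2 * m) := by positivity
      linarith
    have h6 : m / (2 * C) * S t ≤ m / 2 * ‖y t - y'‖ ^ 2 := by
      calc m / (2 * C) * S t ≤ m / (2 * C) * (C * ‖y t - y'‖ ^ 2) :=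
            mul_le_mul_of_nonneg_left (hSle t) (by positivity)
        _ = _ := by field_simp
    simp only [mul_add, Finset.sum_add_distrib]
    linarith
  have hβ : Tendsto (fun t => n ^ 2 * ‖b t - b'‖ ^ 2 / (2 * m)) atTop (𝓝 0) := by
    have := ((((hb.sub_const b').norm).pow 2).const_mul (n ^ 2)).div_const (2 * m)
    simpa using this
  have hS := tendsto_zero_of_deriv_le (by positivity) hS0 hd hle hβ
  refine tendsto_pi_nhds.2 fun i => ?_
  have h1 : Tendsto (fun t => (y t i - y' i) ^ 2) atTop (𝓝 0) := by
    refine squeeze_zero (fun t => sq_nonneg _) (fun t => ?_)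
      (by simpa using hS.const_mul (2 / V i))
    have h2 : V i * ((y t i - y' i) ^ 2 / 2) ≤ S t :=
      Finset.single_le_sum (f := fun i => V i * ((y t i - y' i) ^ 2 / 2))
        (fun j _ => by have := (hV j).le; positivity) (Finset.mem_univ i)
    have h3 := (hV i)
    calc (y t i - y' i) ^ 2 = 2 / V i * (V i * ((y t i - y' i) ^ 2 / 2)) := by field_simp
      _ ≤ _ := mul_le_mul_of_nonneg_left h2 (by positivity)
  have h2 : Tendsto (fun t => |y t i - y' i|) atTop (𝓝 0) := by
    have := h1.sqrt
    simpa [Real.sqrt_sq_eq_abs] using this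
  have h3 := (tendsto_zero_iff_abs_tendsto_zero _).2 h2
  simpa using h3.add_const (y' i)

/-! ### Heat transport by the flow -/

namespace CHPNetwork

variable {N E K : Type*} [Fintype N] [DecidableEq N] [Fintype E] [DecidableEq E]
  [Fintype K] [DecidableEq K]

/-- Total volume. -/
noncomputable def volume (P : CHPNetwork N E K) : ℝ := ∑ e, P.VE e + ∑ k, P.VN k

theorem volume_pos (P : CHPNetwork N E K) : 0 < P.volume := by
  obtain ⟨e, _⟩ := P.heatSrc_nonempty
  have h1 := Finset.sum_pos' (fun e (_ : e ∈ Finset.univ) => (P.VE_pos e).le)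
    ⟨e, Finset.mem_univ e, P.VE_pos e⟩
  have h2 := Finset.sum_nonneg fun k (_ : k ∈ Finset.univ) => (P.VN_pos k).le
  unfold volume
  linarith

/-- Volumes of edges and nodes. -/
def vol (P : CHPNetwork N E K) : E ⊕ K → ℝ := Sum.elim P.VE P.VN

theorem vol_pos (P : CHPNetwork N E K) (i : E ⊕ K) : 0 < P.vol i := by
  rcases i with e | k
  · exact P.VE_pos e
  · exact P.VN_pos k

/-- Heat transport by the flow, as a linear map on edge and node temperatures. -/
noncomputable def transport (P : CHPNetwork N E K) : (E ⊕ K → ℝ) →ₗ[ℝ] (E ⊕ K → ℝ) where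
  toFun T := Sum.elim (fun e => P.q e * (T (Sum.inr (P.src e)) - T (Sum.inl e)))
    (fun k => ∑ e, (if P.tgt e = k then P.q e * T (Sum.inl e) else 0) -
      (∑ e, (if P.tgt e = k then P.q e else 0)) * T (Sum.inr k))
  map_add' T T' := by
    ext (e | k)
    · simp; ring
    · simp only [Pi.add_apply, Sum.elim_inr, mul_add]
      have : ∀ e, (if P.tgt e = k then P.q e * T (Sum.inl e) + P.q e * T' (Sum.inl e) else 0) =
          (if P.tgt e = k then P.q e * T (Sum.inl e) else 0) +
          (if P.tgt e = k then P.q e * T' (Sum.inl e) else 0) := fun e => by split_ifs <;> simp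
      simp only [this, Finset.sum_add_distrib]
      ring
  map_smul' c T := by
    ext (e | k)
    · simp; ring
    · simp only [Pi.smul_apply, Sum.elim_inr, smul_eq_mul, RingHom.id_apply, mul_sub,
        Finset.mul_sum, mul_ite, mul_zero]
      congr 1
      · exact Finset.sum_congr rfl fun e _ => by split_ifs <;> ring
      · ring

theorem sum_tgt (P : CHPNetwork N E K) (f : E → ℝ) (g : K → ℝ) :
    ∑ k, g k * ∑ e, (if P.tgt e = k then f e else 0) = ∑ e, g (P.tgt e) * f e := by
  simp only [Finset.mul_sum]
  rw [Finset.sum_comm]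
  simp

theorem sum_src_eq_sum_tgt (P : CHPNetwork N E K) (g : K → ℝ) :
    ∑ e, g (P.src e) * P.q e = ∑ e, g (P.tgt e) * P.q e := by
  rw [← P.sum_tgt P.q g]
  simp only [P.q_balance, Finset.mul_sum]
  rw [Finset.sum_comm]
  simp

/-- Heat that leaves an edge enters its target node, and by mass balance a node passes on as much
flow as it receives. -/
theorem sum_transport (P : CHPNetwork N E K) (T : E ⊕ K → ℝ) : ∑ i, P.transport T i = 0 := by
  rw [Fintype.sum_sum_type]
  simp only [transport, LinearMap.coe_mk, AddHom.coe_mk, Sum.elim_inl, Sum.elim_inr]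
  have h1 := P.sum_tgt (fun e => P.q e * T (Sum.inl e)) 1
  have h2 := P.sum_tgt P.q (fun k => T (Sum.inr k))
  have h3 := P.sum_src_eq_sum_tgt (fun k => T (Sum.inr k))
  simp only [Pi.one_apply, one_mul] at h1
  simp only [Finset.sum_sub_distrib, mul_sub, h1]
  have h4 : ∑ k, (∑ e, (if P.tgt e = k then P.q e else 0)) * T (Sum.inr k) =
      ∑ e, P.q e * T (Sum.inr (P.src e)) := by
    rw [show ∑ e, P.q e * T (Sum.inr (P.src e)) = ∑ e, T (Sum.inr (P.src e)) * P.q e from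
      Finset.sum_congr rfl fun _ _ => mul_comm _ _, h3, ← h2]
    exact Finset.sum_congr rfl fun _ _ => mul_comm _ _
  rw [h4]
  ring

/-- By mass balance, half of each node's loss ∑ q T² may be charged to its incoming edges and half
to its outgoing ones, which completes the squares along every edge. -/
theorem sum_mul_transport (P : CHPNetwork N E K) (T : E ⊕ K → ℝ) :
    ∑ i, T i * P.transport T i = -∑ e, P.q e *
      (((T (Sum.inr (P.src e)) - T (Sum.inl e)) ^ 2 +
        (T (Sum.inl e) - T (Sum.inr (P.tgt e))) ^ 2) / 2) := by
  rw [Fintype.sum_sum_type]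
  simp only [transport, LinearMap.coe_mk, AddHom.coe_mk, Sum.elim_inl, Sum.elim_inr]
  have h1 := P.sum_tgt (fun e => P.q e * T (Sum.inl e)) (fun k => T (Sum.inr k))
  have h2 := P.sum_tgt P.q (fun k => T (Sum.inr k) ^ 2)
  have h3 := P.sum_src_eq_sum_tgt (fun k => T (Sum.inr k) ^ 2)
  have h4 : ∑ k, T (Sum.inr k) * (∑ e, (if P.tgt e = k then P.q e * T (Sum.inl e) else 0) -
      (∑ e, (if P.tgt e = k then P.q e else 0)) * T (Sum.inr k)) =
      ∑ e, T (Sum.inr (P.tgt e)) * (P.q e * T (Sum.inl e)) -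
      (∑ e, T (Sum.inr (P.src e)) ^ 2 * P.q e + ∑ e, T (Sum.inr (P.tgt e)) ^ 2 * P.q e) / 2 := by
    rw [h3, ← h2, ← h1, add_self_div_two, ← Finset.sum_sub_distrib]
    exact Finset.sum_congr rfl fun _ _ => by ring
  rw [h4, ← Finset.sum_add_distrib, Finset.sum_div, ← Finset.sum_sub_distrib,
    ← Finset.sum_add_distrib, ← Finset.sum_neg_distrib]
  exact Finset.sum_congr rfl fun _ _ => by ring

/-- Heat transport with an additional penalty on the mean temperature. -/
noncomputable def dampedTransport (P : CHPNetwork N E K) :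
    (E ⊕ K → ℝ) →ₗ[ℝ] (E ⊕ K → ℝ) where
  toFun T := fun i => P.transport T i - P.vol i * ∑ j, P.vol j * T j
  map_add' T T' := by
    ext i
    simp only [map_add, Pi.add_apply, mul_add, Finset.sum_add_distrib]
    ring
  map_smul' c T := by
    ext i
    simp only [map_smul, Pi.smul_apply, smul_eq_mul, RingHom.id_apply, mul_left_comm _ c,
      ← Finset.mul_sum]
    ring

/-- The transport form vanishes only when the temperature is the same at an edge and at both its
ends, hence constant on the connected network; a nonzero constant is caught by the penalty. -/
theorem sum_mul_dampedTransport_neg (P : CHPNetwork N E K) (T : E ⊕ K → ℝ) (hT : T ≠ 0) :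
    ∑ i, T i * P.dampedTransport T i < 0 := by
  have h1 : ∑ i, T i * P.dampedTransport T i =
      -∑ e, P.q e * (((T (Sum.inr (P.src e)) - T (Sum.inl e)) ^ 2 +
        (T (Sum.inl e) - T (Sum.inr (P.tgt e))) ^ 2) / 2) - (∑ j, P.vol j * T j) ^ 2 := by
    rw [← P.sum_mul_transport]
    simp only [dampedTransport, LinearMap.coe_mk, AddHom.coe_mk, mul_sub, Finset.sum_sub_distrib]
    congr 1
    rw [sq, Finset.sum_mul]
    exact Finset.sum_congr rfl fun _ _ => by ring
  have hnn : ∀ e ∈ Finset.univ, 0 ≤ P.q e * (((T (Sum.inr (P.src e)) - T (Sum.inl e)) ^ 2 +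
      (T (Sum.inl e) - T (Sum.inr (P.tgt e))) ^ 2) / 2) := fun e _ => by
    have := (P.q_pos e).le
    positivity
  have hsum := Finset.sum_nonneg hnn
  by_contra! hc
  rw [h1] at hc
  have h2 := sq_nonneg (∑ j, P.vol j * T j)
  have h3 := (Finset.sum_eq_zero_iff_of_nonneg hnn).1 (le_antisymm (by linarith) hsum)
  have h4 : ∑ j, P.vol j * T j = 0 := pow_eq_zero_iff two_ne_zero |>.1 (le_antisymm (by linarith) h2)
  have h5 : ∀ e, T (Sum.inr (P.src e)) = T (Sum.inl e) ∧
      T (Sum.inl e) = T (Sum.inr (P.tgt e)) := by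
    intro e
    have h6 := (mul_eq_zero.1 (h3 e (Finset.mem_univ e))).resolve_left (P.q_pos e).ne'
    have h7 := sq_nonneg (T (Sum.inr (P.src e)) - T (Sum.inl e))
    have h8 := sq_nonneg (T (Sum.inl e) - T (Sum.inr (P.tgt e)))
    exact ⟨sub_eq_zero.1 (pow_eq_zero_iff two_ne_zero |>.1 (le_antisymm (by linarith) h7)),
      sub_eq_zero.1 (pow_eq_zero_iff two_ne_zero |>.1 (le_antisymm (by linarith) h8))⟩
  have h6 : ∀ k l, T (Sum.inr k) = T (Sum.inr l) := by
    intro k l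
    have := P.heat_connected k l
    induction this with
    | rel a b hab =>
      obtain ⟨e, rfl, rfl⟩ := hab
      exact (h5 e).1.trans (h5 e).2
    | refl a => rfl
    | symm a b _ ih => exact ih.symm
    | trans a b c _ _ ih1 ih2 => exact ih1.trans ih2
  obtain ⟨e₀, _⟩ := P.heatSrc_nonempty
  have h7 : ∀ i, T i = T (Sum.inl e₀) := by
    rintro (e | k)
    · rw [← (h5 e).1, ← (h5 e₀).1]; exact h6 _ _
    · rw [← (h5 e₀).1]; exact h6 _ _
  have h8 : ∑ j, P.vol j * T j = (∑ j, P.vol j) * T (Sum.inl e₀) := by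
    rw [Finset.sum_mul]
    exact Finset.sum_congr rfl fun j _ => by rw [h7 j]
  have h9 : 0 < ∑ j, P.vol j := Finset.sum_pos (fun j _ => P.vol_pos j) ⟨Sum.inl e₀, by simp⟩
  rw [h8] at h4
  have h10 := (mul_eq_zero.1 h4).resolve_left h9.ne'
  exact hT (funext fun i => by rw [h7 i, h10]; rfl)

end CHPNetwork

/-! ### Reduction to the mean temperature -/

namespace CHPNetwork

variable {N E K : Type*} [Fintype N] [DecidableEq N] [Fintype E] [DecidableEq E]
  [Fintype K] [DecidableEq K]

/-- Energy stored in the heating network. -/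
theorem sum_vol_mul (P : CHPNetwork N E K) (T : E ⊕ K → ℝ) :
    ∑ i, P.vol i * T i = ∑ e, P.VE e * T (Sum.inl e) + ∑ k, P.VN k * T (Sum.inr k) :=
  Fintype.sum_sum_type _

/-- `T` solves the temperature dynamics with heat injections `h` at the edges. -/
def IsThermalSolution (P : CHPNetwork N E K) (h : ℝ → E → ℝ) (T : ℝ → E ⊕ K → ℝ) : Prop :=
  ∀ t, 0 ≤ t → ∀ i, HasDerivWithinAt (fun s => P.vol i * T s i)
    (P.transport (T t) i + Sum.elim (h t) 0 i) (Ici 0) t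

theorem IsThermalSolution.hasDerivWithinAt_sum {P : CHPNetwork N E K} {h : ℝ → E → ℝ}
    {T : ℝ → E ⊕ K → ℝ} (hT : P.IsThermalSolution h T) {t : ℝ} (ht : 0 ≤ t) :
    HasDerivWithinAt (fun s => ∑ i, P.vol i * T s i) (∑ e, h t e) (Ici 0) t := by
  have h1 := HasDerivWithinAt.fun_sum (u := Finset.univ) fun i _ => hT t ht i
  have h2 : ∑ i, (P.transport (T t) i + Sum.elim (h t) 0 i) = ∑ e, h t e := by
    rw [Finset.sum_add_distrib, P.sum_transport, Fintype.sum_sum_type]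
    simp
  rwa [h2] at h1

/-- Transport alone does not damp constants. Since the stored heat converges, a multiple of it can
be subtracted from the linear part, making this strictly dissipative, and returned as part of the
convergent input. -/
theorem IsThermalSolution.exists_tendsto {P : CHPNetwork N E K} {h : ℝ → E → ℝ}
    {T : ℝ → E ⊕ K → ℝ} (hT : P.IsThermalSolution h T) {h' : E → ℝ} {c : ℝ}
    (hh : Tendsto h atTop (𝓝 h'))
    (hc : Tendsto (fun t => ∑ i, P.vol i * T t i) atTop (𝓝 c)) :
    ∃ T', Tendsto T atTop (𝓝 T') := by
  refine exists_tendsto_of_dissipative P.vol_pos P.dampedTransport P.sum_mul_dampedTransport_neg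
    (b := fun t i => P.vol i * ∑ j, P.vol j * T t j + Sum.elim (h t) 0 i)
    (b' := fun i => P.vol i * c + Sum.elim h' 0 i) (fun t ht i => ?_) ?_
  · convert! hT t ht i using 1
    simp only [dampedTransport, LinearMap.coe_mk, AddHom.coe_mk]
    ring
  · refine tendsto_pi_nhds.2 fun i => (hc.const_mul _).add ?_
    rcases i with e | k
    · exact tendsto_pi_nhds.1 hh e
    · exact tendsto_const_nhds

theorem exists_isThermalSolution (P : CHPNetwork N E K) {h : ℝ → E → ℝ}
    (hh : ContinuousOn h (Ici 0)) (T₀ : E ⊕ K → ℝ) :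
    ∃ T, T 0 = T₀ ∧ P.IsThermalSolution h T := by
  let G : (E ⊕ K → ℝ) →ₗ[ℝ] (E ⊕ K → ℝ) :=
    { toFun := fun T i => P.transport T i / P.vol i
      map_add' := fun T T' => by ext i; simp [add_div]
      map_smul' := fun c T => by ext i; simp [mul_div_assoc] }
  have hc : ContinuousOn (fun t (i : E ⊕ K) => Sum.elim (h t) 0 i / P.vol i) (Ici 0) :=
    continuousOn_pi.2 fun i => by
      rcases i with e | k
      · exact (continuousOn_pi.1 hh e).div_const _
      · exact (continuousOn_const : ContinuousOn
          (fun _ : ℝ => (0 : ℝ) / P.vol (Sum.inr k)) (Ici 0))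
  obtain ⟨T, hT0, hT⟩ := exists_global_solution
    (f := fun t T => G T + fun i => Sum.elim (h t) 0 i / P.vol i)
    (K := ‖LinearMap.toContinuousLinearMap G‖₊)
    (fun t _ => LipschitzWith.of_dist_le_mul fun y z => by
      have := (LinearMap.toContinuousLinearMap G).lipschitz.dist_le_mul y z
      simpa using this)
    (fun y => continuousOn_const.add hc) T₀
  refine ⟨T, hT0, fun t ht i => ?_⟩
  have h1 := (hasDerivWithinAt_pi.1 (hT t ht) i).const_mul (P.vol i)
  have h2 : P.vol i * (G (T t) + fun i => Sum.elim (h t) 0 i / P.vol i) i =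
      P.transport (T t) i + Sum.elim (h t) 0 i := by
    have := (P.vol_pos i).ne'
    show P.vol i * (P.transport (T t) i / P.vol i + Sum.elim (h t) 0 i / P.vol i) = _
    field_simp
  rwa [h2] at h1

/-- Total heat injected at an edge, apart from the transport by the flow. -/
noncomputable def heatIn (P : CHPNetwork N E K) (mode : HeatPumpMode N) (x : P.State) (e : E) :
    ℝ :=
  P.hG x e + P.hP mode x e - P.hL e

/-- Replace the temperatures of a state. -/
def withTemp (P : CHPNetwork N E K) (x : P.State) (T : E ⊕ K → ℝ) : P.State :=
  (x.η, x.ω, x.xe, fun e => T (Sum.inl e), fun k => T (Sum.inr k), x.xh)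

/-- Replace the temperatures of a state by their average. -/
noncomputable def uniformTemp (P : CHPNetwork N E K) (x : P.State) : P.State :=
  P.withTemp x fun _ => P.Tbar x

/-- The temperatures of a state. -/
def temp (P : CHPNetwork N E K) (x : P.State) : E ⊕ K → ℝ := Sum.elim x.TE x.TN

variable {P : CHPNetwork N E K} {mode : HeatPumpMode N}

theorem volume_mul_Tbar (x : P.State) : P.volume * P.Tbar x = ∑ i, P.vol i * P.temp x i := by
  rw [sum_vol_mul]
  exact mul_div_cancel₀ _ P.volume_pos.ne'

theorem sum_vol : ∑ i, P.vol i = P.volume := Fintype.sum_sum_type _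

theorem Tbar_of_const {x : P.State} {c : ℝ} (h : ∀ i, P.temp x i = c) : P.Tbar x = c := by
  have h1 := volume_mul_Tbar x
  simp only [h, ← Finset.sum_mul, sum_vol] at h1
  exact mul_left_cancel₀ P.volume_pos.ne' h1

theorem temp_withTemp (x : P.State) (T : E ⊕ K → ℝ) : P.temp (P.withTemp x T) = T := by
  ext (e | k) <;> rfl

theorem Tbar_uniformTemp (x : P.State) : P.Tbar (P.uniformTemp x) = P.Tbar x :=
  Tbar_of_const fun i => by rw [uniformTemp, temp_withTemp]

/-- Sources see temperatures only through the average and pumps not at all as functions of the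
remaining variables, so individual temperatures may be exchanged without affecting the heat inputs.
-/
theorem heatIn_withTemp {x : P.State} {T : E ⊕ K → ℝ} (h : P.Tbar (P.withTemp x T) = P.Tbar x)
    (e : E) : P.heatIn mode (P.withTemp x T) e = P.heatIn mode x e := by
  have : P.hG (P.withTemp x T) e = P.hG x e := by
    unfold hG
    rw [h]
    rfl
  unfold heatIn
  rw [this]
  rfl

theorem isConsistent_withTemp {x : P.State} {T : E ⊕ K → ℝ}
    (h : P.Tbar (P.withTemp x T) = P.Tbar x) (hx : P.IsConsistent mode x) :
    P.IsConsistent mode (P.withTemp x T) := by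
  cases mode with
  | freqDependent a => exact hx
  | converterLinked m => exact ⟨hx.1, fun j hj => by rw [h]; exact hx.2 j hj⟩

/-- `x` solves the network model, except that only the average temperature is tracked. -/
structure IsReducedSolution (P : CHPNetwork N E K) (mode : HeatPumpMode N) (x : ℝ → P.State) :
    Prop where
  consistent : ∀ t : ℝ, 0 ≤ t → P.IsConsistent mode (x t)
  angle : ∀ t : ℝ, 0 ≤ t → ∀ l : P.lines,
    HasDerivWithinAt (fun s => (x s).η l) ((x t).ω l.1.1 - (x t).ω l.1.2) (Ici 0) t
  swing : ∀ t : ℝ, 0 ≤ t → ∀ j ∈ P.gen,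
    HasDerivWithinAt (fun s => P.M j * (x s).ω j) (P.swingRHS mode (x t) j) (Ici 0) t
  generator : ∀ t : ℝ, 0 ≤ t → ∀ j : P.gen,
    HasDerivWithinAt (fun s => (x s).xe j) (-(P.genSys j).f ((x t).xe j) ((x t).ω j)) (Ici 0) t
  mean : ∀ t : ℝ, 0 ≤ t →
    HasDerivWithinAt (fun s => P.volume * P.Tbar (x s)) (∑ e, P.heatIn mode (x t) e) (Ici 0) t
  heatSource : ∀ t : ℝ, 0 ≤ t → ∀ e : P.heatSrc,
    HasDerivWithinAt (fun s => (x s).xh e) (-(P.heatSys e).f ((x t).xh e) (P.Tbar (x t))) (Ici 0) t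

theorem edgeRHS_eq (x : P.State) (e : E) :
    P.edgeRHS mode x e = P.transport (P.temp x) (Sum.inl e) + P.heatIn mode x e := by
  simp [edgeRHS, transport, temp, heatIn]
  ring

theorem nodeRHS_eq (x : P.State) (k : K) :
    P.nodeRHS x k = P.transport (P.temp x) (Sum.inr k) := rfl

theorem IsSolution.isThermalSolution {x : ℝ → P.State} (hx : P.IsSolution mode x) :
    P.IsThermalSolution (fun t => P.heatIn mode (x t)) (fun t => P.temp (x t)) := by
  rintro t ht (e | k)
  · have := hx.edge t ht e
    rwa [edgeRHS_eq] at this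
  · have := hx.node t ht k
    rw [nodeRHS_eq] at this
    simpa using! this

theorem IsSolution.isReducedSolution {x : ℝ → P.State} (hx : P.IsSolution mode x) :
    P.IsReducedSolution mode x :=
  ⟨hx.consistent, hx.angle, hx.swing, hx.generator, fun t ht => by
    simpa only [volume_mul_Tbar] using hx.isThermalSolution.hasDerivWithinAt_sum ht,
    hx.heatSource⟩

/-- The stored heat of T and the tracked total have the same derivative and the same initial value,
so the average of T is the tracked one and all inputs are unchanged. -/
theorem IsReducedSolution.isSolution_withTemp {x : ℝ → P.State}
    (hx : P.IsReducedSolution mode x) {T : ℝ → E ⊕ K → ℝ}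
    (hT : P.IsThermalSolution (fun t => P.heatIn mode (x t)) T)
    (h0 : P.Tbar (P.withTemp (x 0) (T 0)) = P.Tbar (x 0)) :
    P.IsSolution mode (fun t => P.withTemp (x t) (T t)) := by
  have hbar : ∀ t, 0 ≤ t → P.Tbar (P.withTemp (x t) (T t)) = P.Tbar (x t) := by
    intro t ht
    have hd : ∀ s, 0 ≤ s → HasDerivWithinAt
        (fun s => ∑ i, P.vol i * T s i - P.volume * P.Tbar (x s)) 0 (Ici 0) s := fun s hs => by
      have := (hT.hasDerivWithinAt_sum hs).sub (hx.mean s hs)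
      rw [sub_self] at this
      exact this
    have h1 := constant_of_has_deriv_right_zero (a := 0) (b := t)
      (fun s hs => ((hd s hs.1).mono Icc_subset_Ici_self).continuousWithinAt)
      (fun s hs => (hd s hs.1).mono (Ici_subset_Ici.2 hs.1)) t ⟨ht, le_rfl⟩
    have h2 : P.volume * P.Tbar (x 0) = ∑ i, P.vol i * T 0 i := by
      rw [← h0, volume_mul_Tbar, temp_withTemp]
    rw [h2, sub_self] at h1
    refine mul_left_cancel₀ P.volume_pos.ne' ?_
    rw [volume_mul_Tbar, temp_withTemp]
    linarith
  refine ⟨fun t ht => isConsistent_withTemp (hbar t ht) (hx.consistent t ht), hx.angle, hx.swing,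
    hx.generator, fun t ht e => ?_, fun t ht k => ?_, fun t ht e => ?_⟩
  · rw [edgeRHS_eq, temp_withTemp, heatIn_withTemp (hbar t ht)]
    exact hT t ht (Sum.inl e)
  · rw [nodeRHS_eq, temp_withTemp]
    simpa using! hT t ht (Sum.inr k)
  · rw [hbar t ht]
    exact hx.heatSource t ht e

theorem continuous_η (l : P.lines) : Continuous fun x : P.State => x.η l :=
  (continuous_apply l).comp continuous_fst

theorem continuous_ω (j : N) : Continuous fun x : P.State => x.ω j :=
  (continuous_apply j).comp (continuous_fst.comp continuous_snd)

theorem continuous_xe (j : P.gen) : Continuous fun x : P.State => x.xe j :=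
  (continuous_apply j).comp (continuous_fst.comp (continuous_snd.comp continuous_snd))

theorem continuous_TE (e : E) : Continuous fun x : P.State => x.TE e :=
  (continuous_apply e).comp (continuous_fst.comp
    (continuous_snd.comp (continuous_snd.comp continuous_snd)))

theorem continuous_TN (k : K) : Continuous fun x : P.State => x.TN k :=
  (continuous_apply k).comp (continuous_fst.comp (continuous_snd.comp
    (continuous_snd.comp (continuous_snd.comp continuous_snd))))

theorem continuous_xh (e : P.heatSrc) : Continuous fun x : P.State => x.xh e :=
  (continuous_apply e).comp (continuous_snd.comp (continuous_snd.comp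
    (continuous_snd.comp (continuous_snd.comp continuous_snd))))

theorem continuous_Tbar : Continuous fun x : P.State => P.Tbar x :=
  ((continuous_finsetSum _ fun e _ => continuous_const.mul (continuous_TE e)).add
    (continuous_finsetSum _ fun k _ => continuous_const.mul (continuous_TN k))).div_const _

theorem continuous_netInflow (j : N) : Continuous fun x : P.State => P.netInflow x j := by
  have h : ∀ l, Continuous fun x : P.State => P.lineFlow x l := fun l =>
    continuous_const.mul (Real.continuous_sin.comp (continuous_η l))
  refine (continuous_finsetSum _ fun l _ => ?_).sub (continuous_finsetSum _ fun l _ => ?_)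
  · split_ifs
    exacts [h l, continuous_const]
  · split_ifs
    exacts [h l, continuous_const]

theorem _root_.IOSystem.continuous_output (S : IOSystem) {α : Type*} [TopologicalSpace α]
    {x : α → S.X} {u : α → ℝ} (hx : Continuous x) (hu : Continuous u) :
    Continuous fun a => S.output (x a) (u a) :=
  (S.g_lip.continuous.comp (hx.prodMk hu)).neg

theorem _root_.IOSystem.continuous_f (S : IOSystem) {α : Type*} [TopologicalSpace α]
    {x : α → S.X} {u : α → ℝ} (hx : Continuous x) (hu : Continuous u) :
    Continuous fun a => S.f (x a) (u a) :=
  S.f_lip.continuous.comp (hx.prodMk hu)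

theorem continuous_pG (j : N) : Continuous fun x : P.State => P.pG x j := by
  unfold pG
  split_ifs with h
  · exact (P.genSys ⟨j, h⟩).continuous_output (continuous_xe ⟨j, h⟩) (continuous_ω j)
  · exact continuous_const

theorem continuous_pP (j : N) : Continuous fun x : P.State => P.pP mode x j := by
  unfold pP
  split_ifs with h
  · cases mode with
    | freqDependent a => exact continuous_const.mul (continuous_ω j)
    | converterLinked m => exact continuous_netInflow j
  · exact continuous_const

theorem continuous_swingRHS (j : N) : Continuous fun x : P.State => P.swingRHS mode x j :=
  (((continuous_const.sub (continuous_pP j)).add (continuous_pG j)).sub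
    (continuous_const.mul (continuous_ω j))).add (continuous_netInflow j)

theorem continuous_heatIn (e : E) : Continuous fun x : P.State => P.heatIn mode x e := by
  unfold heatIn hG hP
  refine (Continuous.add ?_ (continuous_finsetSum _ fun j _ => ?_)).sub continuous_const
  · split_ifs with h
    · exact (P.heatSys ⟨e, h⟩).continuous_output (continuous_xh ⟨e, h⟩) continuous_Tbar
    · exact continuous_const
  · split_ifs with h
    · exact continuous_const.mul (continuous_pP j)
    · exact continuous_const

theorem continuous_temp : Continuous fun x : P.State => P.temp x := by
  refine continuous_pi fun i => ?_
  rcases i with e | k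
  · exact continuous_TE e
  · exact continuous_TN k

theorem isClosed_isConsistent : IsClosed {x : P.State | P.IsConsistent mode x} := by
  cases mode with
  | freqDependent a =>
    have : {x : P.State | P.IsConsistent (.freqDependent a) x} =
        ⋂ j, ⋂ (_ : j ∉ P.gen), {x | P.swingRHS (.freqDependent a) x j = 0} := by
      ext x; simp [IsConsistent]
    rw [this]
    exact isClosed_iInter fun j => isClosed_iInter fun _ =>
      isClosed_eq (continuous_swingRHS j) continuous_const
  | converterLinked m =>
    have : {x : P.State | P.IsConsistent (.converterLinked m) x} =
        (⋂ j, ⋂ (_ : j ∉ P.gen), ⋂ (_ : j ∉ P.pump),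
          {x | P.swingRHS (.converterLinked m) x j = 0}) ∩
        ⋂ j, ⋂ (_ : j ∈ P.pump), {x | x.ω j = m j * P.Tbar x} := by
      ext x; simp [IsConsistent]
    rw [this]
    exact (isClosed_iInter fun j => isClosed_iInter fun _ => isClosed_iInter fun _ =>
      isClosed_eq (continuous_swingRHS j) continuous_const).inter
      (isClosed_iInter fun j => isClosed_iInter fun _ =>
        isClosed_eq (continuous_ω j) (continuous_const.mul continuous_Tbar))

/-- The limit of a convergent solution is an equilibrium. -/
theorem IsSolution.isEquilibrium_of_tendsto {x : ℝ → P.State} (hx : P.IsSolution mode x)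
    {y : P.State} (hy : Tendsto x atTop (𝓝 y)) : P.IsEquilibrium mode y := by
  -- Each differential equation has the form d/dt u(x) = v(x) with u, v continuous. Along a
  -- convergent solution both sides converge, so v vanishes at the limit.
  have key : ∀ {F : Type} [NormedAddCommGroup F] [NormedSpace ℝ F] {u v : P.State → F},
      Continuous u → Continuous v →
      (∀ t, 0 ≤ t → HasDerivWithinAt (fun s => u (x s)) (v (x t)) (Ici 0) t) → v y = 0 :=
    fun hu hv hd => eq_zero_of_tendsto_of_hasDerivWithinAt hd
      ((hu.tendsto y).comp hy) ((hv.tendsto y).comp hy)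
  refine ⟨?_, fun l => ?_, fun j hj => ?_, fun j => ?_, fun e => ?_, fun k => ?_, fun e => ?_⟩
  · exact isClosed_isConsistent.mem_of_tendsto hy
      ((eventually_ge_atTop 0).mono fun t ht => hx.consistent t ht)
  · exact key (continuous_η l) ((continuous_ω l.1.1).sub (continuous_ω l.1.2))
      fun t ht => hx.angle t ht l
  · exact key (u := fun x => P.M j * x.ω j) (continuous_const.mul (continuous_ω j))
      (continuous_swingRHS j)
      fun t ht => hx.swing t ht j hj
  · exact neg_eq_zero.1 (key (v := fun x => -(P.genSys j).f (x.xe j) (x.ω j)) (continuous_xe j)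
      ((P.genSys j).continuous_f (continuous_xe j) (continuous_ω j.1)).neg
      fun t ht => hx.generator t ht j)
  · refine key (u := fun x => P.VE e * x.TE e) (v := fun x => P.edgeRHS mode x e)
      (continuous_const.mul (continuous_TE e)) ?_ fun t ht => hx.edge t ht e
    simp only [edgeRHS_eq]
    exact ((continuous_apply _).comp
      (P.transport.continuous_of_finiteDimensional.comp continuous_temp)).add (continuous_heatIn e)
  · refine key (u := fun x => P.VN k * x.TN k) (v := fun x => P.nodeRHS x k)
      (continuous_const.mul (continuous_TN k)) ?_ fun t ht => hx.node t ht k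
    simp only [nodeRHS_eq]
    exact (continuous_apply _).comp
      (P.transport.continuous_of_finiteDimensional.comp continuous_temp)
  · exact neg_eq_zero.1 (key (v := fun x => -(P.heatSys e).f (x.xh e) (P.Tbar x))
      (continuous_xh e) ((P.heatSys e).continuous_f (continuous_xh e) continuous_Tbar).neg
      fun t ht => hx.heatSource t ht e)

/-- Reduction of the stability theorem to an ordinary differential equation `ẏ = F y` for the
variables other than the individual temperatures. -/
theorem stable_of_reduction {Y : Type*} [NormedAddCommGroup Y] [NormedSpace ℝ Y] {F : Y → Y}
    {proj : P.State → Y} {embed : Y → P.State} (hproj : Continuous proj)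
    (hembed : Continuous embed)
    (hpe : ∀ x, P.IsConsistent mode x → embed (proj x) = P.uniformTemp x)
    (hsol : ∀ x, P.IsReducedSolution mode x → IsODESolution F (fun t => proj (x t)))
    (hsol' : ∀ y, IsODESolution F y → P.IsReducedSolution mode (fun t => embed (y t)))
    (xs : P.State)
    (hex : ∃ δ > 0, ∀ y₀, dist y₀ (proj xs) < δ → ∃ y, y 0 = y₀ ∧ IsODESolution F y)
    (hconv : ∃ δ > 0, ∀ y, IsODESolution F y → dist (y 0) (proj xs) < δ →
      ∃ q, Tendsto y atTop (𝓝 q)) :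
    ∃ U : Set P.State, IsOpen U ∧ xs ∈ U ∧
      (∀ x₀ ∈ U, P.IsConsistent mode x₀ →
        ∃ x : ℝ → P.State, P.IsSolution mode x ∧ x 0 = x₀) ∧
      ∀ x : ℝ → P.State, P.IsSolution mode x → x 0 ∈ U →
        ∃ y : P.State, P.IsEquilibrium mode y ∧ Tendsto x atTop (𝓝 y) := by
  obtain ⟨δ₁, hδ₁, hex⟩ := hex
  obtain ⟨δ₂, hδ₂, hconv⟩ := hconv
  -- The neighbourhood constrains only the reduced variables.
  refine ⟨proj ⁻¹' Metric.ball (proj xs) (min δ₁ δ₂), Metric.isOpen_ball.preimage hproj,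
    Metric.mem_ball_self (lt_min hδ₁ hδ₂), fun x₀ hx₀ hc => ?_, fun x hx hx0 => ?_⟩
  · have hx₀' : dist (proj x₀) (proj xs) < min δ₁ δ₂ := hx₀
    obtain ⟨y, hy0, hy⟩ := hex (proj x₀) (hx₀'.trans_le (min_le_left _ _))
    have hred := hsol' y hy
    have he0 : embed (y 0) = P.uniformTemp x₀ := by rw [hy0, hpe x₀ hc]
    have hcont : ContinuousOn (fun t => P.heatIn mode (embed (y t))) (Ici 0) :=
      continuousOn_pi.2 fun e =>
        ((continuous_heatIn e).comp hembed).comp_continuousOn hy.continuousOn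
    -- The embedded solution has uniform temperatures. The actual ones are found afterwards from its
    -- heat inputs and the initial temperatures of x₀.
    obtain ⟨T, hT0, hT⟩ := P.exists_isThermalSolution hcont (P.temp x₀)
    have hw : P.withTemp (embed (y 0)) (T 0) = x₀ := by rw [he0, hT0]; rfl
    refine ⟨_, hred.isSolution_withTemp hT ?_, hw⟩
    rw [hw, he0, Tbar_uniformTemp]
  · have hx0' : dist (proj (x 0)) (proj xs) < min δ₁ δ₂ := hx0
    have hred := hx.isReducedSolution
    obtain ⟨q, hq⟩ := hconv _ (hsol x hred) (hx0'.trans_le (min_le_right _ _))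
    -- Everything but the individual temperatures converges. This includes heat inputs and stored
    -- heat, which suffices for the temperatures to converge as well.
    have hu : Tendsto (fun t => P.uniformTemp (x t)) atTop (𝓝 (embed q)) :=
      ((hembed.tendsto q).comp hq).congr'
        ((eventually_ge_atTop 0).mono fun t ht => hpe _ (hx.consistent t ht))
    have hbar : Tendsto (fun t => P.Tbar (x t)) atTop (𝓝 (P.Tbar (embed q))) :=
      ((continuous_Tbar.tendsto _).comp hu).congr fun t => Tbar_uniformTemp _
    have hheat : Tendsto (fun t => P.heatIn mode (x t)) atTop
        (𝓝 (P.heatIn mode (embed q))) :=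
      tendsto_pi_nhds.2 fun e => (((continuous_heatIn e).tendsto _).comp hu).congr fun t =>
        heatIn_withTemp (Tbar_uniformTemp _) e
    obtain ⟨T', hT'⟩ := hx.isThermalSolution.exists_tendsto hheat
      ((hbar.const_mul P.volume).congr fun t => volume_mul_Tbar _)
    have hlim : Tendsto x atTop (𝓝 (P.withTemp (embed q) T')) := by
      have h1 : Continuous fun z : P.State × (E ⊕ K → ℝ) => P.withTemp z.1 z.2 := by
        unfold withTemp State.η State.ω State.xe State.xh
        fun_prop
      have h2 := (h1.tendsto (embed q, T')).comp (hu.prodMk_nhds hT')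
      exact h2.congr fun t => rfl
    exact ⟨_, hx.isEquilibrium_of_tendsto hlim, hlim⟩

/-- Transport only redistributes heat, so at rest nothing can balance a net injection. -/
theorem IsEquilibrium.sum_heatIn_eq_zero {mode : HeatPumpMode N} {x : P.State}
    (hx : P.IsEquilibrium mode x) : ∑ e, P.heatIn mode x e = 0 := by
  have h1 := P.sum_transport (P.temp x)
  rw [Fintype.sum_sum_type] at h1
  have h2 : ∀ e, P.transport (P.temp x) (Sum.inl e) + P.heatIn mode x e = 0 :=
    fun e => by rw [← edgeRHS_eq]; exact hx.edge e
  have h3 : ∀ k, P.transport (P.temp x) (Sum.inr k) = 0 := fun k => by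
    rw [← nodeRHS_eq]; exact hx.node k
  have h4 := Finset.sum_congr (rfl : (Finset.univ : Finset E) = Finset.univ) fun e _ => h2 e
  rw [Finset.sum_add_distrib, Finset.sum_const_zero] at h4
  simp only [h3, Finset.sum_const_zero] at h1
  linarith

end CHPNetwork

/-! ### Mode 2: the mean temperature as a mass of the network -/

theorem HasDerivWithinAt.of_const_mul {f : ℝ → ℝ} {c v t : ℝ} {s : Set ℝ} (hc : c ≠ 0)
    (h : HasDerivWithinAt (fun u => c * f u) (c * v) s t) : HasDerivWithinAt f v s t := by
  have := h.const_mul c⁻¹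
  simpa [inv_mul_cancel_left₀ hc] using this

theorem Finset.sum_subtype_eq_sum_ite {ι : Type*} [Fintype ι] (p : ι → Prop) [DecidablePred p]
    (f : ι → ℝ) : ∑ i : {i // p i}, f i = ∑ i, if p i then f i else 0 := by
  rw [← Finset.sum_filter, ← Finset.sum_subtype (Finset.univ.filter p) (by simp) f]

theorem Finset.sum_coe_eq_sum_ite {ι : Type*} [Fintype ι] [DecidableEq ι] (s : Finset ι)
    (f : ι → ℝ) : ∑ i : s, f i = ∑ i, if i ∈ s then f i else 0 := by
  rw [Finset.sum_coe_sort s f, Finset.sum_ite_mem, Finset.univ_inter]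

namespace CHPNetwork

variable {N E K : Type*} [Fintype N] [DecidableEq N] [Fintype E] [DecidableEq E]
  [Fintype K] [DecidableEq K]

/-- The incidence matrix of the electric network. -/
def inc (P : CHPNetwork N E K) (l : P.lines) (j : N) : ℝ :=
  (if l.1.1 = j then 1 else 0) - (if l.1.2 = j then 1 else 0)

variable {P : CHPNetwork N E K}

theorem netInflow_eq (x : P.State) (j : N) :
    P.netInflow x j = -∑ l, P.inc l j * (P.B l.1 * Real.sin (x.η l)) := by
  simp only [netInflow, inc, sub_mul, Finset.sum_sub_distrib, ite_mul, one_mul, zero_mul,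
    lineFlow]
  ring

theorem sum_inc_mul (l : P.lines) (f : N → ℝ) :
    ∑ j, P.inc l j * f j = f l.1.1 - f l.1.2 := by
  simp [inc, sub_mul, Finset.sum_sub_distrib]

theorem sum_heatIn (mode : HeatPumpMode N) (x : P.State) :
    ∑ e, P.heatIn mode x e = ∑ e : P.heatSrc, (P.heatSys e).output (x.xh e) (P.Tbar x) +
      ∑ j ∈ P.pump, P.Co j * P.pP mode x j - ∑ e, P.hL e := by
  have h1 : ∑ e, P.hG x e = ∑ e : P.heatSrc, (P.heatSys e).output (x.xh e) (P.Tbar x) := by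
    have : ∀ e : P.heatSrc, (P.heatSys e).output (x.xh e) (P.Tbar x) = P.hG x e := fun e => by
      simp [hG]
    simp only [this]
    rw [Finset.sum_coe_eq_sum_ite]
    refine Finset.sum_congr rfl fun e _ => ?_
    split_ifs with h
    · rfl
    · simp [hG, h]
  have h2 : ∑ e, P.hP mode x e = ∑ j ∈ P.pump, P.Co j * P.pP mode x j := by
    unfold hP
    rw [Finset.sum_comm]
    simp
  simp only [heatIn, Finset.sum_sub_distrib, Finset.sum_add_distrib, h1, h2]

/-- The electric network coupled to the mean temperature by heat pumps that link the frequency at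
their buses to it. -/
noncomputable def converterNet (P : CHPNetwork N E K) (m : N → ℝ) {α : ℝ} (hα : 0 < α) :
    PassiveNet P.lines (P.gen ⊕ Unit) {j // j ∉ P.gen ∧ j ∉ P.pump} (P.gen ⊕ P.heatSrc) where
  S := Sum.elim P.genSys P.heatSys
  att := Sum.map id fun _ => ()
  κ := Sum.elim (fun _ => 1) fun _ => α
  κ_pos := by rintro (i | i) <;> simp [hα]
  R l := Sum.elim (fun j => P.inc l j) fun _ => ∑ j ∈ P.pump, m j * P.inc l j
  R' l q := P.inc l q
  b l := P.B l.1
  b_pos l := P.B_pos l.1 l.2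
  M := Sum.elim (fun j => P.M j) fun _ => α * P.volume
  M_pos := by
    rintro (j | _)
    · exact P.M_gen j.1 j.2
    · exact mul_pos hα P.volume_pos
  D := Sum.elim (fun j => P.D j) fun _ => 0
  D_nonneg := by
    rintro (j | _)
    · exact (P.D_pos j.1).le
    · exact le_rfl
  active := by
    rintro (j | _)
    · exact Or.inl (P.D_pos j.1)
    -- The mean temperature has no damping of its own; a conventional heat source supplies the
    -- strict passivity.
    · obtain ⟨e, he⟩ := P.heatSrc_nonempty
      exact Or.inr ⟨Sum.inr ⟨e, he⟩, rfl⟩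
  c := Sum.elim (fun j => -P.pL j) fun _ => -(α * ∑ e, P.hL e)
  D' q := P.D q
  D'_pos q := P.D_pos q
  c' q := -P.pL q

section Converter

/-- The variables of `converterNet` at a state of the network. -/
noncomputable def converterProj (m : N → ℝ) {α : ℝ} (hα : 0 < α) (x : P.State) : (P.converterNet m hα).State :=
  (x.η, Sum.elim (fun j => x.ω j) fun _ => P.Tbar x,
    fun i => match i with
      | Sum.inl j => x.xe j
      | Sum.inr e => x.xh e)

open Classical in
/-- The consistent state with uniform temperatures given by a state of `converterNet`. -/
noncomputable def converterEmbed (m : N → ℝ) {α : ℝ} (hα : 0 < α)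
    (y : (P.converterNet m hα).State) : P.State :=
  (y.1, fun j => if h : j ∈ P.gen then y.2.1 (Sum.inl ⟨j, h⟩) else
      if h' : j ∈ P.pump then m j * y.2.1 (Sum.inr ()) else
        (P.converterNet m hα).w y.1 ⟨j, h, h'⟩,
    fun j => y.2.2 (Sum.inl j), fun _ => y.2.1 (Sum.inr ()), fun _ => y.2.1 (Sum.inr ()),
    fun e => y.2.2 (Sum.inr e))

variable {m : N → ℝ} {α : ℝ} (hα : 0 < α)

theorem continuous_converterProj :
    Continuous (converterProj m hα : P.State → (P.converterNet m hα).State) := by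
  refine continuous_fst.prodMk ((continuous_pi fun j => ?_).prodMk (continuous_pi fun i => ?_))
  · rcases j with j | _
    · exact continuous_ω j.1
    · exact continuous_Tbar
  · rcases i with j | e
    · exact continuous_xe j
    · exact continuous_xh e

theorem continuous_converterEmbed :
    Continuous (converterEmbed m hα : (P.converterNet m hα).State → P.State) := by
  have h1 : ∀ i, Continuous fun y : (P.converterNet m hα).State => y.2.1 i := fun i =>
    (continuous_apply i).comp (continuous_fst.comp continuous_snd)
  have h2 : ∀ i, Continuous fun y : (P.converterNet m hα).State => y.2.2 i := fun i =>
    (continuous_apply i).comp (continuous_snd.comp continuous_snd)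
  have h3 : ∀ q, Continuous fun y : (P.converterNet m hα).State =>
      (P.converterNet m hα).w y.1 q := fun q => by
    unfold PassiveNet.w
    fun_prop
  refine continuous_fst.prodMk ((continuous_pi fun j => ?_).prodMk
    ((continuous_pi fun j => h2 (Sum.inl j)).prodMk ((continuous_pi fun _ => h1 (Sum.inr ())).prodMk
      ((continuous_pi fun _ => h1 (Sum.inr ())).prodMk (continuous_pi fun e => h2 (Sum.inr e))))))
  split_ifs with h h'
  · exact h1 _
  · exact continuous_const.mul (h1 _)
  · exact h3 _

/-- At a load bus without pump the swing equation is algebraic, and w is its solution for the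
frequency; the residual measures the distance to that solution. -/
theorem converter_w (m : N → ℝ) {α : ℝ} (hα : 0 < α) (x : P.State) (q : {j // j ∉ P.gen ∧ j ∉ P.pump}) :
    P.D q * (P.converterNet m hα).w x.η q =
      P.swingRHS (.converterLinked m) x q + P.D q * x.ω q := by
  have hD := (P.D_pos q.1).ne'
  unfold PassiveNet.w
  simp only [converterNet]
  rw [mul_div_cancel₀ _ hD]
  simp only [swingRHS, pP, q.2.2, if_false, pG, q.2.1, dif_neg, not_false_eq_true, netInflow_eq]
  ring

theorem converter_w_eq {x : P.State} (hx : P.IsConsistent (.converterLinked m) x)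
    (q : {j // j ∉ P.gen ∧ j ∉ P.pump}) : (P.converterNet m hα).w x.η q = x.ω q := by
  have h := converter_w m hα x q
  rw [hx.1 q q.2.1 q.2.2, zero_add] at h
  exact mul_left_cancel₀ (P.D_pos q.1).ne' h

/-- Generator buses, pump buses and the rest partition the buses, and the frequencies of all pump
buses are carried by the single variable T̄ with weights m_j. -/
theorem converter_field_angle (hdisj : Disjoint P.gen P.pump) {x : P.State}
    (hx : P.IsConsistent (.converterLinked m) x) (l : P.lines) :
    ((P.converterNet m hα).field (converterProj m hα x)).1 l = x.ω l.1.1 - x.ω l.1.2 := by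
  have hw : ∀ q, (P.converterNet m hα).w (converterProj m hα x).1 q = x.ω q :=
    converter_w_eq hα hx
  simp only [PassiveNet.field, hw]
  rw [← sum_inc_mul l x.ω, Fintype.sum_sum_type]
  simp only [converterNet, converterProj, Sum.elim_inl, Sum.elim_inr, Finset.univ_unique,
    Finset.sum_singleton]
  have e1 := Finset.sum_coe_eq_sum_ite P.gen (fun j => P.inc l j * x.ω j)
  have e2 := Finset.sum_subtype_eq_sum_ite (fun j => j ∉ P.gen ∧ j ∉ P.pump)
    (fun j => P.inc l j * x.ω j)
  have e3 : (∑ j ∈ P.pump, m j * P.inc l j) * P.Tbar x =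
      ∑ j, if j ∈ P.pump then P.inc l j * x.ω j else 0 := by
    rw [Finset.sum_ite_mem, Finset.univ_inter, Finset.sum_mul]
    exact Finset.sum_congr rfl fun j hj => by rw [hx.2 j hj]; ring
  rw [e1, e2, e3, ← Finset.sum_add_distrib, ← Finset.sum_add_distrib]
  refine Finset.sum_congr rfl fun j _ => ?_
  by_cases h1 : j ∈ P.gen
  · simp [h1, Finset.disjoint_left.1 hdisj h1]
  · by_cases h2 : j ∈ P.pump <;> simp [h1, h2]

theorem converter_field_gen (hdisj : Disjoint P.gen P.pump) (x : P.State) (j : P.gen) :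
    P.M j * ((P.converterNet m hα).field (converterProj m hα x)).2.1 (Sum.inl j) =
      P.swingRHS (.converterLinked m) x j := by
  have hM := (P.M_gen j.1 j.2).ne'
  simp only [PassiveNet.field]
  rw [Fintype.sum_sum_type]
  simp only [converterNet, converterProj, Sum.elim_inl, Sum.elim_inr, Sum.map_inl, Sum.map_inr,
    id, Sum.inl.injEq, reduceCtorEq, if_false, Finset.sum_const_zero, add_zero,
    Finset.sum_ite_eq', Finset.mem_univ, if_true, one_mul]
  rw [mul_div_cancel₀ _ hM]
  simp only [swingRHS, pP, Finset.disjoint_left.1 hdisj j.2, if_false, pG, j.2, dif_pos,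
    netInflow_eq]
  ring

/-- Since m_j = α C_{o,j}, scaling the heat equation by α gives the pump powers the weights m_j by
which T̄ sets the pump frequencies. This is why inertia, load and source outputs of T̄ carry the
factor α in `converterNet`. -/
theorem converter_field_mean (hm : ∀ j ∈ P.pump, m j = α * P.Co j) (x : P.State) :
    P.volume * ((P.converterNet m hα).field (converterProj m hα x)).2.1 (Sum.inr ()) =
      ∑ e, P.heatIn (.converterLinked m) x e := by
  have hV := P.volume_pos.ne'
  simp only [PassiveNet.field]
  rw [Fintype.sum_sum_type, sum_heatIn]
  simp only [converterNet, converterProj, Sum.elim_inl, Sum.elim_inr, Sum.map_inl, Sum.map_inr,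
    id, reduceCtorEq, if_false, Finset.sum_const_zero, zero_add, if_true, zero_mul, sub_zero]
  have e1 : ∑ l, (∑ j ∈ P.pump, m j * P.inc l j) * (P.B l.1 * Real.sin (x.η l)) =
      -(α * ∑ j ∈ P.pump, P.Co j * P.pP (.converterLinked m) x j) := by
    simp only [Finset.sum_mul]
    rw [Finset.sum_comm, Finset.mul_sum, ← Finset.sum_neg_distrib]
    refine Finset.sum_congr rfl fun j hj => ?_
    simp only [pP, hj, if_true, netInflow_eq, hm j hj, Finset.mul_sum, mul_neg, neg_neg]
    exact Finset.sum_congr rfl fun _ _ => by ring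
  rw [e1, ← Finset.mul_sum]
  have := hα.ne'
  field_simp
  ring

theorem converterProj_embed (y : (P.converterNet m hα).State) :
    converterProj m hα (converterEmbed m hα y) = y := by
  refine Prod.ext rfl (Prod.ext (funext fun j => ?_) (funext fun i => ?_))
  · rcases j with j | _
    · simp [converterProj, converterEmbed, State.ω]
    · exact Tbar_of_const (by rintro (e | k) <;> rfl)
  · rcases i with j | e <;> rfl

theorem isConsistent_converterEmbed (hdisj : Disjoint P.gen P.pump)
    (y : (P.converterNet m hα).State) :
    P.IsConsistent (.converterLinked m) (converterEmbed m hα y) := by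
  refine ⟨fun j h1 h2 => ?_, fun j hj => ?_⟩
  · have h := converter_w m hα (converterEmbed m hα y) ⟨j, h1, h2⟩
    have h3 : (converterEmbed m hα y).ω j = (P.converterNet m hα).w y.1 ⟨j, h1, h2⟩ := by
      simp [converterEmbed, State.ω, h1, h2]
    rw [h3] at h
    have h4 : (converterEmbed m hα y).η = y.1 := rfl
    rw [h4] at h
    linarith
  · have h1 : P.Tbar (converterEmbed m hα y) = y.2.1 (Sum.inr ()) :=
      Tbar_of_const (by rintro (e | k) <;> rfl)
    rw [h1]
    have : j ∉ P.gen := Finset.disjoint_right.1 hdisj hj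
    simp [converterEmbed, State.ω, this, hj]

theorem converterEmbed_proj {x : P.State} (hx : P.IsConsistent (.converterLinked m) x) :
    converterEmbed m hα (converterProj m hα x) = P.uniformTemp x := by
  refine Prod.ext rfl (Prod.ext (funext fun j => ?_) rfl)
  show (if h : j ∈ P.gen then x.ω j else if h' : j ∈ P.pump then m j * P.Tbar x else
    (P.converterNet m hα).w x.η ⟨j, h, h'⟩) = x.ω j
  split_ifs with h h'
  · rfl
  · exact (hx.2 j h').symm
  · exact converter_w_eq hα hx ⟨j, h, h'⟩

theorem isODESolution_converterProj (hdisj : Disjoint P.gen P.pump)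
    (hm : ∀ j ∈ P.pump, m j = α * P.Co j) {x : ℝ → P.State}
    (hx : P.IsReducedSolution (.converterLinked m) x) :
    IsODESolution (P.converterNet m hα).field (fun t => converterProj m hα (x t)) := by
  intro t ht
  refine PassiveNet.hasDerivWithinAt_state (fun l => ?_) (fun j => ?_) fun i => ?_
  · rw [converter_field_angle hα hdisj (hx.consistent t ht)]
    exact hx.angle t ht l
  · rcases j with j | _
    · refine HasDerivWithinAt.of_const_mul (P.M_gen j.1 j.2).ne' ?_
      rw [converter_field_gen hα hdisj]
      exact hx.swing t ht j j.2
    · refine HasDerivWithinAt.of_const_mul P.volume_pos.ne' ?_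
      rw [converter_field_mean hα hm]
      exact hx.mean t ht
  · rcases i with j | e
    · exact hx.generator t ht j
    · exact hx.heatSource t ht e

theorem isReducedSolution_converterEmbed (hdisj : Disjoint P.gen P.pump)
    (hm : ∀ j ∈ P.pump, m j = α * P.Co j) {y : ℝ → (P.converterNet m hα).State}
    (hy : IsODESolution (P.converterNet m hα).field y) :
    P.IsReducedSolution (.converterLinked m) (fun t => converterEmbed m hα (y t)) := by
  have hc := fun t => isConsistent_converterEmbed hα hdisj (y t)
  have hbar : ∀ t, P.Tbar (converterEmbed m hα (y t)) = (y t).2.1 (Sum.inr ()) := fun t =>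
    Tbar_of_const (by rintro (e | k) <;> rfl)
  have hω : ∀ t, ∀ j : P.gen, (converterEmbed m hα (y t)).ω j = (y t).2.1 (Sum.inl j) :=
    fun t j => by simp [converterEmbed, State.ω]
  refine ⟨fun t _ => hc t, fun t ht l => ?_, fun t ht j hj => ?_, fun t ht j => ?_,
    fun t ht => ?_, fun t ht e => ?_⟩
  · rw [← converter_field_angle hα hdisj (hc t), converterProj_embed]
    exact hasDerivWithinAt_pi.1 (hy t ht).fst l
  · rw [← converter_field_gen hα hdisj _ ⟨j, hj⟩, converterProj_embed]
    simp only [hω _ ⟨j, hj⟩]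
    exact (hasDerivWithinAt_pi.1 (hy t ht).snd.fst (Sum.inl ⟨j, hj⟩)).const_mul _
  · rw [hω]
    exact hasDerivWithinAt_pi.1 (hy t ht).snd.snd (Sum.inl j)
  · rw [← converter_field_mean hα hm, converterProj_embed]
    simp only [hbar]
    exact (hasDerivWithinAt_pi.1 (hy t ht).snd.fst (Sum.inr ())).const_mul _
  · rw [hbar]
    exact hasDerivWithinAt_pi.1 (hy t ht).snd.snd (Sum.inr e)

theorem converter_field_eq_zero (hdisj : Disjoint P.gen P.pump)
    (hm : ∀ j ∈ P.pump, m j = α * P.Co j) {x : P.State}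
    (hx : P.IsEquilibrium (.converterLinked m) x) :
    (P.converterNet m hα).field (converterProj m hα x) = 0 := by
  refine Prod.ext (funext fun l => ?_) (Prod.ext (funext fun j => ?_) (funext fun i => ?_))
  · rw [converter_field_angle hα hdisj hx.consistent]
    exact hx.angle l
  · rcases j with j | _
    · refine (mul_eq_zero.1 ?_).resolve_left (P.M_gen j.1 j.2).ne'
      rw [converter_field_gen hα hdisj]
      exact hx.swing j j.2
    · refine (mul_eq_zero.1 ?_).resolve_left P.volume_pos.ne'
      rw [converter_field_mean hα hm]
      exact hx.sum_heatIn_eq_zero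
  · rcases i with j | e
    · exact neg_eq_zero.2 (hx.generator j)
    · exact neg_eq_zero.2 (hx.heatSource e)

/-- Stability when the pumps link frequency and mean temperature. -/
theorem stable_converterLinked (hmode : P.ModeAdmissible (.converterLinked m)) (xs : P.State)
    (heq : P.IsEquilibrium (.converterLinked m) xs)
    (hη : ∀ l : P.lines, |xs.η l| < Real.pi / 2)
    (hgen : ∀ j : P.gen, (P.genSys j).IsLocallyInputStrictlyPassive (xs.ω j) (xs.xe j) ∧
      (P.genSys j).IsAsymptoticallyStable (xs.ω j) (xs.xe j))
    (hheat : ∀ e : P.heatSrc, (P.heatSys e).IsLocallyInputStrictlyPassive (P.Tbar xs) (xs.xh e) ∧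
      (P.heatSys e).IsAsymptoticallyStable (P.Tbar xs) (xs.xh e)) :
    ∃ U : Set P.State, IsOpen U ∧ xs ∈ U ∧
      (∀ x₀ ∈ U, P.IsConsistent (.converterLinked m) x₀ →
        ∃ x : ℝ → P.State, P.IsSolution (.converterLinked m) x ∧ x 0 = x₀) ∧
      ∀ x : ℝ → P.State, P.IsSolution (.converterLinked m) x → x 0 ∈ U →
        ∃ y : P.State, P.IsEquilibrium (.converterLinked m) y ∧ Tendsto x atTop (𝓝 y) := by
  obtain ⟨hdisj, hmpos, hratio⟩ := hmode
  -- α is the common ratio; without pumps its value is irrelevant.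
  obtain ⟨α, hα, hm⟩ : ∃ α : ℝ, 0 < α ∧ ∀ j ∈ P.pump, m j = α * P.Co j := by
    rcases P.pump.eq_empty_or_nonempty with h0 | ⟨i, hi⟩
    · exact ⟨1, one_pos, by simp [h0]⟩
    · refine ⟨m i / P.Co i, div_pos (hmpos i hi) (P.Co_pos i hi), fun j hj => ?_⟩
      rw [hratio i hi j hj, div_mul_cancel₀ _ (P.Co_pos j hj).ne']
  obtain ⟨W, φ, r, hr, hpass⟩ := (P.converterNet m hα).exists_isPassiveAt
    (p := converterProj m hα xs) (converter_field_eq_zero hα hdisj hm heq) hη (by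
      rintro (j | e)
      · exact hgen j
      · exact hheat e)
  have h := hpass r hr le_rfl
  refine stable_of_reduction (continuous_converterProj hα) (continuous_converterEmbed hα)
    (fun x hx => converterEmbed_proj hα hx)
    (fun x hx => isODESolution_converterProj hα hdisj hm hx)
    (fun y hy => isReducedSolution_converterEmbed hα hdisj hm hy) xs ?_ ?_
  · obtain ⟨δ, hδ, hex⟩ := h.isLyapunov.exists_solution
    exact ⟨δ, hδ, fun y₀ hy₀ => (hex y₀ hy₀).imp fun y hy => ⟨hy.1, hy.2.1⟩⟩
  · obtain ⟨δ, hδ, hc⟩ := h.exists_tendsto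
    exact ⟨δ, hδ, fun y hy hy0 => (hc y hy hy0).imp fun q hq => hq.2⟩

end Converter

end CHPNetwork

/-! ### Cascades -/

/-- A cascade of a system whose solutions converge and an asymptotically stable system, coupled by
a term that vanishes at the limits of the first one. -/
theorem IsLyapunov.cascade {Y₁ Y₂ : Type*} [NormedAddCommGroup Y₁] [NormedSpace ℝ Y₁]
    [FiniteDimensional ℝ Y₁] [NormedAddCommGroup Y₂] [NormedSpace ℝ Y₂] [FiniteDimensional ℝ Y₂]
    {F₁ : Y₁ → Y₁} {V₁ : Y₁ → ℝ} {p₁ : Y₁} {r₁ : ℝ} (h₁ : IsLyapunov F₁ V₁ p₁ r₁)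
    {F₂ : Y₂ → Y₂} {V₂ : Y₂ → ℝ} {p₂ : Y₂} {r₂ : ℝ} (h₂ : IsLyapunov F₂ V₂ p₂ r₂)
    {Q : Set Y₁}
    (hconv₁ : ∃ δ > 0, ∀ x, IsODESolution F₁ x → dist (x 0) p₁ < δ →
      ∃ q ∈ Q, Tendsto x atTop (𝓝 q))
    (hconv₂ : ∃ δ > 0, ∀ x, IsODESolution F₂ x → dist (x 0) p₂ < δ → Tendsto x atTop (𝓝 p₂))
    {G : Y₁ → Y₂} (hG : Continuous G) (hGp : G p₁ = 0) (hGQ : ∀ q ∈ Q, G q = 0) :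
    (∃ δ > 0, ∀ y₀ : Y₁ × Y₂, dist y₀ (p₁, p₂) < δ →
      ∃ y, y 0 = y₀ ∧ IsODESolution (fun y : Y₁ × Y₂ => (F₁ y.1, F₂ y.2 + G y.1)) y) ∧
    ∃ δ > 0, ∀ y : ℝ → Y₁ × Y₂, IsODESolution (fun y : Y₁ × Y₂ => (F₁ y.1, F₂ y.2 + G y.1)) y →
      dist (y 0) (p₁, p₂) < δ → ∃ q, Tendsto y atTop (𝓝 q) := by
  obtain ⟨δ₂, hδ₂, hpert⟩ := h₂.perturbed hconv₂
  -- The first component is kept so near p₁ that the coupling never exceeds the perturbation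
  -- tolerated by the second.
  obtain ⟨η, hη, hGη⟩ : ∃ η > 0, ∀ y, dist y p₁ < η → ‖G y‖ < δ₂ := by
    have h := hG.norm.tendsto p₁
    rw [hGp, norm_zero] at h
    exact Metric.eventually_nhds_iff.1 (h.eventually_lt_const hδ₂)
  have hε : 0 < min η r₁ := lt_min hη h₁.pos
  have hε1 : min η r₁ ≤ η := min_le_left _ _
  have h₁' := h₁.mono hε (min_le_right _ _)
  constructor
  · obtain ⟨δ₁, hδ₁, hex⟩ := h₁'.exists_solution
    refine ⟨min δ₁ δ₂, lt_min hδ₁ hδ₂, fun y₀ hy₀ => ?_⟩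
    rw [Prod.dist_eq, max_lt_iff] at hy₀
    obtain ⟨x₁, hx0, hx₁, hin⟩ := hex y₀.1 (hy₀.1.trans_le (min_le_left _ _))
    obtain ⟨x₂, hx20, hx₂⟩ := exists_solvesWhileIn (d := fun t => G (x₁ t)) h₂.lip
      (hG.comp_continuousOn hx₁.continuousOn) y₀.2
    obtain ⟨hin₂, -⟩ := hpert _ _ hx₂
      (fun t ht => (hGη _ ((hin t ht).trans_le hε1)).le)
      (by rw [hx20]; exact hy₀.2.trans_le (min_le_right _ _))
    refine ⟨fun t => (x₁ t, x₂ t), Prod.ext hx0 hx20, fun t ht => ?_⟩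
    exact (hx₁ t ht).prodMk (hx₂.deriv t ht fun s hs => (hin₂ s hs.1).le)
  · obtain ⟨δ₁, hδ₁, hst⟩ := h₁'.stable
    obtain ⟨δ, hδ, hc⟩ := hconv₁
    refine ⟨min (min δ₁ δ) δ₂, lt_min (lt_min hδ₁ hδ) hδ₂, fun y hy hy0 => ?_⟩
    rw [Prod.dist_eq, max_lt_iff] at hy0
    have hy1 : IsODESolution F₁ (fun t => (y t).1) := fun t ht => (hy t ht).fst
    have h0 := hy0.1.trans_le (min_le_left _ _)
    have hin := hst _ (hy1.solvesWhileIn _) (h0.trans_le (min_le_left _ _))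
    obtain ⟨q, hqQ, hq⟩ := hc _ hy1 (h0.trans_le (min_le_right _ _))
    have hy2 : SolvesWhileIn F₂ (fun t => G (y t).1) (Metric.closedBall p₂ r₂)
        (fun t => (y t).2) :=
      ⟨fun t ht => continuous_snd.continuousAt.comp_continuousWithinAt
        (hy t ht).continuousWithinAt, fun t ht _ => (hy t ht).snd⟩
    obtain ⟨-, ht2⟩ := hpert _ _ hy2 (fun t ht => (hGη _ ((hin t ht).trans_le hε1)).le)
      (hy0.2.trans_le (min_le_right _ _))
    -- The limit q may differ from p₁, but the coupling vanishes on all of Q.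
    have hd : Tendsto (fun t => G (y t).1) atTop (𝓝 0) := by
      rw [← hGQ q hqQ]
      exact (hG.tendsto q).comp hq
    exact ⟨(q, p₂), hq.prodMk_nhds (ht2 hd)⟩

/-! ### Mode 1: the electric network drives the thermal one -/

namespace CHPNetwork

variable {N E K : Type*} [Fintype N] [DecidableEq N] [Fintype E] [DecidableEq E]
  [Fintype K] [DecidableEq K]

/-- Damping, including that of heat pumps with frequency-dependent consumption. -/
def pumpDamping (P : CHPNetwork N E K) (a : N → ℝ) (j : N) : ℝ :=
  P.D j + if j ∈ P.pump then a j else 0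

theorem pumpDamping_pos (P : CHPNetwork N E K) {a : N → ℝ} (ha : ∀ j ∈ P.pump, 0 < a j) (j : N) :
    0 < P.pumpDamping a j := by
  unfold pumpDamping
  have h1 := P.D_pos j
  split_ifs with h
  · linarith [ha j h]
  · linarith

/-- The electric network with frequency-dependent heat pumps. -/
noncomputable def electricNet (P : CHPNetwork N E K) {a : N → ℝ} (ha : ∀ j ∈ P.pump, 0 < a j) :
    PassiveNet P.lines P.gen {j // j ∉ P.gen} P.gen where
  S := P.genSys
  att := id
  κ _ := 1
  κ_pos _ := one_pos
  R l j := P.inc l j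
  R' l q := P.inc l q
  b l := P.B l.1
  b_pos l := P.B_pos l.1 l.2
  M j := P.M j
  M_pos j := P.M_gen j.1 j.2
  D j := P.pumpDamping a j
  D_nonneg j := (P.pumpDamping_pos ha j).le
  active j := Or.inl (P.pumpDamping_pos ha j)
  c j := -P.pL j
  D' q := P.pumpDamping a q
  D'_pos q := P.pumpDamping_pos ha q
  c' q := -P.pL q

/-- The mean temperature and the heat sources, with a constant net heat injection `c`. -/
noncomputable def heatNet (P : CHPNetwork N E K) (c : ℝ) :
    PassiveNet Empty Unit Empty P.heatSrc where
  S := P.heatSys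
  att _ := ()
  κ _ := 1
  κ_pos _ := one_pos
  R l := l.elim
  R' l := l.elim
  b l := l.elim
  b_pos l := l.elim
  M _ := P.volume
  M_pos _ := P.volume_pos
  D _ := 0
  D_nonneg _ := le_rfl
  active _ := by
    obtain ⟨e, he⟩ := P.heatSrc_nonempty
    exact Or.inr ⟨⟨e, he⟩, rfl⟩
  c _ := c
  D' q := q.elim
  D'_pos q := q.elim
  c' q := q.elim

section FreqDependent

variable {P : CHPNetwork N E K} {a : N → ℝ} (ha : ∀ j ∈ P.pump, 0 < a j)

/-- Bus frequencies, as functions of the state of `electricNet`. -/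
noncomputable def electricω (y : (P.electricNet ha).State) (j : N) : ℝ :=
  if h : j ∈ P.gen then y.2.1 ⟨j, h⟩ else (P.electricNet ha).w y.1 ⟨j, h⟩

/-- Heat power of the pumps at bus frequencies `ω`. -/
noncomputable def pumpHeat (P : CHPNetwork N E K) (a ω : N → ℝ) : ℝ :=
  ∑ j ∈ P.pump, P.Co j * (a j * ω j)

/-- The variables of `electricNet` at a state of the network. -/
def electricProj (x : P.State) : (P.electricNet ha).State :=
  (x.η, fun j => x.ω j, x.xe)

/-- The variables of `heatNet` at a state of the network. -/
noncomputable def heatProj (c : ℝ) (x : P.State) : (P.heatNet c).State :=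
  (fun l => l.elim, fun _ => P.Tbar x, x.xh)

/-- The consistent state with uniform temperatures given by states of the two subsystems. -/
noncomputable def cascadeEmbed (c : ℝ) (y : (P.electricNet ha).State × (P.heatNet c).State) :
    P.State :=
  (y.1.1, electricω ha y.1, y.1.2.2, fun _ => y.2.2.1 (), fun _ => y.2.2.1 (), y.2.2.2)

/-- The effect of the pumps on the mean temperature, relative to a net heat injection `c`. -/
noncomputable def coupling (c : ℝ) (y : (P.electricNet ha).State) : (P.heatNet c).State :=
  (0, fun _ => (P.pumpHeat a (electricω ha y) - ∑ e, P.hL e - c) / P.volume, 0)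

/-- The vector field of the cascade of the two subsystems. -/
noncomputable def cascadeField (c : ℝ) (y : (P.electricNet ha).State × (P.heatNet c).State) :
    (P.electricNet ha).State × (P.heatNet c).State :=
  ((P.electricNet ha).field y.1, (P.heatNet c).field y.2 + coupling ha c y.1)

theorem continuous_electricω : Continuous (electricω ha) := by
  refine continuous_pi fun j => ?_
  unfold electricω
  split_ifs with h
  · fun_prop
  · unfold PassiveNet.w
    fun_prop

theorem continuous_coupling (c : ℝ) : Continuous (coupling ha c) := by
  have h1 : Continuous fun y => P.pumpHeat a (electricω ha y) :=
    continuous_finsetSum _ fun j _ => continuous_const.mul (continuous_const.mul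
      ((continuous_apply j).comp (continuous_electricω ha)))
  exact continuous_const.prodMk ((continuous_pi fun _ =>
    ((h1.sub continuous_const).sub continuous_const).div_const _).prodMk continuous_const)

theorem continuous_electricProj : Continuous (electricProj ha) :=
  continuous_fst.prodMk ((continuous_pi fun j : P.gen => continuous_ω (j : N)).prodMk
    (continuous_pi continuous_xe))

theorem continuous_heatProj (c : ℝ) :
    Continuous (heatProj c : P.State → (P.heatNet c).State) :=
  continuous_const.prodMk ((continuous_pi fun _ => continuous_Tbar).prodMk
    (continuous_pi continuous_xh))

theorem continuous_cascadeEmbed (c : ℝ) : Continuous (cascadeEmbed ha c) := by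
  have h1 : Continuous fun y : (P.electricNet ha).State × (P.heatNet c).State =>
      electricω ha y.1 := (continuous_electricω ha).comp continuous_fst
  unfold cascadeEmbed
  fun_prop

/-- With pump consumption counted as damping, a load bus with or without pump is a massless node,
and w solves its power balance for the frequency. -/
theorem electric_w (x : P.State) (q : {j // j ∉ P.gen}) :
    P.pumpDamping a q * (P.electricNet ha).w x.η q =
      P.swingRHS (.freqDependent a) x q + P.pumpDamping a q * x.ω q := by
  have hD := (P.pumpDamping_pos ha q.1).ne'
  unfold PassiveNet.w
  simp only [electricNet]
  rw [mul_div_cancel₀ _ hD]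
  simp only [swingRHS, pP, pG, q.2, dif_neg, not_false_eq_true, netInflow_eq, pumpDamping]
  split_ifs <;> ring

theorem electric_w_eq {x : P.State} (hx : P.IsConsistent (.freqDependent a) x)
    (q : {j // j ∉ P.gen}) : (P.electricNet ha).w x.η q = x.ω q := by
  have h := electric_w ha x q
  rw [hx q q.2, zero_add] at h
  exact mul_left_cancel₀ (P.pumpDamping_pos ha q.1).ne' h

theorem electricω_electricProj {x : P.State} (hx : P.IsConsistent (.freqDependent a) x) :
    electricω ha (electricProj ha x) = x.ω := by
  funext j
  unfold electricω
  split_ifs with h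
  · rfl
  · exact electric_w_eq ha hx ⟨j, h⟩

theorem electric_field_angle {x : P.State} (hx : P.IsConsistent (.freqDependent a) x)
    (l : P.lines) :
    ((P.electricNet ha).field (electricProj ha x)).1 l = x.ω l.1.1 - x.ω l.1.2 := by
  have hw : ∀ q, (P.electricNet ha).w (electricProj ha x).1 q = x.ω q := electric_w_eq ha hx
  simp only [PassiveNet.field, hw]
  rw [← sum_inc_mul l x.ω]
  simp only [electricNet, electricProj]
  rw [Finset.sum_coe_eq_sum_ite P.gen (fun j => P.inc l j * x.ω j),
    Finset.sum_subtype_eq_sum_ite (fun j => j ∉ P.gen) (fun j => P.inc l j * x.ω j),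
    ← Finset.sum_add_distrib]
  refine Finset.sum_congr rfl fun j _ => ?_
  by_cases h : j ∈ P.gen <;> simp [h]

theorem electric_field_gen (x : P.State) (j : P.gen) :
    P.M j * ((P.electricNet ha).field (electricProj ha x)).2.1 j =
      P.swingRHS (.freqDependent a) x j := by
  have hM := (P.M_gen j.1 j.2).ne'
  simp only [PassiveNet.field, electricNet, electricProj, id, Finset.sum_ite_eq',
    Finset.mem_univ, if_true, one_mul]
  rw [mul_div_cancel₀ _ hM]
  simp only [swingRHS, pP, pG, j.2, dif_pos, netInflow_eq, pumpDamping]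
  split_ifs <;> ring

/-- The constant c is added in `heatNet` and subtracted in `coupling`, so any split of the net
injection yields the same equation. -/
theorem cascade_field_mean (c : ℝ) {x : P.State} (hx : P.IsConsistent (.freqDependent a) x) :
    P.volume * (cascadeField ha c (electricProj ha x, heatProj c x)).2.2.1 () =
      ∑ e, P.heatIn (.freqDependent a) x e := by
  have hV := P.volume_pos.ne'
  have hp : P.pumpHeat a x.ω = ∑ j ∈ P.pump, P.Co j * P.pP (.freqDependent a) x j :=
    Finset.sum_congr rfl fun j hj => by simp [pP, hj]
  have e : (cascadeField ha c (electricProj ha x, heatProj c x)).2.2.1 () =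
      ((P.heatNet c).field (heatProj c x)).2.1 () +
        (P.pumpHeat a (electricω ha (electricProj ha x)) - ∑ e, P.hL e - c) / P.volume := rfl
  rw [e, electricω_electricProj ha hx, sum_heatIn, ← hp]
  simp only [PassiveNet.field, heatNet, heatProj, if_true, one_mul, zero_mul,
    Finset.univ_eq_empty, Finset.sum_empty, sub_zero]
  field_simp
  ring

theorem isConsistent_cascadeEmbed (c : ℝ) (y : (P.electricNet ha).State × (P.heatNet c).State) :
    P.IsConsistent (.freqDependent a) (cascadeEmbed ha c y) := by
  intro j hj
  have h := electric_w ha (cascadeEmbed ha c y) ⟨j, hj⟩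
  have h3 : (cascadeEmbed ha c y).ω j = (P.electricNet ha).w y.1.1 ⟨j, hj⟩ := by
    simp [cascadeEmbed, State.ω, electricω, hj]
  have h4 : (cascadeEmbed ha c y).η = y.1.1 := rfl
  rw [h3, h4] at h
  linarith

theorem Tbar_cascadeEmbed (c : ℝ) (y : (P.electricNet ha).State × (P.heatNet c).State) :
    P.Tbar (cascadeEmbed ha c y) = y.2.2.1 () :=
  Tbar_of_const (by rintro (e | k) <;> rfl)

theorem cascadeEmbed_ω (c : ℝ) (y : (P.electricNet ha).State × (P.heatNet c).State)
    (j : P.gen) : (cascadeEmbed ha c y).ω j = y.1.2.1 j := by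
  simp [cascadeEmbed, State.ω, electricω]

theorem proj_cascadeEmbed (c : ℝ) (y : (P.electricNet ha).State × (P.heatNet c).State) :
    (electricProj ha (cascadeEmbed ha c y), heatProj c (cascadeEmbed ha c y)) = y := by
  refine Prod.ext (Prod.ext rfl (Prod.ext (funext fun j => cascadeEmbed_ω ha c y j) rfl))
    (Prod.ext (funext fun l => l.elim) (Prod.ext (funext fun _ => Tbar_cascadeEmbed ha c y) rfl))

theorem cascadeEmbed_proj (c : ℝ) {x : P.State} (hx : P.IsConsistent (.freqDependent a) x) :
    cascadeEmbed ha c (electricProj ha x, heatProj c x) = P.uniformTemp x :=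
  Prod.ext rfl (Prod.ext (electricω_electricProj ha hx) rfl)

theorem isODESolution_cascade (c : ℝ) {x : ℝ → P.State}
    (hx : P.IsReducedSolution (.freqDependent a) x) :
    IsODESolution (cascadeField ha c)
      (fun t => (electricProj ha (x t), heatProj c (x t))) := by
  intro t ht
  refine HasDerivWithinAt.prodMk (PassiveNet.hasDerivWithinAt_state (fun l => ?_) (fun j => ?_)
    fun i => ?_) (PassiveNet.hasDerivWithinAt_state (fun l => l.elim) (fun j => ?_) fun i => ?_)
  · rw [electric_field_angle ha (hx.consistent t ht)]
    exact hx.angle t ht l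
  · refine HasDerivWithinAt.of_const_mul (P.M_gen j.1 j.2).ne' ?_
    rw [electric_field_gen ha]
    exact hx.swing t ht j j.2
  · exact hx.generator t ht i
  · refine HasDerivWithinAt.of_const_mul P.volume_pos.ne' ?_
    have := cascade_field_mean ha c (hx.consistent t ht)
    unfold cascadeField at this
    rw [this]
    exact hx.mean t ht
  · have := hx.heatSource t ht i
    -- The coupling contributes a zero summand to the equations of the source states.
    rw [← add_zero (-_)] at this
    exact this

theorem isReducedSolution_cascadeEmbed (c : ℝ)
    {y : ℝ → (P.electricNet ha).State × (P.heatNet c).State}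
    (hy : IsODESolution (cascadeField ha c) y) :
    P.IsReducedSolution (.freqDependent a) (fun t => cascadeEmbed ha c (y t)) := by
  have hc := fun t => isConsistent_cascadeEmbed ha c (y t)
  have hpe : ∀ t, electricProj ha (cascadeEmbed ha c (y t)) = (y t).1 := fun t =>
    congrArg Prod.fst (proj_cascadeEmbed ha c (y t))
  refine ⟨fun t _ => hc t, fun t ht l => ?_, fun t ht j hj => ?_, fun t ht j => ?_,
    fun t ht => ?_, fun t ht e => ?_⟩
  · rw [← electric_field_angle ha (hc t), hpe]
    exact hasDerivWithinAt_pi.1 (hy t ht).fst.fst l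
  · rw [← electric_field_gen ha _ ⟨j, hj⟩, hpe]
    simp only [cascadeEmbed_ω ha c _ ⟨j, hj⟩]
    exact (hasDerivWithinAt_pi.1 (hy t ht).fst.snd.fst ⟨j, hj⟩).const_mul _
  · rw [cascadeEmbed_ω]
    exact hasDerivWithinAt_pi.1 (hy t ht).fst.snd.snd j
  · rw [← cascade_field_mean ha c (hc t), proj_cascadeEmbed]
    simp only [Tbar_cascadeEmbed]
    exact (hasDerivWithinAt_pi.1 (hy t ht).snd.snd.fst ()).const_mul _
  · rw [Tbar_cascadeEmbed]
    have := hasDerivWithinAt_pi.1 (hy t ht).snd.snd.snd e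
    have h2 : (cascadeField ha c (y t)).2.2.2 e =
        -(P.heatSys e).f ((y t).2.2.2 e) ((y t).2.2.1 ()) := by
      show -(P.heatSys e).f ((y t).2.2.2 e) ((y t).2.2.1 ()) + 0 = _
      rw [add_zero]
    rw [h2] at this
    exact this

theorem electric_field_eq_zero {x : P.State} (hx : P.IsEquilibrium (.freqDependent a) x) :
    (P.electricNet ha).field (electricProj ha x) = 0 := by
  refine Prod.ext (funext fun l => ?_) (Prod.ext (funext fun j => ?_) (funext fun i => ?_))
  · rw [electric_field_angle ha hx.consistent]
    exact hx.angle l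
  · refine (mul_eq_zero.1 ?_).resolve_left (P.M_gen j.1 j.2).ne'
    rw [electric_field_gen ha]
    exact hx.swing j j.2
  · exact neg_eq_zero.2 (hx.generator i)

/-- With c equal to the net injection at the frequencies of x, the coupling sees only deviations of
the frequencies. It therefore vanishes at the equilibrium and at every limit of the electric network
that has the same frequencies. -/
theorem coupling_eq_zero {x : P.State} {y : (P.electricNet ha).State}
    (hy : electricω ha y = x.ω) : coupling ha (P.pumpHeat a x.ω - ∑ e, P.hL e) y = 0 := by
  unfold coupling
  rw [hy, sub_self, zero_div]
  rfl

theorem heat_field_eq_zero (ha : ∀ j ∈ P.pump, 0 < a j) {x : P.State}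
    (hx : P.IsEquilibrium (.freqDependent a) x) :
    (P.heatNet (P.pumpHeat a x.ω - ∑ e, P.hL e)).field (heatProj _ x) = 0 := by
  refine Prod.ext (funext fun l => l.elim) (Prod.ext (funext fun j => ?_) (funext fun i => ?_))
  · refine (mul_eq_zero.1 ?_).resolve_left P.volume_pos.ne'
    have h1 := cascade_field_mean ha (P.pumpHeat a x.ω - ∑ e, P.hL e) hx.consistent
    rw [hx.sum_heatIn_eq_zero] at h1
    unfold cascadeField at h1
    rw [coupling_eq_zero ha (electricω_electricProj ha hx.consistent)] at h1
    simpa using h1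
  · exact neg_eq_zero.2 (hx.heatSource i)

/-- Stability when the consumption of the pumps depends on the frequency. -/
theorem stable_freqDependent (hmode : P.ModeAdmissible (.freqDependent a)) (xs : P.State)
    (heq : P.IsEquilibrium (.freqDependent a) xs)
    (hη : ∀ l : P.lines, |xs.η l| < Real.pi / 2)
    (hgen : ∀ j : P.gen, (P.genSys j).IsLocallyInputStrictlyPassive (xs.ω j) (xs.xe j) ∧
      (P.genSys j).IsAsymptoticallyStable (xs.ω j) (xs.xe j))
    (hheat : ∀ e : P.heatSrc, (P.heatSys e).IsLocallyInputStrictlyPassive (P.Tbar xs) (xs.xh e) ∧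
      (P.heatSys e).IsAsymptoticallyStable (P.Tbar xs) (xs.xh e)) :
    ∃ U : Set P.State, IsOpen U ∧ xs ∈ U ∧
      (∀ x₀ ∈ U, P.IsConsistent (.freqDependent a) x₀ →
        ∃ x : ℝ → P.State, P.IsSolution (.freqDependent a) x ∧ x 0 = x₀) ∧
      ∀ x : ℝ → P.State, P.IsSolution (.freqDependent a) x → x 0 ∈ U →
        ∃ y : P.State, P.IsEquilibrium (.freqDependent a) y ∧ Tendsto x atTop (𝓝 y) := by
  have ha : ∀ j ∈ P.pump, 0 < a j := hmode
  obtain ⟨W₁, φ₁, r₁, hr₁, hpass₁⟩ := (P.electricNet ha).exists_isPassiveAt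
    (electric_field_eq_zero ha heq) hη hgen
  have h₁ := hpass₁ r₁ hr₁ le_rfl
  obtain ⟨W₂, φ₂, r₂, hr₂, hpass₂⟩ :=
    (P.heatNet (P.pumpHeat a xs.ω - ∑ e, P.hL e)).exists_isPassiveAt
      (heat_field_eq_zero ha heq) (fun l => l.elim) hheat
  have h₂ := hpass₂ r₂ hr₂ le_rfl
  have hω := electricω_electricProj ha heq.consistent
  obtain ⟨hex, hconv⟩ := h₁.isLyapunov.cascade h₂.isLyapunov h₁.exists_tendsto
    (by
      obtain ⟨δ, hδ, hc⟩ := h₂.exists_tendsto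
      refine ⟨δ, hδ, fun x hx hx0 => ?_⟩
      obtain ⟨q, hq, ht⟩ := hc x hx hx0
      -- Without lines there are no angles left to vary: the limit is the equilibrium itself, so the
      -- thermal part is asymptotically stable as the cascade requires.
      rwa [show q = heatProj _ xs from Prod.ext (funext fun l => l.elim) hq.1] at ht)
    (continuous_coupling ha _) (coupling_eq_zero ha hω)
    -- Limits of the electric network may differ from the equilibrium in their angles, but generator
    -- frequencies and the net flows that determine load frequencies are the same.
    (fun q hq => coupling_eq_zero ha (by
      rw [← hω]
      funext j
      unfold electricω
      split_ifs with h
      · rw [hq.1]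
      · exact (P.electricNet ha).w_eq_of_sum_eq_zero (hq.2.1 ⟨j, h⟩)))
  exact stable_of_reduction (F := cascadeField ha (P.pumpHeat a xs.ω - ∑ e, P.hL e))
    ((continuous_electricProj ha).prodMk (continuous_heatProj _))
    (continuous_cascadeEmbed ha _) (fun x hx => cascadeEmbed_proj ha _ hx)
    (fun x hx => isODESolution_cascade ha _ hx)
    (fun y hy => isReducedSolution_cascadeEmbed ha _ hy) xs hex hconv

end FreqDependent

end CHPNetwork

theorem corollary1 {N E K : Type*} [Fintype N] [DecidableEq N] [Fintype E] [DecidableEq E]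
    [Fintype K] [DecidableEq K] (P : CHPNetwork N E K) (mode : HeatPumpMode N)
    (hmode : P.ModeAdmissible mode) (xs : P.State) (heq : P.IsEquilibrium mode xs)
    (hη : ∀ l : P.lines, |xs.η l| < Real.pi / 2)
    (hgen : ∀ j : P.gen, (P.genSys j).IsLocallyInputStrictlyPassive (xs.ω j) (xs.xe j) ∧
      (P.genSys j).IsAsymptoticallyStable (xs.ω j) (xs.xe j))
    (hheat : ∀ e : P.heatSrc, (P.heatSys e).IsLocallyInputStrictlyPassive (P.Tbar xs) (xs.xh e) ∧
      (P.heatSys e).IsAsymptoticallyStable (P.Tbar xs) (xs.xh e)) :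
    ∃ U : Set P.State, IsOpen U ∧ xs ∈ U ∧
      (∀ x₀ ∈ U, P.IsConsistent mode x₀ →
        ∃ x : ℝ → P.State, P.IsSolution mode x ∧ x 0 = x₀) ∧
      ∀ x : ℝ → P.State, P.IsSolution mode x → x 0 ∈ U →
        ∃ y : P.State, P.IsEquilibrium mode y ∧ Tendsto x atTop (𝓝 y) := by
  cases mode with
  | freqDependent a => exact P.stable_freqDependent hmode xs heq hη hgen hheat
  | converterLinked m => exact P.stable_converterLinked hmode xs heq hη hgen hheat
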